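/- Let $K$ be a nonarchimedean, nontrivially normed field with additive value group $A=\{-\log|x| : x\in K^\times\}\subset\mathbb{R}$. Let $\Gamma$ be a connected metric graph with underlying finite graph $G$ (loops and multiple edges allowed, with a fixed orientation of each edge), vertex weights $g_w\in\mathbb{Z}_{\ge 0}$ and edge lengths $\ell(e)>0$ in $A$ (for instance, the skeleton of a semistable curve with dual graph $G$). Let $H:V(G)\to\mathbb{Z}_{>0}$ (the multidegree of a polarization), let $d\in\mathbb{Z}$, and let $v,v'$ be vertices. *Torus.* Let $\Omega(\Gamma)$ be the space of harmonic $1$-forms $\omega=\sum_e\omega_e\,de$, with integration pairing $\int_{e'}de=\ell(e)\delta_{e,e'}$. For a chain $c$, write $\int_c\in\Omega(\Gamma)^*$. Put $\Lambda=\{\int_u : u\in H_1(G,\mathbb{Z})\}$ and $\Lambda^*=\{\int_w : w\in H_1(G,\mathbb{R}),\ \sum_e \ell(e)u_ew_e\in\mathbb{Z}\ \forall u\in H_1(G,\mathbb{Z})\}$, and let $\Sigma=\Omega(\Gamma)^*/\Lambda$. Let $\mathrm{Pic}^d(\Gamma)$ be the set of divisors of degree $d$ on $\Gamma$ modulo divisors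 of piecewise linear functions with integer slopes (the coefficient at a point being the sum of the outgoing slopes). *Types.* A type of degree $d$ is a pair $(S,\underline d)$ with $S\subset E(G)$, $\underline d:V(G)\to\mathbb{Z}$ and $|S|+\sum_w\underline d_w=d$. A divisor on $\Gamma$ is of type $(S,\underline d)$ if it is the sum of $\underline d$ and one point in the interior of each edge in $S$. For $Y\subset W\subset V(G)$, $Y\neq\emptyset$, let $E(Y)$ be the set of edges with both ends in $Y$ and $$m_W(Y)=\frac{\sum_{w\in Y}\underline d_w+|S\cap E(Y)|-|\{e\notin S \text{ joining } Y \text{ and } W\smallsetminus Y\}|+1-g(Y)}{\sum_{w\in Y}H_w},\qquad g(Y)=\sum_{w\in Y}g_w+|E(Y)|-|Y|+1,$$ which is the slope of the subsheaf $F_Y$ of sections supported on $Y$, for a rank 1 torsion free sheaf $F$ of type $(S,\underline d)$ on the subcurve $W$ of a nodal curve with dual graph $G$. The type is *stable on* $W\ne\emptyset$ if $m_W(Y)<m_W(W)$ for all $\emptyset\neq Y\subsetneq W$. It is *semistable* if $m_V(Y)\le m_V(V)$ for all $\emptyset\ne Y\subsetneq V=V(G)$, and *$v$-quasistable* if moreover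 $m_V(Y)=m_V(V)$ implies $v\notin Y$. It is *polystable* if it is semistable and equals the type of the graded sheaf $\mathrm{Gr}(F)=\bigoplus_j F_{Z_{j}}/F_{Z_{j-1}}$ of a Jordan–Hölder filtration, given by a chain $\emptyset=Z_0\subsetneq\dots\subsetneq Z_k=V$ whose quotients $F_{Z_j}/F_{Z_{j-1}}$ are stable on $Z_j\smallsetminus Z_{j-1}$ of slope $m_V(V)$. Here $\mathrm{Gr}(F)$ has as its set of nodes $S$ together with all edges between different pieces $Z_j\smallsetminus Z_{j-1}$, and its multidegree at $w\in Z_j\smallsetminus Z_{j-1}$ is $\underline d_w$ minus the number of edges not in $S$ from $w$ to $V\smallsetminus Z_j$. *Polytopal decompositions.* Fix a linear isomorphism $\Omega(\Gamma)^*\cong\mathbb{R}^n$ carrying $\Lambda^*$ onto $\mathbb{Z}^n$. An admissible polytope is a nonempty bounded intersection of finitely many half spaces $\{u:\langle u,w\rangle\ge a\}$ with $w\in\mathbb{Z}^n$, $a\in A$. An admissible $\Lambda$-periodic polytopal decomposition of $\mathbb{R}^n$ is a locally finite collection $\Delta$ of admissible polytopes that covers $\mathbb{R}^n$, contains every nonempty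 face of each member, is such that the intersection of any two members is empty or a common face of both, is invariant under translation by $\Lambda$, and has finitely many $\Lambda$-orbits. An admissible polytopal decomposition of $\Sigma$ is the collection of images in $\Sigma$ of the members of such a $\Delta$. **Proposition.** Sending the class of $\sum_i a_ix_i$ to $\sum_i a_i\int_{v'}^{x_i}$ modulo $\Lambda$, for any choice of paths in $\Gamma$ from $v'$ to the $x_i$, gives a well defined bijection $\mathrm{Pic}^d(\Gamma)\cong\Sigma$. Let $\theta_{S,\underline d}\subset\Sigma$ be the closure of the image of the set of classes of divisors of type $(S,\underline d)$. Then $$\Delta_{\mathrm{ps}}=\{\theta_{S,\underline d} : (S,\underline d)\text{ is a polystable type of degree } d\},\qquad \Delta_{\mathrm{qs}}=\{\theta_{S,\underline d} : (S,\underline d)\text{ is a } v\text{-quasistable type of degree } d\}$$ are admissible polytopal decompositions of $\Sigma$. (They are called the generalized Namikawa decompositions.) -/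

import Mathlib

/-- The additive value group of a nonarchimedean normed field `K`: the set of all `-log ‖x‖`
for `x ∈ Kˣ`. -/
def valueGroup (K : Type*) [NormedField K] : AddSubgroup ℝ where
  carrier := {a | ∃ x : K, x ≠ 0 ∧ a = -Real.log ‖x‖}
  zero_mem' := ⟨1, one_ne_zero, by simp⟩
  add_mem' := by
    rintro _ _ ⟨x, hx, rfl⟩ ⟨y, hy, rfl⟩
    refine ⟨x * y, mul_ne_zero hx hy, ?_⟩
    rw [norm_mul, Real.log_mul (norm_ne_zero_iff.mpr hx) (norm_ne_zero_iff.mpr hy)]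
    ring
  neg_mem' := by
    rintro _ ⟨x, hx, rfl⟩
    exact ⟨x⁻¹, inv_ne_zero hx, by rw [norm_inv, Real.log_inv]⟩

/-- A metric graph with vertex weights: a multigraph with vertices `V` and edges `E` (loops and
multiple edges allowed), with an auxiliary orientation of each edge, a nonnegative integer
`genus v` at each vertex (the geometric genus of the component of a nodal curve having this dual
graph), and a positive length for each edge. -/
structure MetricGraph (V E : Type*) where
  src : E → V
  tgt : E → V
  genus : V → ℕ
  len : E → ℝ
  len_pos : ∀ e, 0 < len e

namespace MetricGraph

section Paths

variable {V E : Type*} [DecidableEq E]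

/-- `Γ.IsPathChain u w ξ`: the integral 1-chain `ξ` is the chain of an edge path from the vertex
`u` to the vertex `w`. -/
inductive IsPathChain (Γ : MetricGraph V E) (u : V) : V → (E → ℤ) → Prop
  | nil : IsPathChain Γ u u 0
  | forward (e : E) (ξ : E → ℤ) (h : IsPathChain Γ u (Γ.src e) ξ) :
      IsPathChain Γ u (Γ.tgt e) (ξ + Pi.single e 1)
  | backward (e : E) (ξ : E → ℤ) (h : IsPathChain Γ u (Γ.tgt e) ξ) :
      IsPathChain Γ u (Γ.src e) (ξ - Pi.single e 1)

/-- Any two vertices are joined by an edge path. -/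
def Connected (Γ : MetricGraph V E) : Prop :=
  ∀ u w : V, ∃ ξ : E → ℤ, Γ.IsPathChain u w ξ

/-- The points of the metric graph: its vertices, and the points in the interior of an edge `e`,
given by their distance `t ∈ (0, len e)` from the source of `e`. -/
abbrev Point (Γ : MetricGraph V E) : Type _ := V ⊕ (Σ e : E, Set.Ioo (0 : ℝ) (Γ.len e))

/-- `Γ.IsPathTo v' x c`: the real 1-chain `c` is the chain of a path from the vertex `v'` to the
point `x` of the metric graph. A path to an interior point of `e` is an edge path to the source of
`e` followed by the initial segment of length `t` of `e` (this includes paths entering through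
the target of `e`, up to backtracking). -/
def IsPathTo (Γ : MetricGraph V E) (v' : V) : Γ.Point → (E → ℝ) → Prop
  | Sum.inl w, c => ∃ ξ : E → ℤ, Γ.IsPathChain v' w ξ ∧ c = fun e => (ξ e : ℝ)
  | Sum.inr ⟨e, t⟩, c => ∃ ξ : E → ℤ, Γ.IsPathChain v' (Γ.src e) ξ ∧
      c = (fun e' => (ξ e' : ℝ)) + Pi.single e ((t : ℝ) / Γ.len e)

end Paths

section Divisors

variable {V E : Type*}

/-- The point at distance `t` from the source of `e` along `e`. -/
noncomputable def edgePoint (Γ : MetricGraph V E) (e : E) (t : ℝ) : Γ.Point :=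
  if h0 : 0 < t then
    if h1 : t < Γ.len e then Sum.inr ⟨e, t, h0, h1⟩ else Sum.inl (Γ.tgt e)
  else Sum.inl (Γ.src e)

/-- Divisors on the metric graph: finite formal sums of points. -/
abbrev Divisor (Γ : MetricGraph V E) : Type _ := Γ.Point →₀ ℤ

/-- The degree of a divisor. -/
def degree (Γ : MetricGraph V E) (D : Γ.Divisor) : ℤ := D.sum fun _ a => a

/-- `f` is a (continuous) piecewise linear function with integer slopes on the metric graph, with
slope `σ e t` at the point `t ∈ [0, len e)` of `e` in the direction away from the source, and
slope `τ e t` at the point `t ∈ (0, len e]` of `e` in the direction away from the target.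
(Finiteness of the number of linear pieces is automatic by compactness of the edges.) -/
def IsPiecewiseLinear (Γ : MetricGraph V E) (f : Γ.Point → ℝ) (σ τ : E → ℝ → ℤ) : Prop :=
  (∀ e, ∀ t ∈ Set.Ico 0 (Γ.len e), ∀ᶠ s in nhdsWithin t (Set.Ioi t),
    f (Γ.edgePoint e s) = f (Γ.edgePoint e t) + σ e t * (s - t)) ∧
  (∀ e, ∀ t ∈ Set.Ioc 0 (Γ.len e), ∀ᶠ s in nhdsWithin t (Set.Iio t),
    f (Γ.edgePoint e s) = f (Γ.edgePoint e t) + τ e t * (t - s))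

variable [DecidableEq V] [Fintype E]

/-- `D` is the divisor of `f`: its coefficient at each point is the sum of the outgoing slopes. -/
def IsDivisorOf (Γ : MetricGraph V E) (D : Γ.Divisor) (σ τ : E → ℝ → ℤ) : Prop :=
  (∀ v : V, D (Sum.inl v) =
    ∑ e with Γ.src e = v, σ e 0 + ∑ e with Γ.tgt e = v, τ e (Γ.len e)) ∧
  (∀ (e : E) (t : Set.Ioo (0 : ℝ) (Γ.len e)), D (Sum.inr ⟨e, t⟩) = σ e t + τ e t)

/-- The group of principal divisors: divisors of piecewise linear functions with integer slopes. -/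
def principal (Γ : MetricGraph V E) : AddSubgroup Γ.Divisor where
  carrier := {D | ∃ (f : Γ.Point → ℝ) (σ τ : E → ℝ → ℤ),
    Γ.IsPiecewiseLinear f σ τ ∧ Γ.IsDivisorOf D σ τ}
  zero_mem' := ⟨0, 0, 0, by simp [IsPiecewiseLinear], by simp [IsDivisorOf]⟩
  add_mem' := by
    rintro D D' ⟨f, σ, τ, ⟨h1, h2⟩, h3, h4⟩ ⟨f', σ', τ', ⟨h1', h2'⟩, h3', h4'⟩
    refine ⟨f + f', σ + σ', τ + τ', ⟨fun e t ht => ?_, fun e t ht => ?_⟩, fun v => ?_,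
      fun e t => ?_⟩
    · filter_upwards [h1 e t ht, h1' e t ht] with s hs hs'
      simp only [Pi.add_apply, hs, hs']
      push_cast
      ring
    · filter_upwards [h2 e t ht, h2' e t ht] with s hs hs'
      simp only [Pi.add_apply, hs, hs']
      push_cast
      ring
    · simp only [Finsupp.add_apply, h3, h3', Pi.add_apply, Finset.sum_add_distrib]
      ring
    · simp only [Finsupp.add_apply, h4, h4', Pi.add_apply]
      ring
  neg_mem' := by
    rintro D ⟨f, σ, τ, ⟨h1, h2⟩, h3, h4⟩
    refine ⟨-f, -σ, -τ, ⟨fun e t ht => ?_, fun e t ht => ?_⟩, fun v => ?_, fun e t => ?_⟩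
    · filter_upwards [h1 e t ht] with s hs
      simp only [Pi.neg_apply, hs]
      push_cast
      ring
    · filter_upwards [h2 e t ht] with s hs
      simp only [Pi.neg_apply, hs]
      push_cast
      ring
    · simp only [Finsupp.neg_apply, h3, Pi.neg_apply, Finset.sum_neg_distrib]
      ring
    · simp only [Finsupp.neg_apply, h4, Pi.neg_apply]
      ring

/-- Divisor classes modulo linear equivalence. -/
abbrev Pic (Γ : MetricGraph V E) : Type _ := Γ.Divisor ⧸ Γ.principal

/-- `Pic^d(Γ)`: the classes of divisors of degree `d`. -/
abbrev PicDeg (Γ : MetricGraph V E) (d : ℤ) : Type _ :=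
  {c : Γ.Pic // ∃ D : Γ.Divisor, Γ.degree D = d ∧ (D : Γ.Pic) = c}

/-- `D` is of type `(S, m)`: it is the sum of the divisor `m` supported on the vertices and of one
point in the interior of each edge in `S`. -/
def IsOfType (Γ : MetricGraph V E) [Fintype V] (S : Finset E) (m : V → ℤ) (D : Γ.Divisor) : Prop :=
  ∃ t : ∀ e, Set.Ioo (0 : ℝ) (Γ.len e),
    D = ∑ v, Finsupp.single (Sum.inl v) (m v) + ∑ e ∈ S, Finsupp.single (Sum.inr ⟨e, t e⟩) 1

end Divisors

section Jacobian

variable {V E : Type*} [DecidableEq V] [Fintype E]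

/-- The boundary map `C_1(G, R) → C_0(G, R)`. -/
def boundary (Γ : MetricGraph V E) (R : Type*) [CommRing R] : (E → R) →ₗ[R] (V → R) where
  toFun c v := ∑ e with Γ.tgt e = v, c e - ∑ e with Γ.src e = v, c e
  map_add' c c' := by
    ext v
    simp only [Pi.add_apply, Finset.sum_add_distrib]
    ring
  map_smul' r c := by
    ext v
    simp only [Pi.smul_apply, smul_eq_mul, ← Finset.mul_sum, RingHom.id_apply]
    ring

/-- First homology `H_1(G, R)`. -/
def homology (Γ : MetricGraph V E) (R : Type*) [CommRing R] : Submodule R (E → R) :=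
  LinearMap.ker (Γ.boundary R)

/-- The space `Ω(Γ)` of harmonic 1-forms `∑ ω_e de`: the outgoing coefficients at every vertex sum
to zero. -/
def harmonicForms (Γ : MetricGraph V E) : Submodule ℝ (E → ℝ) where
  carrier := {ω | ∀ v, ∑ e with Γ.src e = v, ω e + ∑ e with Γ.tgt e = v, -ω e = 0}
  zero_mem' := by simp
  add_mem' := by
    intro a b ha hb v
    have h1 := ha v
    have h2 := hb v
    simp only [Pi.add_apply, Finset.sum_add_distrib, Finset.sum_neg_distrib] at *
    linarith
  smul_mem' := by
    intro r a ha v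
    have h1 := ha v
    simp only [Pi.smul_apply, smul_eq_mul, Finset.sum_neg_distrib, ← Finset.mul_sum] at *
    linear_combination r * h1

/-- The dual space `Ω(Γ)^*`. -/
abbrev Dual (Γ : MetricGraph V E) : Type _ := StrongDual ℝ Γ.harmonicForms

/-- Integration of harmonic 1-forms along a real 1-chain, where `∫_e de = len e`. -/
noncomputable def integral (Γ : MetricGraph V E) (c : E → ℝ) : Γ.Dual :=
  LinearMap.toContinuousLinearMap
    { toFun := fun ω => ∑ e, c e * (ω : E → ℝ) e * Γ.len e
      map_add' := fun ω η => by
        simp only [Submodule.coe_add, Pi.add_apply, mul_add, add_mul, Finset.sum_add_distrib]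
      map_smul' := fun r ω => by
        simp only [Submodule.coe_smul, Pi.smul_apply, smul_eq_mul, RingHom.id_apply,
          Finset.mul_sum]
        exact Finset.sum_congr rfl fun e _ => by ring }

/-- The lattice `Λ ⊆ Ω(Γ)^*` of integrals along integral cycles. -/
noncomputable def periodLattice (Γ : MetricGraph V E) : AddSubgroup Γ.Dual where
  carrier := {x | ∃ u ∈ Γ.homology ℤ, x = Γ.integral fun e => (u e : ℝ)}
  zero_mem' := ⟨0, zero_mem _, by ext ω; simp [integral]⟩
  add_mem' := by
    rintro _ _ ⟨u, hu, rfl⟩ ⟨w, hw, rfl⟩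
    refine ⟨u + w, add_mem hu hw, ?_⟩
    ext ω
    simp [integral, add_mul, Finset.sum_add_distrib]
  neg_mem' := by
    rintro _ ⟨u, hu, rfl⟩
    refine ⟨-u, neg_mem hu, ?_⟩
    ext ω
    simp [integral]

/-- The lattice `Λ^* ⊆ Ω(Γ)^*`: integrals along real cycles whose edge length pairing with every
integral cycle is an integer. -/
def dualLattice (Γ : MetricGraph V E) : Set Γ.Dual :=
  {x | ∃ w ∈ Γ.homology ℝ, x = Γ.integral w ∧
    ∀ u ∈ Γ.homology ℤ, ∃ m : ℤ, ∑ e, (u e : ℝ) * w e * Γ.len e = m}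

/-- The real torus `Σ = Ω(Γ)^* / Λ`, with the quotient topology. -/
abbrev Torus (Γ : MetricGraph V E) : Type _ := Γ.Dual ⧸ Γ.periodLattice

/-- `ι` is the identification of `Pic^d(Γ)` with the torus given by the base vertex `v'`: the class
of `∑ a_x x` is sent to `∑ a_x ∫_{v'}^x` modulo `Λ`, for any choice of paths from `v'` to the
points `x`. -/
def IsAbelJacobi [DecidableEq E] (Γ : MetricGraph V E) (v' : V) {d : ℤ}
    (ι : Γ.PicDeg d ≃ Γ.Torus) : Prop :=
  ∀ (c : Γ.PicDeg d) (D : Γ.Divisor), Γ.degree D = d → (D : Γ.Pic) = c →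
    ∀ p : Γ.Point → (E → ℝ), (∀ x, Γ.IsPathTo v' x (p x)) →
      ι c = ((D.sum fun x a => a • Γ.integral (p x) : Γ.Dual) : Γ.Torus)

/-- The set of classes of divisors of type `(S, m)` in `Pic^d(Γ)`. -/
def thetaOpen [Fintype V] (Γ : MetricGraph V E) (d : ℤ) (S : Finset E) (m : V → ℤ) :
    Set (Γ.PicDeg d) :=
  {c | ∃ D : Γ.Divisor, Γ.IsOfType S m D ∧ (D : Γ.Pic) = c}

/-- The closure of the set of classes of divisors of type `(S, m)`, where `Pic^d(Γ)` is identified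
with the torus through `ι`. -/
def theta [Fintype V] (Γ : MetricGraph V E) {d : ℤ} (ι : Γ.PicDeg d ≃ Γ.Torus)
    (S : Finset E) (m : V → ℤ) : Set Γ.Torus :=
  closure (ι '' Γ.thetaOpen d S m)

end Jacobian

/-! Slope stability of types. A pair `(S, m)` with `S` a set of edges and `m` a divisor on the
vertices is the type of a rank 1 torsion free sheaf on a nodal curve with dual graph `G`: `S` is
the set of nodes where the sheaf is not locally free, and `m` is its multidegree. Subcurves
correspond to sets of vertices. `H` is the multidegree of the polarization. -/

section Stability

variable {V E : Type*} [DecidableEq V] [Fintype E] [DecidableEq E]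

/-- Edges with both ends in `Y`: the nodes of the subcurve `Y`. -/
def edgesIn (Γ : MetricGraph V E) (Y : Finset V) : Finset E :=
  {e | Γ.src e ∈ Y ∧ Γ.tgt e ∈ Y}

/-- Edges joining `Y` and `Z` (used for disjoint `Y`, `Z`). -/
def edgesBetween (Γ : MetricGraph V E) (Y Z : Finset V) : Finset E :=
  {e | (Γ.src e ∈ Y ∧ Γ.tgt e ∈ Z) ∨ (Γ.src e ∈ Z ∧ Γ.tgt e ∈ Y)}

/-- The arithmetic genus of the subcurve `Y`. -/
def arithGenus (Γ : MetricGraph V E) (Y : Finset V) : ℤ :=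
  ∑ v ∈ Y, (Γ.genus v : ℤ) + (Γ.edgesIn Y).card - Y.card + 1

/-- For a sheaf `F` of type `(S, m)` on the subcurve `W` and a subcurve `Y ⊆ W`, the degree of the
subsheaf `F_Y` of sections supported on `Y`. -/
def subsheafDegree (Γ : MetricGraph V E) (S : Finset E) (m : V → ℤ) (W Y : Finset V) : ℤ :=
  ∑ v ∈ Y, m v + (S ∩ Γ.edgesIn Y).card - (Γ.edgesBetween Y (W \ Y) \ S).card

/-- The slope of `F_Y`, for `F` of type `(S, m)` on the subcurve `W` and `Y ⊆ W`; in particular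
the slope of `F` itself for `Y = W`. -/
def slope (Γ : MetricGraph V E) (H : V → ℤ) (S : Finset E) (m : V → ℤ) (W Y : Finset V) : ℚ :=
  ((Γ.subsheafDegree S m W Y + 1 - Γ.arithGenus Y : ℤ) : ℚ) / ((∑ v ∈ Y, H v : ℤ) : ℚ)

/-- Stability of sheaves of type `(S, m)` on the subcurve `W`. -/
def IsStableOn (Γ : MetricGraph V E) (H : V → ℤ) (S : Finset E) (m : V → ℤ) (W : Finset V) :
    Prop :=
  ∀ Y : Finset V, Y.Nonempty → Y ⊂ W → Γ.slope H S m W Y < Γ.slope H S m W W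

variable [Fintype V]

/-- Semistability of the type `(S, m)`. -/
def IsSemistable (Γ : MetricGraph V E) (H : V → ℤ) (S : Finset E) (m : V → ℤ) : Prop :=
  ∀ Y : Finset V, Y.Nonempty → Y ⊂ Finset.univ →
    Γ.slope H S m Finset.univ Y ≤ Γ.slope H S m Finset.univ Finset.univ

/-- `v`-quasistability of the type `(S, m)`. -/
def IsQuasistable (Γ : MetricGraph V E) (H : V → ℤ) (v : V) (S : Finset E) (m : V → ℤ) : Prop :=
  Γ.IsSemistable H S m ∧ ∀ Y : Finset V, Y.Nonempty → Y ⊂ Finset.univ →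
    Γ.slope H S m Finset.univ Y = Γ.slope H S m Finset.univ Finset.univ → v ∉ Y

/-- A filtration of `F` with torsion free quotients is given by a chain of subcurves
`∅ = Z_0 ⊂ Z_1 ⊂ ⋯ ⊂ Z_k = X` through `F_j = F_{Z_j}`; it is encoded by the map `step`, with
`Z_j = {v | step v < j}`. The quotient `F_{j+1} / F_j` lives on the subcurve `{v | step v = j}`.
This is the multidegree of `⨁ F_{j+1} / F_j`: sections of `F_{j+1}` vanish along the nodes,
outside `S`, that lead to components outside `Z_{j+1}`. -/
def gradedDegree (Γ : MetricGraph V E) {k : ℕ} (step : V → Fin k) (S : Finset E) (m : V → ℤ)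
    (v : V) : ℤ :=
  m v - (Finset.card {e : E | e ∉ S ∧ ((Γ.src e = v ∧ step v < step (Γ.tgt e)) ∨
    (Γ.tgt e = v ∧ step v < step (Γ.src e)))} : ℤ)

/-- The nodes at which `⨁ F_{j+1} / F_j` is not locally free. -/
def gradedNodes (Γ : MetricGraph V E) {k : ℕ} (step : V → Fin k) (S : Finset E) : Finset E :=
  S ∪ ({e | step (Γ.src e) ≠ step (Γ.tgt e)} : Finset E)

/-- `step` gives a Jordan–Hölder filtration of the sheaves of type `(S, m)`: its successive
quotients are nonzero and stable, of the same slope as the sheaf. -/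
def IsJordanHolder (Γ : MetricGraph V E) (H : V → ℤ) (S : Finset E) (m : V → ℤ) {k : ℕ}
    (step : V → Fin k) : Prop :=
  Function.Surjective step ∧ ∀ j : Fin k,
    Γ.IsStableOn H S (Γ.gradedDegree step S m) ({v | step v = j} : Finset V) ∧
    Γ.slope H S (Γ.gradedDegree step S m) ({v | step v = j} : Finset V)
      ({v | step v = j} : Finset V) = Γ.slope H S m Finset.univ Finset.univ

/-- Polystability of the type `(S, m)`: a sheaf `F` of this type is semistable and isomorphic to
the graded sheaf `Gr(F)` of a Jordan–Hölder filtration. (`F ≅ Gr(F)` if and only if they have the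
same type: in that case every node joining two different pieces of the filtration is in `S`,
so that `F` is the direct sum of its restrictions to these pieces.) -/
def IsPolystable (Γ : MetricGraph V E) (H : V → ℤ) (S : Finset E) (m : V → ℤ) : Prop :=
  Γ.IsSemistable H S m ∧ ∃ (k : ℕ) (step : V → Fin k), Γ.IsJordanHolder H S m step ∧
    Γ.gradedNodes step S = S ∧ Γ.gradedDegree step S m = m

variable {d : ℤ}

/-- The closures `θ_{S, m}` for the polystable types `(S, m)` of degree `|S| + deg m = d`. -/
def polystableCells (Γ : MetricGraph V E) (H : V → ℤ) (ι : Γ.PicDeg d ≃ Γ.Torus) :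
    Set (Set Γ.Torus) :=
  {T | ∃ (S : Finset E) (m : V → ℤ), (S.card : ℤ) + ∑ v, m v = d ∧
    Γ.IsPolystable H S m ∧ T = Γ.theta ι S m}

/-- The closures `θ_{S, m}` for the `v`-quasistable types `(S, m)` of degree `|S| + deg m = d`. -/
def quasistableCells (Γ : MetricGraph V E) (H : V → ℤ) (v : V) (ι : Γ.PicDeg d ≃ Γ.Torus) :
    Set (Set Γ.Torus) :=
  {T | ∃ (S : Finset E) (m : V → ℤ), (S.card : ℤ) + ∑ v, m v = d ∧
    Γ.IsQuasistable H v S m ∧ T = Γ.theta ι S m}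

end Stability

end MetricGraph

/-- An admissible polytope in `ℝⁿ` with respect to the value group `A`: a nonempty bounded
intersection of finitely many half spaces `{u | ⟨u, w⟩ ≥ a}` with `w ∈ ℤⁿ` and `a ∈ A`. -/
def IsAdmissiblePolytope (A : AddSubgroup ℝ) {n : ℕ} (Q : Set (Fin n → ℝ)) : Prop :=
  Q.Nonempty ∧ Bornology.IsBounded Q ∧
    ∃ s : Finset ((Fin n → ℤ) × ℝ), (∀ h ∈ s, h.2 ∈ A) ∧
      Q = {u | ∀ h ∈ s, h.2 ≤ ∑ i, u i * (h.1 i : ℝ)}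

/-- `F` is a (nonempty) face of the polytope `Q`: the locus in `Q` where some linear functional
attains its maximum over `Q`. -/
def IsFaceOf {n : ℕ} (F Q : Set (Fin n → ℝ)) : Prop :=
  F.Nonempty ∧ ∃ l : (Fin n → ℝ) →ₗ[ℝ] ℝ, F = {x ∈ Q | ∀ y ∈ Q, l y ≤ l x}

/-- An admissible `Λ`-periodic polytopal decomposition of `ℝⁿ`. -/
structure IsAdmissiblePeriodicDecomposition (A : AddSubgroup ℝ) {n : ℕ}
    (Λ : AddSubgroup (Fin n → ℝ)) (Δ : Set (Set (Fin n → ℝ))) : Prop where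
  admissible : ∀ Q ∈ Δ, IsAdmissiblePolytope A Q
  locallyFinite : LocallyFinite fun Q : Δ => (Q : Set (Fin n → ℝ))
  cover : ⋃₀ Δ = Set.univ
  face_mem : ∀ Q ∈ Δ, ∀ F, IsFaceOf F Q → F ∈ Δ
  inter : ∀ Q ∈ Δ, ∀ Q' ∈ Δ, Q ∩ Q' = ∅ ∨ (IsFaceOf (Q ∩ Q') Q ∧ IsFaceOf (Q ∩ Q') Q')
  translate_mem : ∀ w ∈ Λ, ∀ Q ∈ Δ, (fun x => x + w) '' Q ∈ Δ
  finite_orbits : ∃ T ⊆ Δ, T.Finite ∧ ∀ Q ∈ Δ, ∃ Q' ∈ T, ∃ w ∈ Λ, Q = (fun x => x + w) '' Q'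

/-- An admissible polytopal decomposition of the torus `Σ = Ω(Γ)^* / Λ`, in the coordinates
`φ : Ω(Γ)^* ≅ ℝⁿ`: the collection of images in `Σ` of the polytopes in an admissible
`Λ`-periodic polytopal decomposition of `ℝⁿ`. -/
def MetricGraph.IsAdmissibleTorusDecomposition {V E : Type*} [DecidableEq V] [Fintype E]
    (Γ : MetricGraph V E) (A : AddSubgroup ℝ) {n : ℕ} (φ : Γ.Dual ≃ₗ[ℝ] (Fin n → ℝ))
    (𝒟 : Set (Set Γ.Torus)) : Prop :=
  ∃ Δ : Set (Set (Fin n → ℝ)),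
    IsAdmissiblePeriodicDecomposition A (Γ.periodLattice.map φ.toAddEquiv.toAddMonoidHom) Δ ∧
    𝒟 = {T | ∃ Q ∈ Δ, T = (fun x : Γ.Dual => (x : Γ.Torus)) '' (φ ⁻¹' Q)}

/-! Harmonic forms annihilate exactly the gradients, that is, the chains `c` with `c e * len e`
equal to the increment of a vertex potential along `e`. Hence `Ω(Γ)^*` is the quotient of `ℝ^E` by
gradients. A divisor of type `(S, m)` lifts to a point of the open cube `Z + ∏_{e ∈ S} (0, 1)`,
where the integral chain `Z` has a boundary prescribed by `(S, m)` and so is unique up to integral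
cycles. Thus each `θ_{S, m}` is the image of a face of the unit cubical decomposition of `ℝ^E`, and
the question is why the stable types select faces whose projections fit together.

The selection comes from convex duality. Fix `q` on the vertices with total `0`. For a chain `z`
with boundary `q`, let `dualBox z` be the cube of all coordinatewise roundings of `z`. Here `c` is a
rounding of `z` exactly when `z` is a subgradient at `c` of the function that interpolates `t ^ 2 /
2` linearly between integers. The projected cubes are therefore the linearity domains, and their
faces, of the function on `Ω(Γ)^*` obtained by minimizing a convex piecewise linear function over
the fibres of `Γ.integral`. Monotonicity of subgradients gives the face-to-face property
(`mixedCells_inter`), a small shift of `z` along a harmonic form gives faces (`mixedCells_face`),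
and minimizing over a fibre gives covering (`mixedCells_cover`), the optimality condition being
turned into a subgradient `z` by the Gale–Hoffman theorem (`exists_flow`). The facet inequalities
come from finitely many integral cycles (`exists_finset_cycles`), which makes the cells admissible.

Stability enters through flows. The face of type `(S, m)` equals `dualBox z` for some `z` with
boundary `p - d v'` exactly when a flow with values in `(-1/2, 1/2)`, zero on `S`, carries the type
to `p` (`HasStrictFlow`). By Gale–Hoffman this is a family of cut inequalities, one for each vertex
set `Y`. For `p` the canonical weight, the slack of the cut `Y` is a positive multiple of the slope
difference `m_V(V) - m_V(Y)`, and the flow condition is polystability (`isPolystable_iff`). A small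
perturbation of `p` yields `v`-quasistability (`exists_isQuasistable_iff`). Both claims are thus
instances of `isAdmissibleTorusDecomposition_strictFlow`. The bijection with `Pic^d` is the tropical
Abel–Jacobi theorem. -/

namespace MetricGraph

/-! ### Chains, boundaries, and integration modulo gradients. -/

section Chains

variable {V E : Type*} [DecidableEq V] [Fintype E]

theorem sum_mul_boundary [Fintype V] (Γ : MetricGraph V E) {R : Type*} [CommRing R]
    (f : V → R) (c : E → R) :
    ∑ v, f v * Γ.boundary R c v = ∑ e, c e * (f (Γ.tgt e) - f (Γ.src e)) := by
  simp only [boundary, LinearMap.coe_mk, AddHom.coe_mk, mul_sub, Finset.sum_sub_distrib,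
    Finset.mul_sum, Finset.sum_filter]
  congr 1 <;>
  · rw [Finset.sum_comm]
    refine Finset.sum_congr rfl fun e _ => ?_
    simp [mul_comm]

theorem sum_boundary [Fintype V] (Γ : MetricGraph V E) {R : Type*} [CommRing R] (c : E → R) :
    ∑ v, Γ.boundary R c v = 0 := by
  simpa using Γ.sum_mul_boundary (fun _ => 1) c

theorem sum_mem_boundary [Fintype V] (Γ : MetricGraph V E) {R : Type*} [CommRing R]
    (Y : Finset V) (c : E → R) :
    ∑ v ∈ Y, Γ.boundary R c v =
      ∑ e, c e * ((if Γ.tgt e ∈ Y then 1 else 0) - (if Γ.src e ∈ Y then 1 else 0)) := by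
  rw [← Γ.sum_mul_boundary (fun v => if v ∈ Y then 1 else 0) c]
  simp

theorem boundary_intCast (Γ : MetricGraph V E) (R : Type*) [CommRing R] (ξ : E → ℤ) :
    Γ.boundary R (fun e => (ξ e : R)) = fun v => ((Γ.boundary ℤ ξ v : ℤ) : R) := by
  ext v
  simp [boundary]

theorem boundary_single [DecidableEq E] (Γ : MetricGraph V E) (R : Type*) [CommRing R] (e : E)
    (r : R) :
    Γ.boundary R (Pi.single e r) = Pi.single (Γ.tgt e) r - Pi.single (Γ.src e) r := by
  ext v
  simp only [boundary, LinearMap.coe_mk, AddHom.coe_mk, Pi.sub_apply, Finset.sum_filter,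
    Pi.single_apply]
  congr 1 <;>
  · rw [Finset.sum_eq_single e]
    · simp [eq_comm]
    · intro b _ hb; simp [hb]
    · simp

theorem IsPathChain.boundary [DecidableEq E] {Γ : MetricGraph V E} {u w : V} {ξ : E → ℤ}
    (h : Γ.IsPathChain u w ξ) : Γ.boundary ℤ ξ = Pi.single w 1 - Pi.single u 1 := by
  induction h with
  | nil => simp
  | forward e ξ h ih => rw [map_add, ih, boundary_single]; abel
  | backward e ξ h ih => rw [map_sub, ih, boundary_single]; abel

/-- Weight paths from a base vertex to each `w` by `D w`; the contributions at the base vertex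
cancel because `D` has total `0`. -/
theorem Connected.exists_boundary_eq [Fintype V] [DecidableEq E] {Γ : MetricGraph V E}
    (hΓ : Γ.Connected) {R : Type*} [CommRing R] (D : V → R) (hD : ∑ v, D v = 0) :
    ∃ c : E → R, Γ.boundary R c = D := by
  rcases isEmpty_or_nonempty V with hV | ⟨⟨v₀⟩⟩
  · exact ⟨0, Subsingleton.elim _ _⟩
  choose ξ hξ using hΓ v₀
  refine ⟨∑ w, D w • fun e => (ξ w e : R), ?_⟩
  rw [map_sum]
  simp only [map_smul, boundary_intCast, (hξ _).boundary]
  ext v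
  simp only [Finset.sum_apply, Pi.smul_apply, smul_eq_mul, Pi.sub_apply, Int.cast_sub, mul_sub,
    Finset.sum_sub_distrib]
  rw [← Finset.sum_mul, hD]
  simp [Pi.single_apply]

theorem mem_harmonicForms_iff (Γ : MetricGraph V E) (ω : E → ℝ) :
    ω ∈ Γ.harmonicForms ↔ Γ.boundary ℝ ω = 0 := by
  rw [funext_iff]
  refine forall_congr' fun v => ?_
  simp only [boundary, LinearMap.coe_mk, AddHom.coe_mk, Finset.sum_neg_distrib, Pi.zero_apply]
  constructor <;> intro h <;> linarith

theorem mem_homology_iff (Γ : MetricGraph V E) {R : Type*} [CommRing R] (c : E → R) :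
    c ∈ Γ.homology R ↔ Γ.boundary R c = 0 := Iff.rfl

theorem integral_apply (Γ : MetricGraph V E) (c : E → ℝ) (ω : Γ.harmonicForms) :
    Γ.integral c ω = ∑ e, c e * (ω : E → ℝ) e * Γ.len e := rfl

/-- Integration as a linear map on real chains. -/
noncomputable def integralMap (Γ : MetricGraph V E) : (E → ℝ) →ₗ[ℝ] Γ.Dual where
  toFun := Γ.integral
  map_add' c c' := by
    ext ω; simp [integral_apply, add_mul, Finset.sum_add_distrib]
  map_smul' r c := by
    ext ω; simp [integral_apply, Finset.mul_sum, mul_assoc]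

@[simp]
theorem integralMap_apply (Γ : MetricGraph V E) (c : E → ℝ) : Γ.integralMap c = Γ.integral c := rfl

theorem integral_surjective (Γ : MetricGraph V E) : Function.Surjective Γ.integral := by
  classical
  intro x
  obtain ⟨g, hg⟩ := LinearMap.exists_extend (x : Γ.harmonicForms →ₗ[ℝ] ℝ)
  refine ⟨fun e => g (Pi.single e 1) / Γ.len e, ?_⟩
  ext ω
  have h1 : x ω = g ω := by
    have := congrArg (fun l => l ω) hg
    simpa using this.symm
  rw [h1, integral_apply]
  conv_rhs => rw [LinearMap.pi_apply_eq_sum_univ g (ω : E → ℝ)]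
  refine Finset.sum_congr rfl fun e _ => ?_
  have := (Γ.len_pos e).ne'
  have h2 : (fun j => if e = j then (1 : ℝ) else 0) = Pi.single e 1 := by
    ext j; simp [Pi.single_apply, eq_comm]
  rw [h2]
  simp only [smul_eq_mul]
  field_simp

/-- Summation by parts: pairing a gradient with a form pairs the potential with the boundary of the
form. -/
theorem integral_gradient [Fintype V] (Γ : MetricGraph V E) (c : E → ℝ) (f : V → ℝ)
    (h : ∀ e, c e * Γ.len e = f (Γ.tgt e) - f (Γ.src e)) : Γ.integral c = 0 := by
  ext ω
  rw [integral_apply]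
  have h1 := Γ.sum_mul_boundary f (ω : E → ℝ)
  rw [(Γ.mem_harmonicForms_iff _).1 ω.2] at h1
  simp only [Pi.zero_apply, mul_zero, Finset.sum_const_zero] at h1
  rw [zero_apply, h1]
  refine Finset.sum_congr rfl fun e _ => ?_
  rw [← h e]; ring

/-- Linear functionals on `Ω(Γ)^*` are evaluations at harmonic forms. -/
theorem exists_eval_eq [Fintype V] (Γ : MetricGraph V E) (l : Γ.Dual →ₗ[ℝ] ℝ) :
    ∃ ω : Γ.harmonicForms, ∀ x : Γ.Dual, l x = x ω := by
  classical
  set g := l ∘ₗ Γ.integralMap with hg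
  have key : ∀ c : E → ℝ, g c = ∑ e, c e * (g (Pi.single e 1) / Γ.len e) * Γ.len e := by
    intro c
    conv_lhs => rw [LinearMap.pi_apply_eq_sum_univ g c]
    refine Finset.sum_congr rfl fun e _ => ?_
    have := (Γ.len_pos e).ne'
    have h2 : (fun j => if e = j then (1 : ℝ) else 0) = Pi.single e 1 := by
      ext j; simp [Pi.single_apply, eq_comm]
    rw [h2]
    simp only [smul_eq_mul]
    field_simp
  -- The representing form is harmonic because `g` kills gradients; the gradient of the indicator of
  -- `v` gives the condition at `v`.
  have hω : (fun e => g (Pi.single e 1) / Γ.len e) ∈ Γ.harmonicForms := by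
    rw [mem_harmonicForms_iff]
    ext v
    have h0 := Γ.integral_gradient
      (fun e => ((if Γ.tgt e = v then 1 else 0) - (if Γ.src e = v then 1 else 0)) / Γ.len e)
      (fun w => if w = v then 1 else 0) (fun e => by
        have := (Γ.len_pos e).ne'
        field_simp)
    have h1 := key
      (fun e => ((if Γ.tgt e = v then 1 else 0) - (if Γ.src e = v then 1 else 0)) / Γ.len e)
    rw [hg, LinearMap.comp_apply, integralMap_apply, h0, map_zero, ← hg] at h1
    simp only [boundary, LinearMap.coe_mk, AddHom.coe_mk, Finset.sum_filter, Pi.zero_apply]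
    refine Eq.trans ?_ h1.symm
    rw [← Finset.sum_sub_distrib]
    refine Finset.sum_congr rfl fun e _ => ?_
    have := (Γ.len_pos e).ne'
    field_simp
    split_ifs <;> simp <;> field_simp
  refine ⟨⟨_, hω⟩, fun x => ?_⟩
  obtain ⟨c, rfl⟩ := Γ.integral_surjective x
  rw [integral_apply]
  exact key c

end Chains

/-! ### Feasible flows with prescribed boundary. -/

section Flows

variable {V E : Type*} [DecidableEq V] [Fintype E] [Fintype V]

/-- The cut condition for indicator functions extends to all potentials. -/
theorem sum_mul_le_of_cut (Γ : MetricGraph V E) (lo hi : E → ℝ) (hlh : ∀ e, lo e ≤ hi e)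
    (b : V → ℝ) (hb : ∑ v, b v = 0)
    (hcut : ∀ Y : Finset V, ∑ v ∈ Y, b v ≤ ∑ e,
      max (hi e * ((if Γ.tgt e ∈ Y then 1 else 0) - (if Γ.src e ∈ Y then 1 else 0)))
        (lo e * ((if Γ.tgt e ∈ Y then 1 else 0) - (if Γ.src e ∈ Y then 1 else 0))))
    (f : V → ℝ) :
    ∑ v, f v * b v ≤ ∑ e, max (hi e * (f (Γ.tgt e) - f (Γ.src e)))
      (lo e * (f (Γ.tgt e) - f (Γ.src e))) := by
  rcases isEmpty_or_nonempty V with hV | hV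
  · have : IsEmpty E := ⟨fun e => hV.elim (Γ.src e)⟩
    simp
  induction hn : (Finset.univ.image f).card using Nat.strong_induction_on generalizing f with
  | _ n ih =>
  have hne : (Finset.univ.image f).Nonempty := Finset.univ_nonempty.image f
  set M := (Finset.univ.image f).max' hne with hM
  have hfM : ∀ w, f w ≤ M := fun w =>
    Finset.le_max' _ _ (Finset.mem_image_of_mem f (Finset.mem_univ w))
  have hMmem : M ∈ Finset.univ.image f := Finset.max'_mem _ _
  rcases (((Finset.univ.image f).erase M).eq_empty_or_nonempty) with he | he
  · have hc : ∀ w, f w = M := by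
      intro w
      by_contra hw
      have : f w ∈ (Finset.univ.image f).erase M :=
        Finset.mem_erase.2 ⟨hw, Finset.mem_image_of_mem f (Finset.mem_univ w)⟩
      rw [he] at this
      simp at this
    simp [hc, ← Finset.mul_sum, hb]
  set M' := ((Finset.univ.image f).erase M).max' he with hM'
  have hM'mem : M' ∈ (Finset.univ.image f).erase M := Finset.max'_mem _ _
  have hlt : M' < M := lt_of_le_of_ne
    (Finset.le_max' _ _ (Finset.mem_of_mem_erase hM'mem)) (Finset.ne_of_mem_erase hM'mem)
  have hf' : ∀ w, f w = M ∨ f w ≤ M' := by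
    intro w
    by_cases h : f w = M
    · exact Or.inl h
    · exact Or.inr (Finset.le_max' _ _ (Finset.mem_erase.2
        ⟨h, Finset.mem_image_of_mem f (Finset.mem_univ w)⟩))
  -- Layer-cake decomposition: lowering the top level set `Y` from `M` to the second largest value
  -- `M'` leaves fewer values, and `f = f' + (M - M') 1_Y`.
  set f' : V → ℝ := fun w => min (f w) M' with hf'def
  have hcard : (Finset.univ.image f').card < n := by
    rw [← hn]
    refine lt_of_le_of_lt (Finset.card_le_card (t := (Finset.univ.image f).erase M) ?_)
      (Finset.card_erase_lt_of_mem hMmem)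
    intro y hy
    obtain ⟨w, -, rfl⟩ := Finset.mem_image.1 hy
    rcases hf' w with h | h
    · simpa [hf'def, h, hlt.le] using hM'mem
    · simp only [hf'def, min_eq_left h]
      exact Finset.mem_erase.2 ⟨(h.trans_lt hlt).ne, Finset.mem_image_of_mem f (Finset.mem_univ w)⟩
  have h1 := ih _ hcard f' rfl
  set Y : Finset V := Finset.univ.filter fun w => f w = M with hY
  have h2 := mul_le_mul_of_nonneg_left (hcut Y) (sub_nonneg.2 hlt.le)
  have hdec : ∀ w, f w = f' w + (M - M') * (if w ∈ Y then 1 else 0) := by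
    intro w
    rcases hf' w with h | h
    · simp [hf'def, hY, h, hlt.le]
    · simp [hf'def, hY, (h.trans_lt hlt).ne, h]
  have hL : ∑ v, f v * b v = ∑ v, f' v * b v + (M - M') * ∑ v ∈ Y, b v := by
    rw [Finset.mul_sum, ← Finset.sum_filter_add_sum_filter_not Finset.univ (fun w => w ∈ Y)
      (fun v => f v * b v), ← Finset.sum_filter_add_sum_filter_not Finset.univ (fun w => w ∈ Y)
      (fun v => f' v * b v)]
    have : Finset.univ.filter (fun w => w ∈ Y) = Y := by ext; simp
    rw [this, add_right_comm, ← Finset.sum_add_distrib]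
    congr 1
    · refine Finset.sum_congr rfl fun w hw => ?_
      rw [hdec w, if_pos hw]; ring
    · refine Finset.sum_congr rfl fun w hw => ?_
      rw [hdec w, if_neg (Finset.mem_filter.1 hw).2]; ring
  -- Along any edge the increments of `f'` and of `1_Y` never have opposite signs, so the same
  -- branch of each maximum applies.
  have hR : ∀ e, max (hi e * (f' (Γ.tgt e) - f' (Γ.src e))) (lo e * (f' (Γ.tgt e) - f' (Γ.src e)))
      + (M - M') *
      max (hi e * ((if Γ.tgt e ∈ Y then 1 else 0) - (if Γ.src e ∈ Y then 1 else 0)))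
        (lo e * ((if Γ.tgt e ∈ Y then 1 else 0) - (if Γ.src e ∈ Y then 1 else 0))) ≤
      max (hi e * (f (Γ.tgt e) - f (Γ.src e))) (lo e * (f (Γ.tgt e) - f (Γ.src e))) := by
    intro e
    have hd := hlt
    have hle : ∀ w, f' w ≤ M' := fun w => min_le_right _ _
    have hYm : ∀ w, w ∈ Y → f' w = M' := by
      intro w hw
      have : f w = M := (Finset.mem_filter.1 hw).2
      simp [hf'def, this, hlt.le]
    rw [hdec (Γ.tgt e), hdec (Γ.src e)]
    have hl := hlh e
    by_cases ht : Γ.tgt e ∈ Y <;> by_cases hs : Γ.src e ∈ Y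
    · simp [ht, hs]
    · simp only [ht, hs, if_true, if_false, sub_zero, mul_one, mul_zero, add_zero]
      have h3 := hle (Γ.src e)
      rw [hYm _ ht, max_eq_left (mul_le_mul_of_nonneg_right hl (by linarith)), max_eq_left hl,
        max_eq_left (mul_le_mul_of_nonneg_right hl (by linarith))]
      linarith
    · simp only [ht, hs, if_true, if_false, zero_sub, mul_one, mul_zero, add_zero]
      have h3 := hle (Γ.tgt e)
      rw [hYm _ hs, max_eq_right (mul_le_mul_of_nonpos_right hl (by linarith)),
        max_eq_right (by linarith), max_eq_right (mul_le_mul_of_nonpos_right hl (by linarith))]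
      linarith
    · simp [ht, hs]
  rw [hL]
  refine (add_le_add h1 h2).trans ?_
  rw [Finset.mul_sum, ← Finset.sum_add_distrib]
  exact Finset.sum_le_sum fun e _ => hR e

/-- Feasibility of flows with prescribed boundary (Gale, Hoffman). -/
theorem exists_flow (Γ : MetricGraph V E) (lo hi : E → ℝ) (hlh : ∀ e, lo e ≤ hi e)
    (b : V → ℝ) (hb : ∑ v, b v = 0)
    (hcut : ∀ Y : Finset V, ∑ v ∈ Y, b v ≤ ∑ e,
      max (hi e * ((if Γ.tgt e ∈ Y then 1 else 0) - (if Γ.src e ∈ Y then 1 else 0)))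
        (lo e * ((if Γ.tgt e ∈ Y then 1 else 0) - (if Γ.src e ∈ Y then 1 else 0)))) :
    ∃ y : E → ℝ, (∀ e, lo e ≤ y e ∧ y e ≤ hi e) ∧ Γ.boundary ℝ y = b := by
  by_contra hcon
  have hK : IsCompact (Γ.boundary ℝ '' Set.Icc lo hi) :=
    isCompact_Icc.image (LinearMap.continuous_of_finiteDimensional _)
  have hconv : Convex ℝ (Γ.boundary ℝ '' Set.Icc lo hi) :=
    (convex_Icc lo hi).linear_image _
  have hbK : b ∉ Γ.boundary ℝ '' Set.Icc lo hi := by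
    rintro ⟨y, hy, rfl⟩
    exact hcon ⟨y, fun e => ⟨hy.1 e, hy.2 e⟩, rfl⟩
  -- A functional separating `b` from the boundaries of admissible flows is a vertex potential `f`,
  -- and it will violate the cut condition extended to potentials.
  obtain ⟨l, u, h1, h2⟩ := geometric_hahn_banach_closed_point hconv hK.isClosed hbK
  set f : V → ℝ := fun v => l (Pi.single v 1) with hf
  have hl : ∀ x : V → ℝ, l x = ∑ v, f v * x v := by
    intro x
    have := LinearMap.pi_apply_eq_sum_univ (l : (V → ℝ) →ₗ[ℝ] ℝ) x
    simp only [ContinuousLinearMap.coe_coe] at this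
    rw [this]
    refine Finset.sum_congr rfl fun v _ => ?_
    have h2 : (fun j => if v = j then (1 : ℝ) else 0) = Pi.single v 1 := by
      ext j; simp [Pi.single_apply, eq_comm]
    rw [h2, smul_eq_mul, mul_comm]
  -- The corner of the box that maximizes the pairing of the boundary with `f`.
  set y : E → ℝ := fun e => if 0 ≤ f (Γ.tgt e) - f (Γ.src e) then hi e else lo e with hy
  have hyI : y ∈ Set.Icc lo hi := by
    constructor <;> intro e <;> simp only [hy] <;> split_ifs <;> simp [hlh e]
  have h3 := h1 _ ⟨y, hyI, rfl⟩
  rw [hl, sum_mul_boundary] at h3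
  rw [hl] at h2
  have h4 := Γ.sum_mul_le_of_cut lo hi hlh b hb hcut f
  have h5 : ∀ e, max (hi e * (f (Γ.tgt e) - f (Γ.src e))) (lo e * (f (Γ.tgt e) - f (Γ.src e))) =
      y e * (f (Γ.tgt e) - f (Γ.src e)) := by
    intro e
    simp only [hy]
    split_ifs with h
    · exact max_eq_left (mul_le_mul_of_nonneg_right (hlh e) h)
    · exact max_eq_right (mul_le_mul_of_nonpos_right (hlh e) (not_le.1 h).le)
  simp only [h5] at h4
  linarith

end Flows

/-! ### Potentials with bounded differences, and recognizing gradients. -/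

section Potentials

variable {V E : Type*} [DecidableEq V] [Fintype E] [DecidableEq E]

/-- Feasibility of potentials with bounded differences: it suffices to check the bounds on
integral cycles. -/
theorem exists_potential (Γ : MetricGraph V E) (hΓ : Γ.Connected) (a b : E → ℝ)
    (h : ∀ u ∈ Γ.homology ℤ, 0 ≤ ∑ e, max (a e * u e) (b e * u e)) :
    ∃ f : V → ℝ, ∀ e, f (Γ.tgt e) - f (Γ.src e) ≤ max (a e) (b e) ∧
      min (a e) (b e) ≤ f (Γ.tgt e) - f (Γ.src e) := by
  rcases isEmpty_or_nonempty V with hV | ⟨⟨v₀⟩⟩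
  · exact ⟨0, fun e => hV.elim (Γ.src e)⟩
  -- The potential at `w` will be the least cost `κ` of an integral chain (not necessarily a path)
  -- from `v₀` to `w`.
  set κ : (E → ℤ) → ℝ := fun u => ∑ e, max (a e * u e) (b e * u e) with hκ
  have hsub : ∀ u w, κ (u + w) ≤ κ u + κ w := by
    intro u w
    rw [hκ, ← Finset.sum_add_distrib]
    refine Finset.sum_le_sum fun e _ => ?_
    simp only [Pi.add_apply, Int.cast_add, mul_add]
    exact max_le (add_le_add (le_max_left _ _) (le_max_left _ _))
      (add_le_add (le_max_right _ _) (le_max_right _ _))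
  have hbd : ∀ w, ∃ c : E → ℤ, Γ.boundary ℤ c = Pi.single w 1 - Pi.single v₀ 1 :=
    fun w => (hΓ v₀ w).imp fun ξ hξ => hξ.boundary
  -- Two such chains differ by a cycle, whose cost is nonnegative by hypothesis.
  have hlow : ∀ w, BddBelow (κ '' {c | Γ.boundary ℤ c = Pi.single w 1 - Pi.single v₀ 1}) := by
    intro w
    obtain ⟨c₀, hc₀⟩ := hbd w
    refine ⟨-κ (-c₀), ?_⟩
    rintro _ ⟨c, hc, rfl⟩
    have h1 := hsub c (-c₀)
    have h2 := h (c + -c₀) (by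
      rw [mem_homology_iff, map_add, map_neg, hc₀, hc]; simp)
    have h3 : 0 ≤ κ (c + -c₀) := h2
    linarith
  have hsingle : ∀ (e : E) (r : ℤ), κ (Pi.single e r) = max (a e * r) (b e * r) := by
    intro e r
    simp only [hκ]
    rw [Finset.sum_eq_single e]
    · simp
    · intro e' _ he'; simp [he']
    · simp
  have step : ∀ (w w' : V) (u : E → ℤ), Γ.boundary ℤ u = Pi.single w' 1 - Pi.single w 1 →
      sInf (κ '' {c | Γ.boundary ℤ c = Pi.single w' 1 - Pi.single v₀ 1}) ≤
        sInf (κ '' {c | Γ.boundary ℤ c = Pi.single w 1 - Pi.single v₀ 1}) + κ u := by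
    intro w w' u hu
    rw [← sub_le_iff_le_add]
    refine le_csInf (Set.Nonempty.image _ (hbd w)) ?_
    rintro _ ⟨c, hc, rfl⟩
    rw [sub_le_iff_le_add]
    refine (csInf_le (hlow w') ⟨c + u, ?_, rfl⟩).trans (hsub c u)
    rw [Set.mem_ofPred_eq] at hc ⊢
    rw [map_add, hc, hu]; abel
  refine ⟨fun w => sInf (κ '' {c | Γ.boundary ℤ c = Pi.single w 1 - Pi.single v₀ 1}),
    fun e => ⟨?_, ?_⟩⟩
  · have := step (Γ.src e) (Γ.tgt e) (Pi.single e 1) (Γ.boundary_single ℤ e 1)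
    rw [hsingle] at this
    simp only [Int.cast_one, mul_one] at this
    linarith
  -- Traversing `e` backwards costs `max (-a e) (-b e) = -min (a e) (b e)`, which is the lower
  -- bound.
  · have := step (Γ.tgt e) (Γ.src e) (Pi.single e (-1)) (by
      rw [boundary_single]; ext v; simp [Pi.single_apply]; split_ifs <;> simp)
    rw [hsingle] at this
    simp only [Int.cast_neg, Int.cast_one, mul_neg, mul_one, max_neg_neg] at this
    linarith

/-- With equal upper and lower bounds, the cycle condition of `exists_potential` is the vanishing of
the integral on integral cycles seen as harmonic forms. -/
theorem exists_gradient (Γ : MetricGraph V E) (hΓ : Γ.Connected) (c : E → ℝ)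
    (h : Γ.integral c = 0) :
    ∃ f : V → ℝ, ∀ e, c e * Γ.len e = f (Γ.tgt e) - f (Γ.src e) := by
  obtain ⟨f, hf⟩ := Γ.exists_potential hΓ (fun e => c e * Γ.len e) (fun e => c e * Γ.len e) (by
    intro u hu
    have hu' : (fun e => (u e : ℝ)) ∈ Γ.harmonicForms := by
      rw [mem_harmonicForms_iff, boundary_intCast, (Γ.mem_homology_iff u).1 hu]
      ext; simp
    have := congrArg (fun x : Γ.Dual => x ⟨_, hu'⟩) h
    simp only [integral_apply, zero_apply] at this
    simp only [max_self]
    refine le_of_eq (this.symm.trans (Finset.sum_congr rfl fun e _ => ?_))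
    ring)
  refine ⟨f, fun e => ?_⟩
  obtain ⟨h1, h2⟩ := hf e
  rw [max_self] at h1
  rw [min_self] at h2
  exact le_antisymm h2 h1

end Potentials

end MetricGraph

/-! ### Finite generation of lattices by sign-compatible sums. -/

section Conformal

variable {E : Type*} [Fintype E]

/-- A finite set of elements of a lattice generating all its elements by sign-compatible sums
(a Graver basis). -/
theorem exists_finite_conformal_generators (N : AddSubgroup (E → ℤ)) :
    ∃ G : Finset (E → ℤ), (∀ g ∈ G, g ∈ N) ∧ ∀ Q : (E → ℤ) → Prop, Q 0 → (∀ g ∈ G, Q g) →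
      (∀ u w, (∀ e, 0 ≤ u e * w e) → Q u → Q w → Q (u + w)) → ∀ u ∈ N, Q u := by
  classical
  -- Positive and negative parts: `ψ w ≤ ψ u` means that each `w e` lies between `0` and `u e`. The
  -- minimal nonzero elements form an antichain, finite by Dickson's lemma.
  set ψ : (E → ℤ) → (E → ℕ × ℕ) := fun u e => ((u e).toNat, (-u e).toNat) with hψ
  have hinj : Function.Injective ψ := by
    intro u w h
    ext e
    have h1 := congrFun h e
    simp only [hψ, Prod.mk.injEq] at h1
    omega
  set A : Set (E → ℕ × ℕ) := {a | Minimal (· ∈ ψ '' {u | u ∈ N ∧ u ≠ 0}) a} with hA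
  have hfin : A.Finite :=
    WellQuasiOrderedLE.finite_of_isAntichain (setOfPred_minimal_antichain _)
  have hfin' : (ψ ⁻¹' A).Finite := hfin.preimage hinj.injOn
  refine ⟨hfin'.toFinset, ?_, ?_⟩
  · intro g hg
    have hg' : ψ g ∈ A := by simpa using hg
    obtain ⟨u, hu, hug⟩ := hg'.1
    rw [← hinj hug]; exact hu.1
  intro Q h0 hG hadd u hu
  induction hn : ∑ e, (u e).natAbs using Nat.strong_induction_on generalizing u with
  | _ n ih =>
  by_cases hu0 : u = 0
  · rw [hu0]; exact h0
  obtain ⟨a, ha, hmin⟩ := exists_minimal_le_of_wellFoundedLT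
    (· ∈ ψ '' {u | u ∈ N ∧ u ≠ 0}) (ψ u) ⟨u, ⟨hu, hu0⟩, rfl⟩
  obtain ⟨w, ⟨hwN, hw0⟩, rfl⟩ := hmin.1
  have hwG : w ∈ hfin'.toFinset := hfin'.mem_toFinset.2 hmin
  have hcomp : ∀ e, (0 ≤ w e ∧ w e ≤ u e) ∨ (w e ≤ 0 ∧ u e ≤ w e) := by
    intro e
    have h1 := (ha e).1
    have h2 := (ha e).2
    simp only [hψ] at h1 h2
    omega
  -- Removing a minimal element below `u` keeps signs compatible and lowers the `ℓ¹` norm.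
  have hlt : ∑ e, ((u - w) e).natAbs < n := by
    rw [← hn]
    obtain ⟨e₀, he₀⟩ := Function.ne_iff.1 hw0
    refine Finset.sum_lt_sum (fun e _ => ?_) ⟨e₀, Finset.mem_univ _, ?_⟩
    · have := hcomp e
      simp only [Pi.sub_apply]; omega
    · have := hcomp e₀
      simp only [Pi.sub_apply, Pi.zero_apply, ne_eq] at he₀ ⊢; omega
  have h1 := ih _ hlt (u - w) (sub_mem hu hwN) rfl
  have h2 := hadd (u - w) w (fun e => by
    rcases hcomp e with h | h
    · exact mul_nonneg (by simpa using h.2) h.1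
    · exact mul_nonneg_of_nonpos_of_nonpos (by simpa using h.2) h.1) h1 (hG w hwG)
  simpa using h2

end Conformal

/-! ### The rounding relation as a monotone relation. -/

section Rounding

/-- The right-hand interval is the subdifferential of `interpSq` at `c`, so rounding `z` to `c` and
having `z` as a subgradient at `c` are the same relation. -/
theorem near_iff (c z : ℝ) :
    ((⌈z - 1 / 2⌉ : ℝ) ≤ c ∧ c ≤ ⌊z + 1 / 2⌋) ↔ ((⌈c⌉ : ℝ) - 1 / 2 ≤ z ∧ z ≤ ⌊c⌋ + 1 / 2) := by
  rw [← Int.le_floor, ← Int.ceil_le, Int.ceil_le, Int.le_floor]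
  constructor <;> rintro ⟨h1, h2⟩ <;> constructor <;> linarith

theorem le_of_near_of_lt {c z c' z' : ℝ} (h : c ≤ ⌊z + 1 / 2⌋) (h' : (⌈z' - 1 / 2⌉ : ℝ) ≤ c')
    (hz : z < z') : c ≤ c' := by
  refine h.trans (le_trans ?_ h')
  have h1 := Int.floor_le (z + 1 / 2)
  have h2 := Int.le_ceil (z' - 1 / 2)
  have h3 : (⌊z + 1 / 2⌋ : ℝ) < ⌈z' - 1 / 2⌉ + 1 := by linarith
  exact_mod_cast Int.lt_add_one_iff.1 (by exact_mod_cast h3)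

/-- Monotonicity of subgradients of a convex function; the face-to-face property of the cells rests
on it. -/
theorem near_monotone {c z c' z' : ℝ} (h : (⌈z - 1 / 2⌉ : ℝ) ≤ c ∧ c ≤ ⌊z + 1 / 2⌋)
    (h' : (⌈z' - 1 / 2⌉ : ℝ) ≤ c' ∧ c' ≤ ⌊z' + 1 / 2⌋) : 0 ≤ (c - c') * (z - z') := by
  rcases lt_trichotomy z z' with hz | hz | hz
  · exact mul_nonneg_of_nonpos_of_nonpos (sub_nonpos.2 (le_of_near_of_lt h.2 h'.1 hz))
      (sub_nonpos.2 hz.le)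
  · simp [hz]
  · exact mul_nonneg (sub_nonneg.2 (le_of_near_of_lt h'.2 h.1 hz)) (sub_nonneg.2 hz.le)

/-- A small shift of `z` in a nonzero direction breaks ties, so the interval of roundings collapses
to the endpoint favoured by `h`. Applied in each coordinate, this exhibits faces of boxes as boxes.
-/
theorem eventually_near_add_iff (z h : ℝ) : ∀ᶠ ε in nhdsWithin (0 : ℝ) (Set.Ioi 0), ∀ c : ℝ,
    ((⌈z + ε * h - 1 / 2⌉ : ℝ) ≤ c ∧ c ≤ ⌊z + ε * h + 1 / 2⌋) ↔
      ((⌈z - 1 / 2⌉ : ℝ) ≤ c ∧ c ≤ ⌊z + 1 / 2⌋) ∧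
        ∀ c', ((⌈z - 1 / 2⌉ : ℝ) ≤ c' ∧ c' ≤ ⌊z + 1 / 2⌋) → c' * h ≤ c * h := by
  have hle : (⌈z - 1 / 2⌉ : ℝ) ≤ ⌊z + 1 / 2⌋ := by
    have h1 := Int.ceil_lt_add_one (z - 1 / 2)
    have h2 := Int.lt_floor_add_one (z + 1 / 2)
    have h3 : (⌈z - 1 / 2⌉ : ℝ) < ⌊z + 1 / 2⌋ + 1 := by linarith
    exact_mod_cast Int.lt_add_one_iff.1 (by exact_mod_cast h3)
  have hev : ∀ δ : ℝ, 0 < δ → ∀ᶠ ε in nhdsWithin (0 : ℝ) (Set.Ioi 0), |ε * h| < δ := by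
    intro δ hδ
    have ht : Filter.Tendsto (fun ε : ℝ => |ε * h|) (nhdsWithin 0 (Set.Ioi 0)) (nhds 0) := by
      have : Continuous fun ε : ℝ => |ε * h| := by fun_prop
      have h2 := this.tendsto 0
      simp only [zero_mul, abs_zero] at h2
      exact h2.mono_left nhdsWithin_le_nhds
    exact ht.eventually (gt_mem_nhds hδ)
  rcases lt_trichotomy h 0 with hh | hh | hh
  · have h1 := Int.ceil_lt_add_one (z - 1 / 2)
    filter_upwards [hev _ (sub_pos.2 h1), self_mem_nhdsWithin] with ε hε hε0 c
    have hε0' : 0 < ε := hε0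
    have h2 : ε * h < 0 := mul_neg_of_pos_of_neg hε0' hh
    rw [abs_of_neg h2] at hε
    have h3 := Int.le_ceil (z - 1 / 2)
    have e1 : ⌈z + ε * h - 1 / 2⌉ = ⌈z - 1 / 2⌉ := by
      rw [Int.ceil_eq_iff]; constructor <;> linarith
    have e2 : ⌊z + ε * h + 1 / 2⌋ = ⌈z - 1 / 2⌉ := by
      rw [Int.floor_eq_iff]; constructor <;> linarith
    rw [e1, e2]
    constructor
    · rintro ⟨h4, h5⟩
      refine ⟨⟨h4, h5.trans hle⟩, fun c' hc' => ?_⟩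
      exact mul_le_mul_of_nonpos_right (h5.trans hc'.1) hh.le
    · rintro ⟨h4, h5⟩
      refine ⟨h4.1, ?_⟩
      exact (mul_le_mul_right_of_neg hh).1 (h5 _ ⟨le_rfl, hle⟩)
  · subst hh
    simp
  · have h1 := Int.lt_floor_add_one (z + 1 / 2)
    filter_upwards [hev _ (sub_pos.2 h1), self_mem_nhdsWithin] with ε hε hε0 c
    have hε0' : 0 < ε := hε0
    have h2 : 0 < ε * h := mul_pos hε0' hh
    rw [abs_of_pos h2] at hε
    have h3 := Int.floor_le (z + 1 / 2)
    have e1 : ⌈z + ε * h - 1 / 2⌉ = ⌊z + 1 / 2⌋ := by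
      rw [Int.ceil_eq_iff]; constructor <;> linarith
    have e2 : ⌊z + ε * h + 1 / 2⌋ = ⌊z + 1 / 2⌋ := by
      rw [Int.floor_eq_iff]; constructor <;> linarith
    rw [e1, e2]
    constructor
    · rintro ⟨h4, h5⟩
      refine ⟨⟨hle.trans h4, h5⟩, fun c' hc' => ?_⟩
      exact mul_le_mul_of_nonneg_right (hc'.2.trans h4) hh.le
    · rintro ⟨h4, h5⟩
      refine ⟨?_, h4.2⟩
      exact (mul_le_mul_iff_left₀ hh).1 (h5 _ ⟨hle, le_rfl⟩)

end Rounding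

/-! ### The convex piecewise linear function behind the cells. -/

section Interpolation

/-- The piecewise linear interpolation of `t ↦ t ^ 2 / 2` at the integers. -/
noncomputable def interpSq (t : ℝ) : ℝ := t ^ 2 / 2 + Int.fract t * (1 - Int.fract t) / 2

theorem continuous_interpSq : Continuous interpSq := by
  have h : Continuous fun t : ℝ => (fun s : ℝ => s * (1 - s) / 2) (Int.fract t) :=
    ContinuousOn.comp_fract'' (f := fun s : ℝ => s * (1 - s) / 2) (by fun_prop) (by norm_num)
  exact ((continuous_pow 2).div_const 2).add h

theorem le_interpSq (t : ℝ) : t ^ 2 / 2 ≤ interpSq t := by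
  have h1 := Int.fract_nonneg t
  have h2 := (Int.fract_lt_one t).le
  have := mul_nonneg h1 (sub_nonneg.2 h2)
  unfold interpSq; linarith

theorem interpSq_eq (k : ℤ) (t : ℝ) (h0 : (k : ℝ) ≤ t) (h1 : t ≤ k + 1) :
    interpSq t = (k + 1 / 2) * t - k * (k + 1) / 2 := by
  rcases h1.lt_or_eq with h | rfl
  · have : Int.fract t = t - k := by
      rw [Int.fract, (Int.floor_eq_iff (a := t) (z := k)).2 ⟨h0, h⟩]
    unfold interpSq; rw [this]; ring
  · have : Int.fract ((k : ℝ) + 1) = 0 := by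
      rw [show (k : ℝ) + 1 = ((k + 1 : ℤ) : ℝ) by push_cast; ring]
      exact Int.fract_intCast _
    unfold interpSq; rw [this]; ring

/-- The right slope `⌊t⌋ + 1 / 2`, and the left slope `⌈t⌉ - 1 / 2` of the next lemma, are the ends
of the interval in `near_iff`. -/
theorem eventually_interpSq_add (t : ℝ) : ∀ᶠ ε in nhdsWithin (0 : ℝ) (Set.Ioi 0),
    interpSq (t + ε) = interpSq t + (⌊t⌋ + 1 / 2) * ε := by
  filter_upwards [Ioo_mem_nhdsGT (sub_pos.2 (Int.lt_floor_add_one t))] with ε hε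
  have h1 := Int.floor_le t
  have h2 := Int.lt_floor_add_one t
  have h3 := hε.1
  have h4 := hε.2
  rw [interpSq_eq ⌊t⌋ (t + ε) (by linarith) (by linarith), interpSq_eq ⌊t⌋ t h1 h2.le]
  ring

theorem eventually_interpSq_sub (t : ℝ) : ∀ᶠ ε in nhdsWithin (0 : ℝ) (Set.Ioi 0),
    interpSq (t - ε) = interpSq t - (⌈t⌉ - 1 / 2) * ε := by
  have h1 := Int.le_ceil t
  have h2 := Int.ceil_lt_add_one t
  filter_upwards [Ioo_mem_nhdsGT (show 0 < t - (⌈t⌉ - 1) by linarith)] with ε hε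
  have h3 := hε.1
  have h4 := hε.2
  rw [interpSq_eq (⌈t⌉ - 1) (t - ε) (by push_cast; linarith) (by push_cast; linarith),
    interpSq_eq (⌈t⌉ - 1) t (by push_cast; linarith) (by push_cast; linarith)]
  push_cast
  ring

end Interpolation

namespace MetricGraph

/-! ### Cubes of roundings. -/

section Boxes

variable {E : Type*}

/-- The cube of chains whose coefficients are the integers nearest to those of `z`, or lie
between the two nearest integers. -/
noncomputable def dualBox (z : E → ℝ) : Set (E → ℝ) :=
  Set.Icc (fun e => (⌈z e - 1 / 2⌉ : ℝ)) (fun e => (⌊z e + 1 / 2⌋ : ℝ))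

theorem mem_dualBox {z c : E → ℝ} : c ∈ dualBox z ↔
    ∀ e, (⌈z e - 1 / 2⌉ : ℝ) ≤ c e ∧ c e ≤ ⌊z e + 1 / 2⌋ := by
  simp only [dualBox, Set.mem_Icc, Pi.le_def, forall_and]

theorem ceil_le_floor (t : ℝ) : (⌈t - 1 / 2⌉ : ℝ) ≤ ⌊t + 1 / 2⌋ := by
  have h1 := Int.ceil_lt_add_one (t - 1 / 2)
  have h2 := Int.lt_floor_add_one (t + 1 / 2)
  have h3 : (⌈t - 1 / 2⌉ : ℝ) < ⌊t + 1 / 2⌋ + 1 := by linarith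
  exact_mod_cast Int.lt_add_one_iff.1 (by exact_mod_cast h3)

theorem dualBox_nonempty (z : E → ℝ) : (dualBox z).Nonempty :=
  ⟨_, mem_dualBox.2 fun e => ⟨le_rfl, ceil_le_floor (z e)⟩⟩

theorem abs_sub_le_of_mem_dualBox {z c : E → ℝ} (h : c ∈ dualBox z) (e : E) :
    |c e - z e| ≤ 1 / 2 := by
  have h1 := mem_dualBox.1 h e
  have h2 := Int.le_ceil (z e - 1 / 2)
  have h3 := Int.floor_le (z e + 1 / 2)
  rw [abs_le]; constructor <;> linarith [h1.1, h1.2]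

theorem dualBox_add_int (z : E → ℝ) (u : E → ℤ) (c : E → ℝ) :
    (c + fun e => (u e : ℝ)) ∈ dualBox (z + fun e => (u e : ℝ)) ↔ c ∈ dualBox z := by
  rw [mem_dualBox, mem_dualBox]
  refine forall_congr' fun e => ?_
  simp only [Pi.add_apply]
  rw [show z e + (u e : ℝ) - 1 / 2 = z e - 1 / 2 + u e by ring,
    show z e + (u e : ℝ) + 1 / 2 = z e + 1 / 2 + u e by ring, Int.ceil_add_intCast,
    Int.floor_add_intCast]
  push_cast
  constructor <;> rintro ⟨h1, h2⟩ <;> constructor <;> linarith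

end Boxes

/-! ### Projected cubes: intersections, faces, translations and facet inequalities. -/

section Cells

variable {V E : Type*} [Fintype E]

/-- By monotonicity every summand is nonnegative, so all vanish. On each edge the chains agree or
the centres agree, and in either case the roundings may be exchanged. -/
theorem mem_dualBox_of_sum_le (Γ : MetricGraph V E) {z z' c c' : E → ℝ} (hc : c ∈ dualBox z)
    (hc' : c' ∈ dualBox z') (h : ∑ e, (c e - c' e) * (z e - z' e) * Γ.len e ≤ 0) :
    c ∈ dualBox z' ∧ c' ∈ dualBox z := by
  have hnn : ∀ e ∈ Finset.univ, 0 ≤ (c e - c' e) * (z e - z' e) * Γ.len e := fun e _ =>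
    mul_nonneg (near_monotone (mem_dualBox.1 hc e) (mem_dualBox.1 hc' e)) (Γ.len_pos e).le
  have h0 := (Finset.sum_eq_zero_iff_of_nonneg hnn).1 (le_antisymm h (Finset.sum_nonneg hnn))
  rw [mem_dualBox, mem_dualBox, ← forall_and]
  intro e
  have h1 := h0 e (Finset.mem_univ e)
  have h2 := (Γ.len_pos e).ne'
  rcases mul_eq_zero.1 ((mul_eq_zero.1 h1).resolve_right h2) with h3 | h3
  · rw [sub_eq_zero] at h3
    exact ⟨h3 ▸ mem_dualBox.1 hc' e, h3 ▸ mem_dualBox.1 hc e⟩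
  · rw [sub_eq_zero] at h3
    exact ⟨h3 ▸ mem_dualBox.1 hc e, h3 ▸ mem_dualBox.1 hc' e⟩

variable [DecidableEq V]

/-- The polytopes in `Ω(Γ)^*` obtained by projecting the cubes dual to the chains with
boundary `q`. -/
def mixedCells (Γ : MetricGraph V E) (q : V → ℝ) : Set (Set Γ.Dual) :=
  {P | ∃ z : E → ℝ, Γ.boundary ℝ z = q ∧ P = Γ.integral '' dualBox z}

theorem sub_mem_harmonicForms (Γ : MetricGraph V E) {z z' : E → ℝ} {q : V → ℝ}
    (hz : Γ.boundary ℝ z = q) (hz' : Γ.boundary ℝ z' = q) : z - z' ∈ Γ.harmonicForms := by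
  rw [mem_harmonicForms_iff, map_sub, hz, hz', sub_self]

/-- Equal integrals pair equally with the harmonic form `z - z'`, so the monotonicity sum is zero.
-/
theorem mem_dualBox_of_integral_eq (Γ : MetricGraph V E) {z z' c c' : E → ℝ} {q : V → ℝ}
    (hz : Γ.boundary ℝ z = q) (hz' : Γ.boundary ℝ z' = q) (hc : c ∈ dualBox z)
    (hc' : c' ∈ dualBox z') (h : Γ.integral c = Γ.integral c') :
    c ∈ dualBox z' ∧ c' ∈ dualBox z := by
  refine Γ.mem_dualBox_of_sum_le hc hc' (le_of_eq ?_)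
  have h1 := congrArg (fun x : Γ.Dual => x ⟨_, Γ.sub_mem_harmonicForms hz hz'⟩) h
  simp only [integral_apply, Pi.sub_apply] at h1
  simp only [sub_mul, Finset.sum_sub_distrib] at h1 ⊢
  linarith

/-- Two cells meet in a cell, cut out of each of them by a linear functional. -/
theorem mixedCells_inter (Γ : MetricGraph V E) {z z' : E → ℝ} {q : V → ℝ}
    (hz : Γ.boundary ℝ z = q) (hz' : Γ.boundary ℝ z' = q) {x₀ : Γ.Dual}
    (hx : x₀ ∈ Γ.integral '' dualBox z) (hx' : x₀ ∈ Γ.integral '' dualBox z') :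
    ∃ ω : Γ.harmonicForms, Γ.integral '' dualBox z ∩ Γ.integral '' dualBox z' =
      {x ∈ Γ.integral '' dualBox z | ∀ y ∈ Γ.integral '' dualBox z, y ω ≤ x ω} := by
  obtain ⟨c₀, hc₀, rfl⟩ := hx
  obtain ⟨c₁, hc₁, h01⟩ := hx'
  have hc₀' := (Γ.mem_dualBox_of_integral_eq hz hz' hc₀ hc₁ h01.symm).1
  -- The functional is evaluation at `z' - z`: its values on the first cell never exceed those on
  -- the second, and they meet at the common point.
  refine ⟨⟨_, Γ.sub_mem_harmonicForms hz' hz⟩, ?_⟩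
  have hle : ∀ c ∈ dualBox z, ∀ c' ∈ dualBox z',
      Γ.integral c ⟨_, Γ.sub_mem_harmonicForms hz' hz⟩ ≤
        Γ.integral c' ⟨_, Γ.sub_mem_harmonicForms hz' hz⟩ := by
    intro c hc c' hc'
    rw [integral_apply, integral_apply]
    refine Finset.sum_le_sum fun e _ => mul_le_mul_of_nonneg_right ?_ (Γ.len_pos e).le
    have := near_monotone (mem_dualBox.1 hc e) (mem_dualBox.1 hc' e)
    simp only [Pi.sub_apply]
    linarith
  ext x
  constructor
  · rintro ⟨hx, c', hc', rfl⟩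
    refine ⟨hx, ?_⟩
    rintro _ ⟨c, hc, rfl⟩
    exact hle c hc c' hc'
  · rintro ⟨⟨c, hc, rfl⟩, hmax⟩
    refine ⟨⟨c, hc, rfl⟩, c, (Γ.mem_dualBox_of_sum_le hc hc₀' ?_).1, rfl⟩
    have h1 := hmax _ ⟨c₀, hc₀, rfl⟩
    simp only [integral_apply, Pi.sub_apply] at h1
    simp only [sub_mul, mul_sub, Finset.sum_sub_distrib] at h1 ⊢
    linarith

/-- Faces of cells are cells. -/
theorem mixedCells_face (Γ : MetricGraph V E) {z : E → ℝ} {q : V → ℝ}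
    (hz : Γ.boundary ℝ z = q) (ω : Γ.harmonicForms) :
    {x ∈ Γ.integral '' dualBox z | ∀ y ∈ Γ.integral '' dualBox z, y ω ≤ x ω} ∈ Γ.mixedCells q := by
  have hev := (Filter.eventually_all.2 fun e =>
    eventually_near_add_iff (z e) ((ω : E → ℝ) e)).exists
  obtain ⟨ε, hε⟩ := hev
  -- The shifted centre has the same boundary because `ω` is harmonic, and its box is the face of
  -- the old box on which each `c e * ω e` is maximal.
  refine ⟨z + ε • (ω : E → ℝ), ?_, ?_⟩
  · rw [map_add, map_smul, hz, (Γ.mem_harmonicForms_iff _).1 ω.2, smul_zero, add_zero]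
  have hbox : ∀ c, c ∈ dualBox (z + ε • (ω : E → ℝ)) ↔ c ∈ dualBox z ∧
      ∀ c' ∈ dualBox z, ∀ e, c' e * (ω : E → ℝ) e ≤ c e * (ω : E → ℝ) e := by
    intro c
    classical
    simp only [mem_dualBox (z := z + ε • (ω : E → ℝ)), Pi.add_apply, Pi.smul_apply, smul_eq_mul, hε]
    rw [forall_and, ← mem_dualBox]
    refine and_congr_right fun hc =>
      ⟨fun h c' hc' e => h e _ (mem_dualBox.1 hc' e), fun h e t ht => ?_⟩
    have := h (Function.update c e t) (mem_dualBox.2 fun e' => ?_) e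
    · simpa using this
    · rcases eq_or_ne e' e with rfl | he
      · simpa using ht
      · simpa [he] using mem_dualBox.1 hc e'
  have hsum : ∀ c c' : E → ℝ, (∀ e, c' e * (ω : E → ℝ) e ≤ c e * (ω : E → ℝ) e) →
      Γ.integral c' ω ≤ Γ.integral c ω := fun c c' h => by
    rw [integral_apply, integral_apply]
    exact Finset.sum_le_sum fun e _ => mul_le_mul_of_nonneg_right (h e) (Γ.len_pos e).le
  obtain ⟨c₀, hc₀⟩ := dualBox_nonempty (z + ε • (ω : E → ℝ))
  have hc₀' := (hbox c₀).1 hc₀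
  ext x
  constructor
  · rintro ⟨⟨c, hc, rfl⟩, hmax⟩
    refine ⟨c, (hbox c).2 ⟨hc, fun c' hc' e => (hc₀'.2 c' hc' e).trans (le_of_eq ?_)⟩, rfl⟩
    have h1 := hmax _ ⟨c₀, hc₀'.1, rfl⟩
    rw [integral_apply, integral_apply] at h1
    -- Since `c₀` is maximal on every edge, a chain with maximal sum must be maximal on every edge
    -- too.
    have hnn : ∀ e ∈ Finset.univ, c e * (ω : E → ℝ) e * Γ.len e ≤ c₀ e * (ω : E → ℝ) e * Γ.len e :=
      fun e _ => mul_le_mul_of_nonneg_right (hc₀'.2 c hc e) (Γ.len_pos e).le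
    have h2 := (Finset.sum_eq_sum_iff_of_le hnn).1 (le_antisymm (Finset.sum_le_sum hnn) h1) e
      (Finset.mem_univ e)
    exact (mul_right_cancel₀ (Γ.len_pos e).ne' h2).symm
  · rintro ⟨c, hc, rfl⟩
    have hc' := (hbox c).1 hc
    refine ⟨⟨c, hc'.1, rfl⟩, ?_⟩
    rintro _ ⟨c', hc'', rfl⟩
    exact hsum c c' (hc'.2 c' hc'')

theorem mixedCells_translate (Γ : MetricGraph V E) {q : V → ℝ} {P : Set Γ.Dual}
    (hP : P ∈ Γ.mixedCells q) {x : Γ.Dual} (hx : x ∈ Γ.periodLattice) :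
    (fun y => y + x) '' P ∈ Γ.mixedCells q := by
  obtain ⟨z, hz, rfl⟩ := hP
  obtain ⟨u, hu, rfl⟩ := hx
  refine ⟨z + fun e => (u e : ℝ), ?_, ?_⟩
  · rw [map_add, hz, boundary_intCast, (Γ.mem_homology_iff u).1 hu]
    ext; simp
  ext y
  constructor
  · rintro ⟨_, ⟨c, hc, rfl⟩, rfl⟩
    exact ⟨_, (dualBox_add_int z u c).2 hc, map_add Γ.integralMap _ _⟩
  · rintro ⟨c, hc, rfl⟩
    have h1 : c = (c - fun e => (u e : ℝ)) + fun e => (u e : ℝ) := by abel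
    rw [h1] at hc ⊢
    exact ⟨_, ⟨_, (dualBox_add_int z u _).1 hc, rfl⟩, (map_add Γ.integralMap _ _).symm⟩

theorem continuous_integral (Γ : MetricGraph V E) : Continuous Γ.integral :=
  LinearMap.continuous_of_finiteDimensional (E := E → ℝ) (F' := Γ.Dual) Γ.integralMap

theorem isCompact_dualBox_image (Γ : MetricGraph V E) (z : E → ℝ) :
    IsCompact (Γ.integral '' dualBox z) :=
  isCompact_Icc.image Γ.continuous_integral

/-- Integral cycles as harmonic forms. -/
def cycleForm (Γ : MetricGraph V E) (u : Γ.homology ℤ) : Γ.harmonicForms :=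
  ⟨fun e => ((u : E → ℤ) e : ℝ), by
    rw [mem_harmonicForms_iff, boundary_intCast, (Γ.mem_homology_iff _).1 u.2]; ext; simp⟩

/-- Cells are cut out by the inequalities coming from finitely many integral cycles. -/
theorem exists_finset_cycles [Fintype V] [DecidableEq E] (Γ : MetricGraph V E) (hΓ : Γ.Connected) :
    ∃ G : Finset (Γ.homology ℤ), ∀ (lo hi : E → ℝ), (∀ e, lo e ≤ hi e) →
      Γ.integral '' Set.Icc lo hi = {x | ∀ u ∈ G, x (Γ.cycleForm u) ≤
        ∑ e, max (lo e * (u : E → ℤ) e) (hi e * (u : E → ℤ) e) * Γ.len e} := by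
  classical
  obtain ⟨G, hG, hgen⟩ := exists_finite_conformal_generators (Γ.homology ℤ).toAddSubgroup
  refine ⟨G.subtype (· ∈ Γ.homology ℤ), fun lo hi hlh => ?_⟩
  ext x
  constructor
  · rintro ⟨c, hc, rfl⟩ u -
    rw [integral_apply]
    refine Finset.sum_le_sum fun e _ => mul_le_mul_of_nonneg_right ?_ (Γ.len_pos e).le
    simp only [cycleForm]
    rcases le_total (0 : ℝ) ((u : E → ℤ) e) with h | h
    · exact le_max_of_le_right (mul_le_mul_of_nonneg_right (hc.2 e) h)
    · exact le_max_of_le_left (mul_le_mul_of_nonpos_right (hc.1 e) h)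
  · intro hx
    obtain ⟨c₀, rfl⟩ := Γ.integral_surjective x
    -- The support function of a box is additive on sign-compatible sums, so the inequalities pass
    -- from the generators to all integral cycles.
    have hall := hgen (fun u => ∑ e, c₀ e * (u e : ℝ) * Γ.len e ≤
        ∑ e, max (lo e * u e) (hi e * u e) * Γ.len e) (by simp)
      (fun g hg => by
        have := hx ⟨g, hG g hg⟩ (by simpa using hg)
        simpa [integral_apply, cycleForm] using this)
      (fun u w huw hu hw => by
        have h1 : ∑ e, c₀ e * (((u + w) e : ℤ) : ℝ) * Γ.len e =
            ∑ e, c₀ e * (u e : ℝ) * Γ.len e + ∑ e, c₀ e * (w e : ℝ) * Γ.len e := by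
          rw [← Finset.sum_add_distrib]
          exact Finset.sum_congr rfl fun e _ => by rw [Pi.add_apply, Int.cast_add]; ring
        have h2 : ∑ e, max (lo e * ((u + w) e : ℤ)) (hi e * ((u + w) e : ℤ)) * Γ.len e =
            ∑ e, max (lo e * u e) (hi e * u e) * Γ.len e +
              ∑ e, max (lo e * w e) (hi e * w e) * Γ.len e := by
          rw [← Finset.sum_add_distrib]
          refine Finset.sum_congr rfl fun e _ => ?_
          have hl := hlh e
          have h3 : (0 : ℝ) ≤ (u e : ℝ) * w e := by exact_mod_cast huw e
          simp only [Pi.add_apply, Int.cast_add]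
          rw [← add_mul]
          congr 1
          rcases le_total (0 : ℝ) (u e) with hu0 | hu0 <;>
            rcases le_total (0 : ℝ) (w e) with hw0 | hw0
          · rw [max_eq_right (mul_le_mul_of_nonneg_right hl (add_nonneg hu0 hw0)),
              max_eq_right (mul_le_mul_of_nonneg_right hl hu0),
              max_eq_right (mul_le_mul_of_nonneg_right hl hw0)]
            ring
          · rcases mul_eq_zero.1 (le_antisymm (mul_nonpos_of_nonneg_of_nonpos hu0 hw0) h3)
              with h | h <;> simp [h]
          · rcases mul_eq_zero.1 (le_antisymm (mul_nonpos_of_nonpos_of_nonneg hu0 hw0) h3)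
              with h | h <;> simp [h]
          · rw [max_eq_left (mul_le_mul_of_nonpos_right hl (add_nonpos hu0 hw0)),
              max_eq_left (mul_le_mul_of_nonpos_right hl hu0),
              max_eq_left (mul_le_mul_of_nonpos_right hl hw0)]
            ring
        rw [h1, h2]; exact add_le_add hu hw)
    -- Adding a gradient does not change the integral; the potential `f` is chosen so that the
    -- corrected chain enters the box.
    obtain ⟨f, hf⟩ := Γ.exists_potential hΓ (fun e => (lo e - c₀ e) * Γ.len e)
      (fun e => (hi e - c₀ e) * Γ.len e) (by
        intro u hu
        have h1 := hall u hu
        have h2 : ∑ e, max ((lo e - c₀ e) * Γ.len e * u e) ((hi e - c₀ e) * Γ.len e * u e) =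
            ∑ e, max (lo e * u e) (hi e * u e) * Γ.len e - ∑ e, c₀ e * (u e : ℝ) * Γ.len e := by
          rw [← Finset.sum_sub_distrib]
          refine Finset.sum_congr rfl fun e _ => ?_
          rw [max_mul_of_nonneg _ _ (Γ.len_pos e).le, ← max_sub_sub_right]
          congr 1 <;> ring_nf
        rw [h2]; linarith)
    refine ⟨fun e => c₀ e + (f (Γ.tgt e) - f (Γ.src e)) / Γ.len e, ?_, ?_⟩
    · have key : ∀ e, lo e - c₀ e ≤ (f (Γ.tgt e) - f (Γ.src e)) / Γ.len e ∧
          (f (Γ.tgt e) - f (Γ.src e)) / Γ.len e ≤ hi e - c₀ e := by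
        intro e
        have h1 := hf e
        have h2 : (lo e - c₀ e) * Γ.len e ≤ (hi e - c₀ e) * Γ.len e :=
          mul_le_mul_of_nonneg_right (by linarith [hlh e]) (Γ.len_pos e).le
        simp only [max_eq_right h2, min_eq_left h2] at h1
        exact ⟨(le_div_iff₀ (Γ.len_pos e)).2 h1.2, (div_le_iff₀ (Γ.len_pos e)).2 h1.1⟩
      constructor <;> intro e <;> simp only <;> linarith [(key e).1, (key e).2]
    · have h1 : Γ.integral (fun e => (f (Γ.tgt e) - f (Γ.src e)) / Γ.len e) = 0 := by
        exact Γ.integral_gradient _ f fun e => div_mul_cancel₀ _ (Γ.len_pos e).ne'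
      have h2 := map_add Γ.integralMap c₀ (fun e => (f (Γ.tgt e) - f (Γ.src e)) / Γ.len e)
      simp only [integralMap_apply, h1, add_zero] at h2
      exact h2

end Cells

end MetricGraph

/-- Sublevel sets of sums of coercive quadratic functions are bounded. -/
theorem exists_abs_le_of_sum_quadratic_le {E : Type*} [Fintype E] (a K : E → ℝ)
    (ha : ∀ e, 0 < a e) (hK : ∀ e, 0 ≤ K e) (M : ℝ) :
    ∃ R : ℝ, ∀ c : E → ℝ, ∑ e, (a e * c e ^ 2 - K e * |c e|) ≤ M → ∀ e, |c e| ≤ R := by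
  -- Completing the square bounds each summand below by `-K e ^ 2 / (4 * a e)`, hence each single
  -- summand is at most `B`.
  set B : ℝ := |M| + ∑ e, K e ^ 2 / (4 * a e) with hB
  have hterm : ∀ e, 0 ≤ K e ^ 2 / (4 * a e) := fun e =>
    div_nonneg (sq_nonneg _) (by linarith [ha e])
  have hB0 : 0 ≤ B := add_nonneg (abs_nonneg _) (Finset.sum_nonneg fun e _ => hterm e)
  have hr : ∀ e, 0 ≤ (K e + B) / a e + 1 := fun e =>
    add_nonneg (div_nonneg (add_nonneg (hK e) hB0) (ha e).le) zero_le_one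
  refine ⟨∑ e, ((K e + B) / a e + 1), fun c hc e => ?_⟩
  refine le_trans ?_ (Finset.single_le_sum (f := fun e => (K e + B) / a e + 1)
    (fun e _ => hr e) (Finset.mem_univ e))
  have hlow : ∀ e, -(K e ^ 2 / (4 * a e)) ≤ a e * c e ^ 2 - K e * |c e| := by
    intro e
    have h1 : a e * c e ^ 2 - K e * |c e| + K e ^ 2 / (4 * a e) =
        (2 * a e * |c e| - K e) ^ 2 / (4 * a e) := by
      have := (ha e).ne'
      rw [← sq_abs (c e)]
      field_simp
      ring
    have h2 : 0 ≤ (2 * a e * |c e| - K e) ^ 2 / (4 * a e) :=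
      div_nonneg (sq_nonneg _) (by linarith [ha e])
    linarith
  have he : a e * c e ^ 2 - K e * |c e| ≤ B := by
    classical
    rw [← Finset.add_sum_erase _ _ (Finset.mem_univ e)] at hc
    have h1 : -(∑ e' ∈ Finset.univ.erase e, K e' ^ 2 / (4 * a e')) ≤
        ∑ e' ∈ Finset.univ.erase e, (a e' * c e' ^ 2 - K e' * |c e'|) := by
      rw [← Finset.sum_neg_distrib]
      exact Finset.sum_le_sum fun e' _ => hlow e'
    have h2 : ∑ e' ∈ Finset.univ.erase e, K e' ^ 2 / (4 * a e') ≤ ∑ e', K e' ^ 2 / (4 * a e') :=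
      Finset.sum_le_sum_of_subset_of_nonneg (Finset.erase_subset _ _) fun e' _ _ => hterm e'
    have h3 := le_abs_self M
    linarith
  by_contra hcon
  push Not at hcon
  have h0 : 0 ≤ (K e + B) / a e := div_nonneg (add_nonneg (hK e) hB0) (ha e).le
  have h1 : 1 < |c e| := by linarith
  have h2 : K e + B + a e < a e * |c e| := by
    have h3 := mul_lt_mul_of_pos_left hcon (ha e)
    have h4 : a e * ((K e + B) / a e + 1) = K e + B + a e := by
      have := (ha e).ne'
      field_simp
    linarith
  rw [← sq_abs] at he
  have h5 : B + a e < |c e| * (a e * |c e| - K e) := by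
    have h6 : B + a e < a e * |c e| - K e := by linarith
    have h7 : 0 < a e * |c e| - K e := by linarith [ha e]
    calc B + a e < a e * |c e| - K e := h6
      _ ≤ |c e| * (a e * |c e| - K e) := le_mul_of_one_le_left h7.le h1.le
  have := ha e
  nlinarith

namespace MetricGraph

/-! ### The cells cover the dual space. -/

section Covering

/-- The one-sided derivative in the direction of the gradient of an indicator function, in the form
of the summands of the cut condition in `exists_flow`. -/
theorem eventually_interp_step (t l : ℝ) (hl : 0 < l) (p q : Prop) [Decidable p] [Decidable q] :
    ∀ᶠ ε in nhdsWithin (0 : ℝ) (Set.Ioi 0),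
      interpSq (t + ε * (((if p then 1 else 0) - (if q then 1 else 0)) / l)) * l =
        interpSq t * l + ε * max
          (((⌊t⌋ : ℝ) + 1 / 2) * ((if p then 1 else 0) - (if q then 1 else 0)))
          (((⌈t⌉ : ℝ) - 1 / 2) * ((if p then 1 else 0) - (if q then 1 else 0))) := by
  have hlh : (⌈t⌉ : ℝ) - 1 / 2 ≤ ⌊t⌋ + 1 / 2 := by
    have : (⌈t⌉ : ℝ) ≤ ⌊t⌋ + 1 := by exact_mod_cast Int.ceil_le_floor_add_one t
    linarith
  have ht : Filter.Tendsto (fun ε : ℝ => ε / l) (nhdsWithin 0 (Set.Ioi 0))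
      (nhdsWithin 0 (Set.Ioi 0)) := by
    refine tendsto_nhdsWithin_iff.2 ⟨?_, ?_⟩
    · have : Continuous fun ε : ℝ => ε / l := by fun_prop
      have h2 := this.tendsto 0
      rw [zero_div] at h2
      exact h2.mono_left nhdsWithin_le_nhds
    · filter_upwards [self_mem_nhdsWithin] with ε hε using div_pos hε hl
  by_cases hp : p <;> by_cases hq : q
  · simp [hp, hq]
  · filter_upwards [ht.eventually (eventually_interpSq_add t)] with ε hε
    simp only [hp, hq, if_true, if_false, sub_zero, mul_one_div, hε, mul_one, max_eq_left hlh]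
    field_simp
  · filter_upwards [ht.eventually (eventually_interpSq_sub t)] with ε hε
    simp only [hp, hq, if_true, if_false, zero_sub, mul_one, mul_neg]
    rw [max_eq_right (neg_le_neg hlh), neg_div, mul_neg, mul_one_div, ← sub_eq_add_neg, hε]
    field_simp
    ring
  · simp [hp, hq]

variable {V E : Type*} [DecidableEq V] [Fintype E] [Fintype V] [DecidableEq E]

/-- A minimizer `c` of `F` over the fibre above `x` cannot be improved along gradients of indicator
functions. These are the cut conditions for a flow `z` with boundary `q` that is a subgradient at
`c`, which puts `c` in `dualBox z`. -/
theorem mixedCells_cover (Γ : MetricGraph V E) (hΓ : Γ.Connected) {q : V → ℝ}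
    (hq : ∑ v, q v = 0) (x : Γ.Dual) : ∃ P ∈ Γ.mixedCells q, x ∈ P := by
  obtain ⟨z₀, hz₀⟩ := hΓ.exists_boundary_eq q hq
  obtain ⟨c₁, hc₁⟩ := Γ.integral_surjective x
  set F : (E → ℝ) → ℝ := fun c => ∑ e, (interpSq (c e) * Γ.len e - z₀ e * c e * Γ.len e) with hF
  have hFcont : Continuous F := by
    refine continuous_finsetSum _ fun e _ => ?_
    have := continuous_interpSq.comp (continuous_apply (A := fun _ : E => ℝ) e)
    exact (this.mul continuous_const).sub
      ((continuous_const.mul (continuous_apply e)).mul continuous_const)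
  -- The quadratic lower bound `le_interpSq` confines a sublevel set of `F` to a cube, so the
  -- minimum over the fibre exists.
  obtain ⟨R, hR⟩ := exists_abs_le_of_sum_quadratic_le (fun e => Γ.len e / 2)
    (fun e => |z₀ e| * Γ.len e) (fun e => half_pos (Γ.len_pos e))
    (fun e => mul_nonneg (abs_nonneg _) (Γ.len_pos e).le) (F c₁)
  have hR' : ∀ c, F c ≤ F c₁ → c ∈ Set.Icc (fun _ : E => -R) (fun _ => R) := by
    intro c hc
    have h1 := hR c (le_trans (Finset.sum_le_sum fun e _ => ?_) hc)
    · exact ⟨fun e => (abs_le.1 (h1 e)).1, fun e => (abs_le.1 (h1 e)).2⟩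
    · have h2 := mul_le_mul_of_nonneg_right (le_interpSq (c e)) (Γ.len_pos e).le
      have h3 : z₀ e * c e ≤ |z₀ e| * |c e| := by rw [← abs_mul]; exact le_abs_self _
      have h4 := mul_le_mul_of_nonneg_right h3 (Γ.len_pos e).le
      linarith
  have hcomp : IsCompact (Set.Icc (fun _ : E => -R) (fun _ => R) ∩ Γ.integral ⁻¹' {x}) :=
    isCompact_Icc.inter_right (isClosed_singleton.preimage Γ.continuous_integral)
  obtain ⟨c, ⟨-, hcx⟩, hmin⟩ := hcomp.exists_isMinOn ⟨c₁, hR' c₁ le_rfl, hc₁⟩ hFcont.continuousOn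
  have hmin' : ∀ c', Γ.integral c' = x → F c ≤ F c' := by
    intro c' hc'
    rcases le_total (F c') (F c₁) with h | h
    · exact hmin ⟨hR' c' h, hc'⟩
    · exact (hmin ⟨hR' c₁ le_rfl, hc₁⟩ : F c ≤ F c₁).trans h
  obtain ⟨z, hz, hzq⟩ := Γ.exists_flow (fun e => (⌈c e⌉ : ℝ) - 1 / 2) (fun e => (⌊c e⌋ : ℝ) + 1 / 2)
    (fun e => by
      have : (⌈c e⌉ : ℝ) ≤ ⌊c e⌋ + 1 := by exact_mod_cast Int.ceil_le_floor_add_one (c e)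
      linarith) q hq (fun Y => by
    set s : E → ℝ := fun e =>
      (if Γ.tgt e ∈ Y then 1 else 0) - (if Γ.src e ∈ Y then 1 else 0) with hs
    have hev := (Filter.eventually_all.2 fun e =>
      eventually_interp_step (c e) (Γ.len e) (Γ.len_pos e) (Γ.tgt e ∈ Y) (Γ.src e ∈ Y)).and
      self_mem_nhdsWithin
    obtain ⟨ε, hε, hε0⟩ := hev.exists
    have hε0' : 0 < ε := hε0
    replace hε : ∀ e, interpSq (c e + ε * (s e / Γ.len e)) * Γ.len e = interpSq (c e) * Γ.len e +
      ε * max (((⌊c e⌋ : ℝ) + 1 / 2) * s e) (((⌈c e⌉ : ℝ) - 1 / 2) * s e) := hε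
    have hg := Γ.integral_gradient (fun e => s e / Γ.len e) (fun v => if v ∈ Y then 1 else 0)
      fun e => div_mul_cancel₀ _ (Γ.len_pos e).ne'
    have h1 := hmin' (c + ε • fun e => s e / Γ.len e) (by
      have := map_add Γ.integralMap c (ε • fun e => s e / Γ.len e)
      rw [map_smul] at this
      simp only [integralMap_apply, hg, smul_zero, add_zero] at this
      rw [this]; exact hcx)
    have h2 : F (c + ε • fun e => s e / Γ.len e) = F c + ε *
        (∑ e, max ((⌊c e⌋ + 1 / 2) * s e) ((⌈c e⌉ - 1 / 2) * s e) - ∑ e, z₀ e * s e) := by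
      rw [hF, ← Finset.sum_sub_distrib, Finset.mul_sum, ← Finset.sum_add_distrib]
      refine Finset.sum_congr rfl fun e _ => ?_
      simp only [Pi.add_apply, Pi.smul_apply, smul_eq_mul]
      rw [hε e]
      have := (Γ.len_pos e).ne'
      field_simp
      ring
    rw [← hz₀, sum_mem_boundary]
    rw [h2] at h1
    have h3 := nonneg_of_mul_nonneg_right (by linarith :
      0 ≤ ε * (∑ e, max ((⌊c e⌋ + 1 / 2) * s e) ((⌈c e⌉ - 1 / 2) * s e) - ∑ e, z₀ e * s e)) hε0'
    linarith)
  exact ⟨_, ⟨z, hzq, rfl⟩, c, mem_dualBox.2 fun e => (near_iff _ _).2 (hz e), hcx⟩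

end Covering

/-! ### Local finiteness and finiteness modulo periods. -/

section Finiteness

variable {V E : Type*} [DecidableEq V] [Fintype E]

/-- Pairing a point of norm at most `r` with the harmonic form `z - z₀` is linear in `z - z₀` from
above. It is quadratic from below, because `c` is within `1 / 2` of `z`. So `z` is bounded, and the
integral corners of the box have finitely many possibilities. -/
theorem mixedCells_finite (Γ : MetricGraph V E) (q : V → ℝ) (r : ℝ) :
    {P ∈ Γ.mixedCells q | ∃ x ∈ P, ‖x‖ ≤ r}.Finite := by
  classical
  by_cases hL : ∃ z₀, Γ.boundary ℝ z₀ = q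
  swap
  · convert Set.finite_empty
    refine Set.eq_empty_of_forall_notMem ?_
    rintro P ⟨⟨z, hz, -⟩, -⟩
    exact hL ⟨z, hz⟩
  obtain ⟨z₀, hz₀⟩ := hL
  obtain ⟨R, hR⟩ := exists_abs_le_of_sum_quadratic_le Γ.len
    (fun e => (|z₀ e| + 1 / 2) * Γ.len e + |r|) Γ.len_pos
    (fun e => add_nonneg (mul_nonneg (by positivity) (Γ.len_pos e).le) (abs_nonneg _)) 0
  obtain ⟨N, hN⟩ := exists_nat_ge (R + ∑ e, |z₀ e| + 1)
  refine Set.Finite.subset (((Set.finite_Icc (fun _ : E => (-N : ℤ)) (fun _ => (N : ℤ))).prod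
    (Set.finite_Icc (fun _ : E => (-N : ℤ)) (fun _ => (N : ℤ)))).image
    fun b : (E → ℤ) × (E → ℤ) =>
      Γ.integral '' Set.Icc (fun e => (b.1 e : ℝ)) (fun e => (b.2 e : ℝ)))
    ?_
  rintro _ ⟨⟨z, hz, rfl⟩, _, ⟨c, hc, rfl⟩, hx⟩
  have hzb : ∀ e, |z e - z₀ e| ≤ R := by
    refine hR (fun e => z e - z₀ e) ?_
    set ω : Γ.harmonicForms := ⟨_, Γ.sub_mem_harmonicForms hz hz₀⟩ with hω
    have hωe : ∀ e, (ω : E → ℝ) e = z e - z₀ e := fun e => rfl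
    have h1 : ‖ω‖ ≤ ∑ e, |z e - z₀ e| := by
      rw [Submodule.coe_norm, pi_norm_le_iff_of_nonneg (Finset.sum_nonneg fun e _ => abs_nonneg _)]
      intro e
      exact Finset.single_le_sum (f := fun e => |z e - z₀ e|) (fun e _ => abs_nonneg _)
        (Finset.mem_univ e)
    have h2 : Γ.integral c ω ≤ |r| * ∑ e, |z e - z₀ e| :=
      (le_abs_self _).trans (((Γ.integral c).le_opNorm ω).trans
        (mul_le_mul (hx.trans (le_abs_self r)) h1 (norm_nonneg _) (abs_nonneg _)))
    rw [integral_apply, Finset.mul_sum, ← sub_nonpos, ← Finset.sum_sub_distrib] at h2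
    refine le_trans (Finset.sum_le_sum fun e _ => ?_) h2
    have h3 := abs_sub_le_of_mem_dualBox hc e
    have h4 : -((|z₀ e| + 1 / 2) * |z e - z₀ e|) ≤ (c e - z e + z₀ e) * (z e - z₀ e) := by
      refine le_trans (neg_le_neg ?_) (neg_abs_le _)
      rw [abs_mul]
      refine mul_le_mul_of_nonneg_right ((abs_add_le _ _).trans ?_) (abs_nonneg _)
      linarith
    have h5 := mul_le_mul_of_nonneg_right h4 (Γ.len_pos e).le
    rw [hωe]
    linarith
  have hzN : ∀ e, |z e| + 1 ≤ N := by
    intro e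
    have h1 := Finset.single_le_sum (f := fun e => |z₀ e|) (fun e _ => abs_nonneg _)
        (Finset.mem_univ e)
    have h2 := abs_add_le (z e - z₀ e) (z₀ e)
    rw [sub_add_cancel] at h2
    have h3 := hzb e
    linarith
  refine ⟨(fun e => ⌈z e - 1 / 2⌉, fun e => ⌊z e + 1 / 2⌋),
    ⟨⟨fun e => ?_, fun e => ?_⟩, ⟨fun e => ?_, fun e => ?_⟩⟩, rfl⟩
  all_goals have h1 := abs_le.1 (show |z e| ≤ N - 1 by linarith [hzN e])
  · have : ((-N : ℤ) : ℝ) ≤ ⌈z e - 1 / 2⌉ := by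
      push_cast; linarith [Int.le_ceil (z e - 1 / 2)]
    exact_mod_cast this
  · exact Int.ceil_le.2 (by push_cast; linarith)
  · exact Int.le_floor.2 (by push_cast; linarith)
  · have : (⌊z e + 1 / 2⌋ : ℝ) ≤ ((N : ℤ) : ℝ) := by
      push_cast; linarith [Int.floor_le (z e + 1 / 2)]
    exact_mod_cast this

variable [Fintype V]

theorem abs_boundary_le (Γ : MetricGraph V E) (c : E → ℝ) (v : V) :
    |Γ.boundary ℝ c v| ≤ ∑ e, |c e| := by
  have h := Γ.sum_mem_boundary {v} c
  rw [Finset.sum_singleton] at h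
  rw [h]
  refine (Finset.abs_sum_le_sum_abs _ _).trans (Finset.sum_le_sum fun e _ => ?_)
  rw [abs_mul]
  refine mul_le_of_le_one_right (abs_nonneg _) ?_
  split_ifs <;> simp

/-- Up to integral cycles a box is determined by the boundary of its lower corner and its side
lengths. The sides are `0` or `1`, and the boundary is bounded because the corner is close to `z`,
whose boundary is `q`. -/
theorem mixedCells_finite_orbits (Γ : MetricGraph V E) (q : V → ℝ) :
    ∃ T ⊆ Γ.mixedCells q, T.Finite ∧ ∀ P ∈ Γ.mixedCells q, ∃ P' ∈ T, ∃ x ∈ Γ.periodLattice,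
      P = (fun y => y + x) '' P' := by
  classical
  set g : (E → ℝ) → (V → ℤ) × (E → ℤ) := fun z =>
    (Γ.boundary ℤ fun e => ⌈z e - 1 / 2⌉, fun e => ⌊z e + 1 / 2⌋ - ⌈z e - 1 / 2⌉) with hg
  obtain ⟨N, hN⟩ := exists_nat_ge (∑ v, |q v| + Fintype.card E)
  have hfin : (g '' {z | Γ.boundary ℝ z = q}).Finite := by
    refine ((Set.finite_Icc (fun _ : V => (-N : ℤ)) (fun _ => (N : ℤ))).prod
      (Set.finite_Icc (fun _ : E => (0 : ℤ)) (fun _ => (1 : ℤ)))).subset ?_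
    rintro _ ⟨z, hz, rfl⟩
    have hb : ∀ v, |((Γ.boundary ℤ (fun e => ⌈z e - 1 / 2⌉) v : ℤ) : ℝ)| ≤ N := by
      intro v
      have h1 := congrFun (Γ.boundary_intCast ℝ (fun e => ⌈z e - 1 / 2⌉)) v
      rw [← h1]
      have h2 : (fun e => (⌈z e - 1 / 2⌉ : ℝ)) = z + fun e => (⌈z e - 1 / 2⌉ : ℝ) - z e := by
        ext e; simp
      rw [h2, map_add, hz]
      refine (abs_add_le _ _).trans (le_trans (add_le_add ?_ ?_) hN)
      · exact Finset.single_le_sum (f := fun v => |q v|) (fun v _ => abs_nonneg _)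
          (Finset.mem_univ v)
      · refine (Γ.abs_boundary_le _ v).trans ?_
        refine (Finset.sum_le_card_nsmul _ _ 1 fun e _ => ?_).trans (by simp)
        rw [abs_le]
        constructor <;> linarith [Int.le_ceil (z e - 1 / 2), Int.ceil_lt_add_one (z e - 1 / 2)]
    refine ⟨⟨fun v => ?_, fun v => ?_⟩, ⟨fun e => ?_, fun e => ?_⟩⟩
    · have := (abs_le.1 (hb v)).1
      exact_mod_cast this
    · have := (abs_le.1 (hb v)).2
      exact_mod_cast this
    · have := ceil_le_floor (z e)
      have h2 : ⌈z e - 1 / 2⌉ ≤ ⌊z e + 1 / 2⌋ := by exact_mod_cast this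
      simpa [hg] using h2
    · have h1 := Int.le_ceil (z e - 1 / 2)
      have h2 := Int.floor_le (z e + 1 / 2)
      have h3 : (⌊z e + 1 / 2⌋ : ℝ) ≤ 1 + ⌈z e - 1 / 2⌉ := by linarith
      have h4 : ⌊z e + 1 / 2⌋ ≤ 1 + ⌈z e - 1 / 2⌉ := by exact_mod_cast h3
      simpa [hg] using h4
  obtain ⟨L, hL, hbij⟩ := Set.exists_subset_bijOn {z | Γ.boundary ℝ z = q} g
  have hLfin : L.Finite := hbij.finite_iff_finite.2 hfin
  refine ⟨(fun z => Γ.integral '' dualBox z) '' L, ?_, hLfin.image _, ?_⟩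
  · rintro _ ⟨z, hz, rfl⟩
    exact ⟨z, hL hz, rfl⟩
  rintro _ ⟨z, hz, rfl⟩
  obtain ⟨z', hz', hgz⟩ := hbij.surjOn ⟨z, hz, rfl⟩
  have h1 := congrArg Prod.fst hgz
  have h2 : ∀ e, ⌊z' e + 1 / 2⌋ - ⌈z' e - 1 / 2⌉ = ⌊z e + 1 / 2⌋ - ⌈z e - 1 / 2⌉ :=
    fun e => congrFun (congrArg Prod.snd hgz) e
  simp only [hg] at h1
  set u : E → ℤ := (fun e => ⌈z e - 1 / 2⌉) - fun e => ⌈z' e - 1 / 2⌉ with hu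
  refine ⟨_, ⟨z', hz', rfl⟩, Γ.integral fun e => (u e : ℝ), ⟨u, ?_, rfl⟩, ?_⟩
  · rw [mem_homology_iff, hu, map_sub, h1, sub_self]
  have hmem : ∀ c : E → ℝ, (c + fun e => (u e : ℝ)) ∈ dualBox z ↔ c ∈ dualBox z' := by
    intro c
    rw [mem_dualBox, mem_dualBox]
    refine forall_congr' fun e => ?_
    have h3 : (⌊z e + 1 / 2⌋ : ℝ) = ⌊z' e + 1 / 2⌋ - ⌈z' e - 1 / 2⌉ + ⌈z e - 1 / 2⌉ := by
      have := h2 e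
      have h4 : ⌊z e + 1 / 2⌋ = ⌊z' e + 1 / 2⌋ - ⌈z' e - 1 / 2⌉ + ⌈z e - 1 / 2⌉ := by omega
      rw [h4]; push_cast; ring
    simp only [Pi.add_apply, hu, Pi.sub_apply, Int.cast_sub, h3]
    constructor <;> rintro ⟨h5, h6⟩ <;> constructor <;> linarith
  ext y
  constructor
  · rintro ⟨c, hc, rfl⟩
    have h3 : c = (c - fun e => (u e : ℝ)) + fun e => (u e : ℝ) := by abel
    rw [h3] at hc ⊢
    exact ⟨_, ⟨_, (hmem _).1 hc, rfl⟩, (map_add Γ.integralMap _ _).symm⟩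
  · rintro ⟨_, ⟨c, hc, rfl⟩, rfl⟩
    exact ⟨_, (hmem c).2 hc, map_add Γ.integralMap _ _⟩

end Finiteness

end MetricGraph

namespace MetricGraph

/-! ### The periodic decomposition in integral coordinates. -/

section Coordinates

variable {V E : Type*} [DecidableEq V] [Fintype E] [Fintype V] [DecidableEq E]

/-- Evaluation at an integral cycle has integer coordinates because each `φ.symm (Pi.single i 1)`
lies in `Λ^*`. The bounds are integer combinations of edge lengths because boxes have integral
corners. -/
theorem isAdmissiblePolytope_image (Γ : MetricGraph V E) (hΓ : Γ.Connected) (A : AddSubgroup ℝ)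
    (hA : ∀ e, Γ.len e ∈ A) {n : ℕ} (φ : Γ.Dual ≃ₗ[ℝ] (Fin n → ℝ))
    (hφ : ∀ x : Γ.Dual, x ∈ Γ.dualLattice ↔ ∀ i, ∃ k : ℤ, φ x i = k) (z : E → ℝ) :
    IsAdmissiblePolytope A (φ '' (Γ.integral '' dualBox z)) := by
  have hφc : Continuous φ :=
    LinearMap.continuous_of_finiteDimensional (E := Γ.Dual) (F' := Fin n → ℝ) φ.toLinearMap
  refine ⟨((dualBox_nonempty z).image _).image _,
    ((Γ.isCompact_dualBox_image z).image hφc).isBounded, ?_⟩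
  obtain ⟨G, hG⟩ := Γ.exists_finset_cycles hΓ
  have hint : ∀ (i : Fin n) (u : Γ.homology ℤ), ∃ k : ℤ,
      φ.symm (Pi.single i 1) (Γ.cycleForm u) = k := by
    intro i u
    have h1 : φ.symm (Pi.single i 1) ∈ Γ.dualLattice := by
      rw [hφ]
      intro j
      rw [LinearEquiv.apply_symm_apply]
      by_cases h : j = i
      · exact ⟨1, by simp [h]⟩
      · exact ⟨0, by simp [h]⟩
    obtain ⟨w, -, hw, hw'⟩ := h1
    obtain ⟨m, hm⟩ := hw' u u.2
    refine ⟨m, ?_⟩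
    rw [hw, integral_apply, ← hm]
    exact Finset.sum_congr rfl fun e _ => by rw [mul_comm (w e)]; rfl
  choose k hk using hint
  have hcoord : ∀ (x : Γ.Dual) (u : Γ.homology ℤ),
      x (Γ.cycleForm u) = ∑ i, φ x i * k i u := by
    intro x u
    have h1 : x = ∑ i, φ x i • φ.symm (Pi.single i 1) := by
      apply φ.injective
      rw [map_sum]
      simp only [map_smul, LinearEquiv.apply_symm_apply]
      exact pi_eq_sum_univ' _
    conv_lhs => rw [h1]
    rw [sum_apply]
    exact Finset.sum_congr rfl fun i _ => by rw [← hk]; rfl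
  classical
  set b : Γ.homology ℤ → ℝ := fun u => ∑ e, max ((⌈z e - 1 / 2⌉ : ℝ) * (u : E → ℤ) e)
    ((⌊z e + 1 / 2⌋ : ℝ) * (u : E → ℤ) e) * Γ.len e with hb
  have hbA : ∀ u, b u ∈ A := by
    intro u
    refine sum_mem fun e _ => ?_
    have : max ((⌈z e - 1 / 2⌉ : ℝ) * (u : E → ℤ) e) ((⌊z e + 1 / 2⌋ : ℝ) * (u : E → ℤ) e) * Γ.len e
        = (max (⌈z e - 1 / 2⌉ * (u : E → ℤ) e) (⌊z e + 1 / 2⌋ * (u : E → ℤ) e)) • Γ.len e := by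
      rw [zsmul_eq_mul]; push_cast; rfl
    rw [this]
    exact zsmul_mem (hA e) _
  refine ⟨G.image fun u => (fun i => -k i u, -b u), ?_, ?_⟩
  · intro h hh
    obtain ⟨u, -, rfl⟩ := Finset.mem_image.1 hh
    exact neg_mem (hbA u)
  have hP : Γ.integral '' dualBox z = {x | ∀ u ∈ G, x (Γ.cycleForm u) ≤ b u} :=
    hG _ _ fun e => ceil_le_floor (z e)
  ext y
  have h2 : y ∈ φ '' (Γ.integral '' dualBox z) ↔ φ.symm y ∈ Γ.integral '' dualBox z := by
    constructor
    · rintro ⟨x, hx, rfl⟩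
      rwa [LinearEquiv.symm_apply_apply]
    · intro h
      exact ⟨_, h, φ.apply_symm_apply y⟩
  rw [h2, hP]
  change (∀ u ∈ G, _) ↔ ∀ h ∈ _, _
  rw [Finset.forall_mem_image]
  refine forall₂_congr fun u _ => ?_
  rw [hcoord, LinearEquiv.apply_symm_apply]
  simp only [Int.cast_neg, mul_neg, Finset.sum_neg_distrib, neg_le_neg_iff]

/-- In coordinates, the mixed cells form an admissible periodic decomposition. -/
theorem isAdmissiblePeriodicDecomposition_mixedCells (Γ : MetricGraph V E) (hΓ : Γ.Connected)
    (A : AddSubgroup ℝ) (hA : ∀ e, Γ.len e ∈ A) {n : ℕ} (φ : Γ.Dual ≃ₗ[ℝ] (Fin n → ℝ))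
    (hφ : ∀ x : Γ.Dual, x ∈ Γ.dualLattice ↔ ∀ i, ∃ k : ℤ, φ x i = k) {q : V → ℝ}
    (hq : ∑ v, q v = 0) :
    IsAdmissiblePeriodicDecomposition A (Γ.periodLattice.map φ.toAddEquiv.toAddMonoidHom)
      ((fun P => φ '' P) '' Γ.mixedCells q) where
  admissible := by
    rintro _ ⟨_, ⟨z, -, rfl⟩, rfl⟩
    exact Γ.isAdmissiblePolytope_image hΓ A hA φ hφ z
  locallyFinite := by
    have hφc : Continuous φ.symm := LinearMap.continuous_of_finiteDimensional
      (E := Fin n → ℝ) (F' := Γ.Dual) φ.symm.toLinearMap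
    intro x
    have hball : Metric.ball (φ.symm x) 1 ∈ nhds (φ.symm x) :=
      Metric.ball_mem_nhds (α := Γ.Dual) _ one_pos
    refine ⟨φ.symm ⁻¹' Metric.ball (φ.symm x) 1,
      hφc.continuousAt.preimage_mem_nhds hball, ?_⟩
    refine Set.Finite.subset (((Γ.mixedCells_finite q (‖φ.symm x‖ + 1)).image
      fun P => φ '' P).preimage Subtype.val_injective.injOn) ?_
    rintro ⟨_, P, hP, rfl⟩ ⟨_, ⟨y, hy, rfl⟩, hyU⟩
    refine ⟨P, ⟨hP, y, hy, ?_⟩, rfl⟩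
    have h1 : dist y (φ.symm x) < 1 := by simpa using hyU
    have h2 := norm_le_norm_add_norm_sub (φ.symm x) y
    rw [dist_comm] at h1
    have h3 : ‖φ.symm x - y‖ < 1 := (dist_eq_norm (E := Γ.Dual) (φ.symm x) y).symm.trans_lt h1
    linarith
  cover := by
    refine Set.eq_univ_of_forall fun y => ?_
    obtain ⟨P, hP, hy⟩ := Γ.mixedCells_cover hΓ hq (φ.symm y)
    exact ⟨_, ⟨P, hP, rfl⟩, φ.symm y, hy, φ.apply_symm_apply y⟩
  face_mem := by
    rintro _ ⟨_, ⟨z, hz, rfl⟩, rfl⟩ F ⟨-, l, rfl⟩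
    obtain ⟨ω, hω⟩ := Γ.exists_eval_eq (l ∘ₗ φ.toLinearMap)
    refine ⟨_, Γ.mixedCells_face hz ω, ?_⟩
    have hω' : ∀ x, l (φ x) = x ω := hω
    ext y
    constructor
    · rintro ⟨x, ⟨hx, hmax⟩, rfl⟩
      refine ⟨⟨x, hx, rfl⟩, ?_⟩
      rintro _ ⟨x', hx', rfl⟩
      rw [hω', hω']
      exact hmax x' hx'
    · rintro ⟨⟨x, hx, rfl⟩, hmax⟩
      refine ⟨x, ⟨hx, fun x' hx' => ?_⟩, rfl⟩
      rw [← hω', ← hω']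
      exact hmax _ ⟨x', hx', rfl⟩
  inter := by
    have key : ∀ z z' : E → ℝ, Γ.boundary ℝ z = q → Γ.boundary ℝ z' = q →
        (Γ.integral '' dualBox z ∩ Γ.integral '' dualBox z').Nonempty →
        IsFaceOf (φ '' (Γ.integral '' dualBox z) ∩ φ '' (Γ.integral '' dualBox z'))
          (φ '' (Γ.integral '' dualBox z)) := by
      rintro z z' hz hz' ⟨x, hx, hx'⟩
      obtain ⟨ω, hω⟩ := Γ.mixedCells_inter hz hz' hx hx'
      rw [← Set.image_inter φ.injective]
      refine ⟨⟨φ x, x, ⟨hx, hx'⟩, rfl⟩, LinearMap.comp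
        { toFun := fun y : Γ.Dual => y ω, map_add' := fun _ _ => rfl, map_smul' := fun _ _ => rfl }
        φ.symm.toLinearMap, ?_⟩
      rw [hω]
      ext y
      constructor
      · rintro ⟨w, ⟨hw, hmax⟩, rfl⟩
        refine ⟨⟨w, hw, rfl⟩, ?_⟩
        rintro _ ⟨w', hw', rfl⟩
        simpa using hmax w' hw'
      · rintro ⟨⟨w, hw, rfl⟩, hmax⟩
        refine ⟨w, ⟨hw, fun w' hw' => ?_⟩, rfl⟩
        simpa using hmax _ ⟨w', hw', rfl⟩
    rintro _ ⟨_, ⟨z, hz, rfl⟩, rfl⟩ _ ⟨_, ⟨z', hz', rfl⟩, rfl⟩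
    rcases Set.eq_empty_or_nonempty (Γ.integral '' dualBox z ∩ Γ.integral '' dualBox z') with h | h
    · left
      simp only [← Set.image_inter φ.injective, h, Set.image_empty]
    · right
      refine ⟨key z z' hz hz' h, ?_⟩
      rw [Set.inter_comm] at h
      have := key z' z hz' hz h
      rwa [Set.inter_comm] at this
  translate_mem := by
    rintro _ ⟨x, hx, rfl⟩ _ ⟨P, hP, rfl⟩
    refine ⟨_, Γ.mixedCells_translate hP hx, ?_⟩
    simp only [Set.image_image]
    exact Set.image_congr fun y _ => map_add φ y x
  finite_orbits := by
    obtain ⟨T, hT, hfin, horb⟩ := Γ.mixedCells_finite_orbits q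
    refine ⟨(fun P => φ '' P) '' T, Set.image_mono hT, hfin.image _, ?_⟩
    rintro _ ⟨P, hP, rfl⟩
    obtain ⟨P', hP', x, hx, rfl⟩ := horb P hP
    refine ⟨_, ⟨P', hP', rfl⟩, φ x, ⟨x, hx, rfl⟩, ?_⟩
    simp only [Set.image_image]
    exact Set.image_congr fun y _ => map_add φ y x

end Coordinates

end MetricGraph

namespace MetricGraph

/-! ### Strict flows and cut inequalities. -/

section Gap

variable {V E : Type*} [DecidableEq V] [Fintype E] [DecidableEq E]

/-- The excess at each vertex of the type `(S, m)`, with the edges in `S` distributed evenly to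
their ends, over the function `p`. -/
noncomputable def demand (Γ : MetricGraph V E) (p : V → ℝ) (S : Finset E) (m : V → ℤ) (v : V) : ℝ :=
  m v + 1 / 2 * ∑ e, (if e ∈ S then ((if Γ.src e = v then 1 else 0) +
    (if Γ.tgt e = v then 1 else 0) : ℝ) else 0) - p v

/-- The number of edges outside `S` in the cut defined by `Y`. -/
noncomputable def cutSize (Γ : MetricGraph V E) (S : Finset E) (Y : Finset V) : ℝ :=
  ∑ e, if e ∈ S then 0 else |(if Γ.tgt e ∈ Y then 1 else 0) - (if Γ.src e ∈ Y then 1 else 0 : ℝ)|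

/-- The slack in the cut condition for `Y`. -/
noncomputable def gap (Γ : MetricGraph V E) (p : V → ℝ) (S : Finset E) (m : V → ℤ)
    (Y : Finset V) : ℝ :=
  1 / 2 * Γ.cutSize S Y - ∑ v ∈ Y, Γ.demand p S m v

/-- There is a flow of absolute value less than `1 / 2`, vanishing on `S`, carrying the
type `(S, m)` to `p`. -/
def HasStrictFlow (Γ : MetricGraph V E) (p : V → ℝ) (S : Finset E) (m : V → ℤ) : Prop :=
  ∃ y : E → ℝ, (∀ e ∈ S, y e = 0) ∧ (∀ e, |y e| < 1 / 2) ∧ Γ.boundary ℝ y = -Γ.demand p S m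

theorem sum_demand (Γ : MetricGraph V E) (p : V → ℝ) (S : Finset E) (m : V → ℤ) (Y : Finset V) :
    ∑ v ∈ Y, Γ.demand p S m v = ∑ v ∈ Y, (m v : ℝ) + 1 / 2 * ∑ e, (if e ∈ S then
      ((if Γ.src e ∈ Y then 1 else 0) + (if Γ.tgt e ∈ Y then 1 else 0) : ℝ) else 0) -
        ∑ v ∈ Y, p v := by
  simp only [demand, Finset.sum_sub_distrib, Finset.sum_add_distrib, ← Finset.mul_sum]
  congr 3
  rw [Finset.sum_comm]
  refine Finset.sum_congr rfl fun e _ => ?_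
  split_ifs with h <;> simp [Finset.sum_add_distrib, *]

theorem sum_univ_demand [Fintype V] (Γ : MetricGraph V E) {p : V → ℝ} {S : Finset E} {m : V → ℤ}
    {d : ℤ} (hp : ∑ v, p v = d) (hd : (S.card : ℤ) + ∑ v, m v = d) :
    ∑ v, Γ.demand p S m v = 0 := by
  rw [sum_demand, hp, ← hd]
  have : ∑ e, (if e ∈ S then ((if Γ.src e ∈ Finset.univ then 1 else 0) +
      (if Γ.tgt e ∈ Finset.univ then 1 else 0) : ℝ) else 0) = 2 * S.card := by
    simp
    ring
  rw [this]
  push_cast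
  ring

/-- Such `Y` are the unions of connected components of the graph with `S` removed. -/
theorem cutSize_eq_zero_iff (Γ : MetricGraph V E) (S : Finset E) (Y : Finset V) :
    Γ.cutSize S Y = 0 ↔ ∀ e ∉ S, (Γ.src e ∈ Y ↔ Γ.tgt e ∈ Y) := by
  rw [cutSize, Finset.sum_eq_zero_iff_of_nonneg fun e _ => by split_ifs <;> simp]
  simp only [Finset.mem_univ, true_imp_iff]
  refine forall_congr' fun e => ?_
  by_cases h1 : e ∈ S <;> by_cases h2 : Γ.src e ∈ Y <;> by_cases h3 : Γ.tgt e ∈ Y <;>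
    simp [h1, h2, h3]

theorem gap_empty (Γ : MetricGraph V E) (p : V → ℝ) (S : Finset E) (m : V → ℤ) :
    Γ.gap p S m ∅ = 0 := by
  simp [gap, cutSize]

theorem gap_univ [Fintype V] (Γ : MetricGraph V E) {p : V → ℝ} {S : Finset E} {m : V → ℤ}
    {d : ℤ} (hp : ∑ v, p v = d) (hd : (S.card : ℤ) + ∑ v, m v = d) :
    Γ.gap p S m Finset.univ = 0 := by
  rw [gap, Γ.sum_univ_demand hp hd]
  simp [cutSize]

/-- The flow writes the gap as a sum of `1 / 2 ± y e` over the cut edges outside `S`, each term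
positive. -/
theorem HasStrictFlow.gap_nonneg [Fintype V] {Γ : MetricGraph V E} {p : V → ℝ} {S : Finset E}
    {m : V → ℤ} (h : Γ.HasStrictFlow p S m) (Y : Finset V) :
    0 ≤ Γ.gap p S m Y ∧ (Γ.gap p S m Y = 0 → Γ.cutSize S Y = 0) := by
  obtain ⟨y, hyS, hy, hb⟩ := h
  have h1 : Γ.gap p S m Y = ∑ e, ((1 / 2 * if e ∈ S then 0 else
      |(if Γ.tgt e ∈ Y then 1 else 0) - (if Γ.src e ∈ Y then 1 else 0 : ℝ)|) +
      y e * ((if Γ.tgt e ∈ Y then 1 else 0) - (if Γ.src e ∈ Y then 1 else 0))) := by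
    rw [Finset.sum_add_distrib, ← Γ.sum_mem_boundary, hb, ← Finset.mul_sum]
    simp only [Pi.neg_apply, Finset.sum_neg_distrib]
    rw [gap, cutSize]; ring
  have hnn : ∀ e ∈ Finset.univ, 0 ≤ ((1 / 2 * if e ∈ S then 0 else
      |(if Γ.tgt e ∈ Y then 1 else 0) - (if Γ.src e ∈ Y then 1 else 0 : ℝ)|) +
      y e * ((if Γ.tgt e ∈ Y then 1 else 0) - (if Γ.src e ∈ Y then 1 else 0))) := by
    intro e _
    have h2 := abs_lt.1 (hy e)
    by_cases hS : e ∈ S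
    · simp [hS, hyS e hS]
    · by_cases h3 : Γ.tgt e ∈ Y <;> by_cases h4 : Γ.src e ∈ Y <;> simp [hS, h3, h4] <;> linarith
  refine ⟨h1 ▸ Finset.sum_nonneg hnn, fun h0 => ?_⟩
  rw [h1, Finset.sum_eq_zero_iff_of_nonneg hnn] at h0
  rw [cutSize_eq_zero_iff]
  intro e he
  have h2 := abs_lt.1 (hy e)
  have h5 := h0 e (Finset.mem_univ e)
  by_cases h3 : Γ.tgt e ∈ Y <;> by_cases h4 : Γ.src e ∈ Y <;> simp [he, h3, h4] at h5 ⊢ <;> linarith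

theorem hasStrictFlow_iff [Fintype V] (Γ : MetricGraph V E) {p : V → ℝ} {S : Finset E}
    {m : V → ℤ} {d : ℤ} (hp : ∑ v, p v = d) (hd : (S.card : ℤ) + ∑ v, m v = d) :
    Γ.HasStrictFlow p S m ↔
      ∀ Y, 0 ≤ Γ.gap p S m Y ∧ (Γ.gap p S m Y = 0 → Γ.cutSize S Y = 0) := by
  refine ⟨HasStrictFlow.gap_nonneg, fun h => ?_⟩
  -- Capacities can be shrunk to `δ / 2` with `δ < 1`: the finitely many strict cut inequalities
  -- survive, and the tight ones involve no capacity. This makes the flow strict.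
  have hev : ∀ᶠ δ in nhdsWithin (1 : ℝ) (Set.Iio 1), ∀ Y : Finset V,
      ∑ v ∈ Y, Γ.demand p S m v ≤ δ / 2 * Γ.cutSize S Y := by
    rw [Filter.eventually_all]
    intro Y
    obtain ⟨h1, h2⟩ := h Y
    rcases h1.eq_or_lt with h3 | h3
    · have h4 := h2 h3.symm
      rw [gap, h4] at h3
      rw [h4]
      exact Filter.Eventually.of_forall fun δ => by linarith
    · have hc : Filter.Tendsto (fun δ : ℝ => δ / 2 * Γ.cutSize S Y) (nhdsWithin 1 (Set.Iio 1))
          (nhds (1 / 2 * Γ.cutSize S Y)) := by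
        have : Continuous fun δ : ℝ => δ / 2 * Γ.cutSize S Y := by fun_prop
        exact (this.tendsto 1).mono_left nhdsWithin_le_nhds
      rw [gap, sub_pos] at h3
      exact (hc.eventually (lt_mem_nhds h3)).mono fun δ hδ => hδ.le
  obtain ⟨δ, hδ, hδ0, hδ1⟩ := (hev.and (Ioo_mem_nhdsLT (zero_lt_one' ℝ))).exists
  obtain ⟨y, hy, hyb⟩ := Γ.exists_flow (fun e => if e ∈ S then 0 else -(δ / 2))
    (fun e => if e ∈ S then 0 else δ / 2) (fun e => by split_ifs <;> linarith)
    (Γ.demand p S m) (Γ.sum_univ_demand hp hd) (fun Y => by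
      refine (hδ Y).trans (le_of_eq ?_)
      rw [cutSize, Finset.mul_sum]
      refine Finset.sum_congr rfl fun e _ => ?_
      have : -(δ / 2) ≤ δ / 2 := by linarith
      by_cases hS : e ∈ S <;> by_cases h3 : Γ.tgt e ∈ Y <;> by_cases h4 : Γ.src e ∈ Y <;>
        simp [hS, h3, h4, this])
  refine ⟨-y, fun e he => ?_, fun e => ?_, by rw [map_neg, hyb]⟩
  · have := hy e
    simp only [he, if_true] at this
    simp [le_antisymm this.2 this.1]
  · have := hy e
    rw [Pi.neg_apply, abs_neg, abs_lt]
    split_ifs at this <;> constructor <;> linarith [this.1, this.2]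

end Gap

/-! ### The slack of a cut as a difference of slopes. -/

section Slopes

variable {V E : Type*} [DecidableEq V] [Fintype E]

theorem card_edgesIn (Γ : MetricGraph V E) (Y : Finset V) :
    ((Γ.edgesIn Y).card : ℝ) =
      ∑ e, (if Γ.src e ∈ Y then 1 else 0) * (if Γ.tgt e ∈ Y then 1 else 0 : ℝ) := by
  rw [edgesIn, Finset.card_filter]
  push_cast
  exact Finset.sum_congr rfl fun e _ => by split_ifs <;> simp_all

variable [Fintype V]

/-- The vertex function to which slope stability compares the multidegree. -/
noncomputable def canonicalWeight (Γ : MetricGraph V E) (H : V → ℤ) (d : ℤ) (v : V) : ℝ :=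
  H v * ((d + 1 - Γ.arithGenus Finset.univ : ℤ) / (∑ w, H w : ℤ)) + Γ.genus v - 1 +
    1 / 2 * ∑ e, ((if Γ.src e = v then 1 else 0) + (if Γ.tgt e = v then 1 else 0) : ℝ)

theorem sum_mem_canonicalWeight (Γ : MetricGraph V E) (H : V → ℤ) (d : ℤ) (Y : Finset V) :
    ∑ v ∈ Y, Γ.canonicalWeight H d v = (∑ v ∈ Y, H v : ℤ) *
      ((d + 1 - Γ.arithGenus Finset.univ : ℤ) / (∑ w, H w : ℤ)) +
      ∑ v ∈ Y, (Γ.genus v : ℝ) - Y.card + 1 / 2 * ∑ e, ((if Γ.src e ∈ Y then 1 else 0) + (if Γ.tgt e ∈ Y then 1 else 0) : ℝ) := by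
  simp only [canonicalWeight, Finset.sum_sub_distrib, Finset.sum_add_distrib, ← Finset.mul_sum,
    ← Finset.sum_mul]
  congr 1
  · push_cast; simp
  · congr 2
    all_goals
      rw [Finset.sum_comm]
      exact Finset.sum_congr rfl fun e _ => by simp

theorem sum_canonicalWeight (Γ : MetricGraph V E) (H : V → ℤ) (hH : 0 < ∑ v, H v) (d : ℤ) :
    ∑ v, Γ.canonicalWeight H d v = d := by
  have hH' : ((∑ v, H v : ℤ) : ℝ) ≠ 0 := by exact_mod_cast hH.ne'
  rw [sum_mem_canonicalWeight, mul_div_cancel₀ _ hH', arithGenus]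
  push_cast
  rw [card_edgesIn]
  simp only [Finset.mem_univ, if_true, Finset.sum_const, Finset.card_univ, nsmul_eq_mul]
  ring

variable [DecidableEq E]

/-- The numerator of the slope of the subsheaf supported on `Y`. -/
def eulerChar (Γ : MetricGraph V E) (S : Finset E) (m : V → ℤ) (Y : Finset V) : ℤ :=
  Γ.subsheafDegree S m Finset.univ Y + 1 - Γ.arithGenus Y

theorem eulerChar_univ (Γ : MetricGraph V E) {S : Finset E} {m : V → ℤ} {d : ℤ}
    (hd : (S.card : ℤ) + ∑ v, m v = d) :
    Γ.eulerChar S m Finset.univ = d + 1 - Γ.arithGenus Finset.univ := by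
  have h1 : S ∩ Γ.edgesIn Finset.univ = S := by ext; simp [edgesIn]
  have h2 : Γ.edgesBetween Finset.univ (Finset.univ \ Finset.univ) = ∅ := by
    ext; simp [edgesBetween]
  rw [eulerChar, subsheafDegree, h1, h2, ← hd]
  simp
  ring

/-- The genus and half-valence terms of `canonicalWeight` are what turns the symmetric count of half
edges in `gap` into the Euler characteristic of `F_Y`, leaving the multiple of the total slope. -/
theorem gap_canonicalWeight (Γ : MetricGraph V E) (H : V → ℤ) (d : ℤ) (S : Finset E) (m : V → ℤ)
    (Y : Finset V) : Γ.gap (Γ.canonicalWeight H d) S m Y = (∑ v ∈ Y, H v : ℤ) *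
      ((d + 1 - Γ.arithGenus Finset.univ : ℤ) / (∑ w, H w : ℤ)) - Γ.eulerChar S m Y := by
  have h1 : ((S ∩ Γ.edgesIn Y).card : ℝ) =
      ∑ e, if e ∈ S then (if Γ.src e ∈ Y then 1 else 0) * (if Γ.tgt e ∈ Y then 1 else 0 : ℝ)
        else 0 := by
    have : S ∩ Γ.edgesIn Y = Finset.univ.filter fun e => e ∈ S ∧ Γ.src e ∈ Y ∧ Γ.tgt e ∈ Y := by
      ext; simp [edgesIn]
    rw [this, Finset.card_filter]
    push_cast
    exact Finset.sum_congr rfl fun e _ => by split_ifs <;> simp_all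
  have h2 : ((Γ.edgesBetween Y (Finset.univ \ Y) \ S).card : ℝ) = Γ.cutSize S Y := by
    have : Γ.edgesBetween Y (Finset.univ \ Y) \ S = Finset.univ.filter fun e => e ∉ S ∧
        ((Γ.src e ∈ Y ∧ Γ.tgt e ∉ Y) ∨ (Γ.src e ∉ Y ∧ Γ.tgt e ∈ Y)) := by
      ext; simp [edgesBetween, and_comm]
    rw [this, Finset.card_filter, cutSize]
    push_cast
    refine Finset.sum_congr rfl fun e _ => ?_
    by_cases hS : e ∈ S <;> by_cases h3 : Γ.tgt e ∈ Y <;> by_cases h4 : Γ.src e ∈ Y <;>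
      simp [hS, h3, h4]
  rw [gap, sum_demand, sum_mem_canonicalWeight, eulerChar, subsheafDegree]
  generalize ((d + 1 - Γ.arithGenus Finset.univ : ℤ) : ℝ) / (∑ w, H w : ℤ) = κ
  rw [arithGenus]
  push_cast
  rw [h1, h2, card_edgesIn]
  -- Checked edge by edge, according to membership in `S` and the number of ends in `Y`.
  have key : 1 / 2 * Γ.cutSize S Y - 1 / 2 * ∑ e, (if e ∈ S then
      ((if Γ.src e ∈ Y then 1 else 0) + (if Γ.tgt e ∈ Y then 1 else 0) : ℝ) else 0) +
      1 / 2 * ∑ e, ((if Γ.src e ∈ Y then 1 else 0) + (if Γ.tgt e ∈ Y then 1 else 0) : ℝ) +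
      (∑ e, if e ∈ S then (if Γ.src e ∈ Y then 1 else 0) * (if Γ.tgt e ∈ Y then 1 else 0 : ℝ)
        else 0) = Γ.cutSize S Y +
      ∑ e, (if Γ.src e ∈ Y then 1 else 0) * (if Γ.tgt e ∈ Y then 1 else 0 : ℝ) := by
    simp only [cutSize, Finset.mul_sum]
    simp only [← Finset.sum_sub_distrib, ← Finset.sum_add_distrib]
    refine Finset.sum_congr rfl fun e _ => ?_
    by_cases hS : e ∈ S <;> by_cases h3 : Γ.tgt e ∈ Y <;> by_cases h4 : Γ.src e ∈ Y <;>
      simp [hS, h3, h4] <;> norm_num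
  linarith

theorem gap_eq_mul_slope (Γ : MetricGraph V E) {H : V → ℤ} (hH : ∀ v, 0 < H v) {d : ℤ}
    {S : Finset E} {m : V → ℤ} (hd : (S.card : ℤ) + ∑ v, m v = d) {Y : Finset V}
    (hY : Y.Nonempty) :
    Γ.gap (Γ.canonicalWeight H d) S m Y = (∑ v ∈ Y, H v : ℤ) *
      ((Γ.slope H S m Finset.univ Finset.univ - Γ.slope H S m Finset.univ Y : ℚ) : ℝ) := by
  have hpos : 0 < ∑ v ∈ Y, H v := Finset.sum_pos (fun v _ => hH v) hY
  have hne : ((∑ v ∈ Y, H v : ℤ) : ℝ) ≠ 0 := by exact_mod_cast hpos.ne'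
  have h1 : (Γ.slope H S m Finset.univ Finset.univ : ℝ) =
      (d + 1 - Γ.arithGenus Finset.univ : ℤ) / (∑ w, H w : ℤ) := by
    rw [slope, ← Γ.eulerChar_univ hd, eulerChar, Rat.cast_div, Rat.cast_intCast, Rat.cast_intCast]
  have h2 : (Γ.slope H S m Finset.univ Y : ℝ) = Γ.eulerChar S m Y / (∑ w ∈ Y, H w : ℤ) := by
    rw [slope, eulerChar, Rat.cast_div, Rat.cast_intCast, Rat.cast_intCast]
  rw [gap_canonicalWeight, Rat.cast_sub, h1, h2, mul_sub, mul_div_cancel₀ _ hne]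

theorem gap_nonneg_iff (Γ : MetricGraph V E) {H : V → ℤ} (hH : ∀ v, 0 < H v) {d : ℤ}
    {S : Finset E} {m : V → ℤ} (hd : (S.card : ℤ) + ∑ v, m v = d) {Y : Finset V}
    (hY : Y.Nonempty) : 0 ≤ Γ.gap (Γ.canonicalWeight H d) S m Y ↔
      Γ.slope H S m Finset.univ Y ≤ Γ.slope H S m Finset.univ Finset.univ := by
  have hpos : (0 : ℝ) < (∑ v ∈ Y, H v : ℤ) := by
    exact_mod_cast Finset.sum_pos (fun v _ => hH v) hY
  rw [Γ.gap_eq_mul_slope hH hd hY, mul_nonneg_iff_of_pos_left hpos, Rat.cast_nonneg, sub_nonneg]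

theorem gap_eq_zero_iff (Γ : MetricGraph V E) {H : V → ℤ} (hH : ∀ v, 0 < H v) {d : ℤ}
    {S : Finset E} {m : V → ℤ} (hd : (S.card : ℤ) + ∑ v, m v = d) {Y : Finset V}
    (hY : Y.Nonempty) : Γ.gap (Γ.canonicalWeight H d) S m Y = 0 ↔
      Γ.slope H S m Finset.univ Y = Γ.slope H S m Finset.univ Finset.univ := by
  have hpos : (0 : ℝ) < (∑ v ∈ Y, H v : ℤ) := by
    exact_mod_cast Finset.sum_pos (fun v _ => hH v) hY
  rw [Γ.gap_eq_mul_slope hH hd hY, mul_eq_zero, or_iff_right hpos.ne', Rat.cast_eq_zero,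
    sub_eq_zero, eq_comm]

theorem isSemistable_iff_gap (Γ : MetricGraph V E) {H : V → ℤ} (hH : ∀ v, 0 < H v) {d : ℤ}
    {S : Finset E} {m : V → ℤ} (hd : (S.card : ℤ) + ∑ v, m v = d) :
    Γ.IsSemistable H S m ↔ ∀ Y : Finset V, Y.Nonempty → Y ⊂ Finset.univ →
      0 ≤ Γ.gap (Γ.canonicalWeight H d) S m Y :=
  forall₂_congr fun _ hY => imp_congr_right fun _ => (Γ.gap_nonneg_iff hH hd hY).symm

/-- Edges leaving `W` belong to `S` and are not subtracted, so stability on `W` can be tested with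
slopes in the whole curve. -/
theorem slope_eq_of_subset (Γ : MetricGraph V E) (H : V → ℤ) {S : Finset E} (m : V → ℤ)
    {W Y : Finset V} (hW : ∀ e ∉ S, (Γ.src e ∈ W ↔ Γ.tgt e ∈ W)) (hY : Y ⊆ W) :
    Γ.slope H S m W Y = Γ.slope H S m Finset.univ Y := by
  have : Γ.edgesBetween Y (W \ Y) \ S = Γ.edgesBetween Y (Finset.univ \ Y) \ S := by
    ext e
    simp only [edgesBetween, Finset.mem_sdiff, Finset.mem_filter, Finset.mem_univ, true_and]
    refine and_congr_left fun he => ?_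
    have h1 := hW e he
    have h2 := @hY (Γ.src e)
    have h3 := @hY (Γ.tgt e)
    tauto
  rw [slope, slope, subsheafDegree, subsheafDegree, this]

end Slopes

end MetricGraph

namespace MetricGraph

/-! ### Polystable and quasistable types as strict flow conditions. -/

section Stability

variable {V E : Type*} [Fintype E] [DecidableEq E]

theorem gradedNodes_eq_iff (Γ : MetricGraph V E) {k : ℕ} (step : V → Fin k) (S : Finset E) :
    Γ.gradedNodes step S = S ↔ ∀ e ∉ S, step (Γ.src e) = step (Γ.tgt e) := by
  rw [gradedNodes, Finset.union_eq_left]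
  constructor
  · intro h e he
    by_contra hne
    exact he (h (by simpa using hne))
  · intro h e he
    by_contra hS
    exact (by simpa using he : step (Γ.src e) ≠ step (Γ.tgt e)) (h e hS)

variable [DecidableEq V]

theorem gradedDegree_eq (Γ : MetricGraph V E) {k : ℕ} {step : V → Fin k} {S : Finset E}
    (m : V → ℤ) (h : ∀ e ∉ S, step (Γ.src e) = step (Γ.tgt e)) :
    Γ.gradedDegree step S m = m := by
  ext v
  rw [gradedDegree, Finset.filter_false_of_mem, Finset.card_empty, Nat.cast_zero, sub_zero]
  rintro e - ⟨he, h1 | h1⟩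
  · obtain ⟨rfl, h2⟩ := h1
    exact h2.ne (h e he)
  · obtain ⟨rfl, h2⟩ := h1
    exact h2.ne (h e he).symm

/-- The slack is additive along partitions not separated by edges outside `S`. -/
theorem gap_eq_sum_fibers (Γ : MetricGraph V E) (p : V → ℝ) {k : ℕ} {step : V → Fin k}
    {S : Finset E} (m : V → ℤ) (h : ∀ e ∉ S, step (Γ.src e) = step (Γ.tgt e)) (Y : Finset V) :
    Γ.gap p S m Y = ∑ j, Γ.gap p S m (Y.filter fun v => step v = j) := by
  simp only [gap, Finset.sum_sub_distrib, ← Finset.mul_sum]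
  rw [Finset.sum_fiberwise]
  congr 2
  simp only [cutSize]
  rw [Finset.sum_comm]
  refine Finset.sum_congr rfl fun e _ => ?_
  by_cases hS : e ∈ S
  · simp [hS]
  · simp only [hS, if_false, Finset.mem_filter, h e hS]
    rw [Finset.sum_eq_single (step (Γ.tgt e))]
    · simp
    · intro j _ hj; simp [hj.symm]
    · simp

variable [Fintype V]

/-- Polystable types are the types admitting a strict flow. -/
theorem isPolystable_iff (Γ : MetricGraph V E) {H : V → ℤ} (hH : ∀ v, 0 < H v) [Nonempty V]
    {d : ℤ} {S : Finset E} {m : V → ℤ} (hd : (S.card : ℤ) + ∑ v, m v = d) :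
    Γ.IsPolystable H S m ↔ Γ.HasStrictFlow (Γ.canonicalWeight H d) S m := by
  have hsum := Γ.sum_canonicalWeight H
    (Finset.sum_pos (fun v _ => hH v) Finset.univ_nonempty) d
  rw [Γ.hasStrictFlow_iff hsum hd]
  constructor
  · rintro ⟨hss, k, step, ⟨-, hJH⟩, hnodes, hdeg⟩
    rw [gradedNodes_eq_iff] at hnodes
    rw [hdeg] at hJH
    have hpiece : ∀ j, ∀ e ∉ S, (Γ.src e ∈ Finset.univ.filter (fun v => step v = j) ↔
        Γ.tgt e ∈ Finset.univ.filter (fun v => step v = j)) := fun j e he => by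
      simp [hnodes e he]
    have hnn : ∀ Y, 0 ≤ Γ.gap (Γ.canonicalWeight H d) S m Y := by
      intro Y
      rcases Y.eq_empty_or_nonempty with rfl | hY
      · exact (Γ.gap_empty _ _ _).ge
      rcases eq_or_ne Y Finset.univ with rfl | hne
      · exact (Γ.gap_univ hsum hd).ge
      · exact (Γ.isSemistable_iff_gap hH hd).1 hss Y hY
          (Finset.ssubset_univ_iff.2 hne)
    refine fun Y => ⟨hnn Y, fun h0 => ?_⟩
    -- A zero gap splits into zero gaps on the Jordan–Hölder pieces. Stability of a piece forces `Y`
    -- to contain it or miss it, so no edge outside `S` is cut.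
    rw [Γ.gap_eq_sum_fibers _ m hnodes, Finset.sum_eq_zero_iff_of_nonneg fun j _ => hnn _] at h0
    rw [cutSize_eq_zero_iff]
    intro e he
    have hj := h0 (step (Γ.src e)) (Finset.mem_univ _)
    set j := step (Γ.src e) with hjdef
    rcases (Y.filter fun v => step v = j).eq_empty_or_nonempty with hemp | hne
    · have h1 : ∀ v, step v = j → v ∉ Y := fun v hv hvY =>
        Finset.notMem_empty v (hemp ▸ Finset.mem_filter.2 ⟨hvY, hv⟩)
      exact iff_of_false (h1 _ rfl) (h1 _ (hnodes e he).symm)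
    · have hsub : (Y.filter fun v => step v = j) ⊆ Finset.univ.filter fun v => step v = j :=
        Finset.filter_subset_filter _ (Finset.subset_univ _)
      rcases hsub.eq_or_ssubset with heq | hss'
      · have h1 : ∀ v, step v = j → v ∈ Y := fun v hv =>
          (Finset.mem_filter.1 (heq ▸ Finset.mem_filter.2 ⟨Finset.mem_univ v, hv⟩)).1
        exact iff_of_true (h1 _ rfl) (h1 _ (hnodes e he).symm)
      · have h1 := (hJH j).1 _ hne hss'
        rw [(hJH j).2, Γ.slope_eq_of_subset H m (hpiece j) hsub] at h1
        exact absurd ((Γ.gap_eq_zero_iff hH hd hne).1 hj) h1.ne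
  · intro h
    refine ⟨(Γ.isSemistable_iff_gap hH hd).2 fun Y _ _ => (h Y).1, ?_⟩
    -- The pieces of the filtration are the connected components of the graph without `S`; their
    -- order is irrelevant because every edge joining two of them is in `S`.
    let r : Setoid V := Relation.EqvGen.setoid fun a b => ∃ e ∉ S, Γ.src e = a ∧ Γ.tgt e = b
    obtain ⟨k, ⟨ε⟩⟩ := Finite.exists_equiv_fin (Quotient r)
    set step : V → Fin k := fun v => ε (Quotient.mk r v) with hstep
    have hnodes : ∀ e ∉ S, step (Γ.src e) = step (Γ.tgt e) := fun e he =>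
      congrArg ε (Quotient.sound (Relation.EqvGen.rel _ _ ⟨e, he, rfl, rfl⟩))
    have hpiece : ∀ j, ∀ e ∉ S, (Γ.src e ∈ Finset.univ.filter (fun v => step v = j) ↔
        Γ.tgt e ∈ Finset.univ.filter (fun v => step v = j)) := fun j e he => by
      simp [hnodes e he]
    have hsurj : Function.Surjective step := ε.surjective.comp Quotient.mk_surjective
    refine ⟨k, step, ⟨hsurj, fun j => ?_⟩, (Γ.gradedNodes_eq_iff step S).2 hnodes,
      Γ.gradedDegree_eq m hnodes⟩
    rw [Γ.gradedDegree_eq m hnodes]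
    have hsat : ∀ Y : Finset V, Γ.cutSize S Y = 0 → ∀ a b, step a = step b → (a ∈ Y ↔ b ∈ Y) := by
      intro Y hY a b hab
      rw [cutSize_eq_zero_iff] at hY
      have h1 : Relation.EqvGen (fun a b => ∃ e ∉ S, Γ.src e = a ∧ Γ.tgt e = b) a b :=
        Quotient.exact (ε.injective hab)
      induction h1 with
      | rel a b hr => obtain ⟨e, he, rfl, rfl⟩ := hr; exact hY e he
      | refl => rfl
      | symm a b _ ih => exact (ih hab.symm).symm
      | trans a b c h1 h2 ih1 ih2 =>
        have h3 : step a = step b := congrArg ε (Quotient.sound h1)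
        have h4 : step b = step c := congrArg ε (Quotient.sound h2)
        exact (ih1 h3).trans (ih2 h4)
    obtain ⟨w, hw⟩ := hsurj j
    have hWne : (Finset.univ.filter fun v => step v = j).Nonempty := ⟨w, by simp [hw]⟩
    have hW0 : Γ.gap (Γ.canonicalWeight H d) S m (Finset.univ.filter fun v => step v = j) = 0 := by
      have h1 := Γ.gap_univ hsum hd
      rw [Γ.gap_eq_sum_fibers _ m hnodes, Finset.sum_eq_zero_iff_of_nonneg fun j _ => (h _).1] at h1
      exact h1 j (Finset.mem_univ j)
    have hslope := (Γ.gap_eq_zero_iff hH hd hWne).1 hW0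
    rw [Γ.slope_eq_of_subset H m (hpiece j) (Finset.Subset.refl _)]
    refine ⟨fun Y hY hYW => ?_, hslope⟩
    rw [Γ.slope_eq_of_subset H m (hpiece j) hYW.1,
      Γ.slope_eq_of_subset H m (hpiece j) (Finset.Subset.refl _), hslope]
    refine lt_of_le_of_ne ((Γ.gap_nonneg_iff hH hd hY).1 (h Y).1) fun heq => ?_
    have h1 := hsat Y ((h Y).2 ((Γ.gap_eq_zero_iff hH hd hY).2 heq))
    obtain ⟨a, ha⟩ := hY
    refine hYW.2 fun b hb => ?_
    have h2 := (Finset.mem_filter.1 (hYW.1 ha)).2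
    have h3 := (Finset.mem_filter.1 hb).2
    exact (h1 a b (h2.trans h3.symm)).1 ha

/-- Bounded denominators keep nonzero gaps away from `0`, which leaves room for a perturbation. -/
theorem exists_int_eq_mul_gap (Γ : MetricGraph V E) {H : V → ℤ} (hH : 0 < ∑ v, H v) (d : ℤ)
    (S : Finset E) (m : V → ℤ) (Y : Finset V) :
    ∃ N : ℤ, Γ.gap (Γ.canonicalWeight H d) S m Y * (∑ v, H v : ℤ) = N := by
  have hne : ((∑ v, H v : ℤ) : ℝ) ≠ 0 := by exact_mod_cast hH.ne'
  refine ⟨(∑ v ∈ Y, H v) * (d + 1 - Γ.arithGenus Finset.univ) - Γ.eulerChar S m Y * ∑ v, H v, ?_⟩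
  rw [gap_canonicalWeight, sub_mul, mul_assoc, div_mul_cancel₀ _ hne]
  push_cast
  ring

/-- Quasistable types are the types admitting a strict flow for a small perturbation. -/
theorem exists_isQuasistable_iff (Γ : MetricGraph V E) {H : V → ℤ} (hH : ∀ v, 0 < H v) (v : V)
    (d : ℤ) : ∃ p : V → ℝ, ∑ w, p w = d ∧ ∀ (S : Finset E) (m : V → ℤ),
      (S.card : ℤ) + ∑ w, m w = d → (Γ.IsQuasistable H v S m ↔ Γ.HasStrictFlow p S m) := by
  have hHpos : 0 < ∑ w, H w := Finset.sum_pos (fun w _ => hH w) ⟨v, Finset.mem_univ v⟩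
  have hHpos' : (0 : ℝ) < (∑ w, H w : ℤ) := by exact_mod_cast hHpos
  have hVpos : (0 : ℝ) < Fintype.card V := by
    exact_mod_cast Fintype.card_pos_iff.2 ⟨v⟩
  have hsum := Γ.sum_canonicalWeight H hHpos d
  -- Nonzero gaps have absolute value at least `1 / ∑ H`, twice the largest change `δ |V|` caused by
  -- the perturbation.
  set δ : ℝ := 1 / (2 * Fintype.card V * (∑ w, H w : ℤ)) with hδ
  have hδpos : 0 < δ := by positivity
  have hδcard : δ * Fintype.card V * (∑ w, H w : ℤ) < 1 := by
    rw [hδ]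
    have h1 := hHpos'.ne'
    have h2 := hVpos.ne'
    field_simp
    norm_num
  -- The perturbation has total `0`. For proper nonempty `Y` it lowers the gap by `δ (|V| - |Y|)` if
  -- `v ∈ Y` and raises it by `δ |Y|` otherwise, so zero gaps become forbidden or positive
  -- accordingly.
  set p : V → ℝ := fun w => Γ.canonicalWeight H d w -
    δ * ((if w = v then (Fintype.card V : ℝ) else 0) - 1) with hp
  have hpY : ∀ Y : Finset V, ∑ w ∈ Y, p w = ∑ w ∈ Y, Γ.canonicalWeight H d w -
      δ * ((if v ∈ Y then (Fintype.card V : ℝ) else 0) - Y.card) := by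
    intro Y
    simp only [hp, Finset.sum_sub_distrib, ← Finset.mul_sum]
    simp
  have hpsum : ∑ w, p w = d := by
    rw [hpY, hsum]; simp
  refine ⟨p, hpsum, fun S m hd => ?_⟩
  have hgap : ∀ Y, Γ.gap p S m Y = Γ.gap (Γ.canonicalWeight H d) S m Y -
      δ * ((if v ∈ Y then (Fintype.card V : ℝ) else 0) - Y.card) := by
    intro Y
    rw [gap, gap, sum_demand, sum_demand, hpY]
    ring
  have hposgap : ∀ Y, 0 < Γ.gap (Γ.canonicalWeight H d) S m Y →
      δ * Fintype.card V < Γ.gap (Γ.canonicalWeight H d) S m Y := by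
    intro Y h
    obtain ⟨N, hN⟩ := Γ.exists_int_eq_mul_gap hHpos d S m Y
    have h1 : (0 : ℝ) < N := hN ▸ mul_pos h hHpos'
    have h2 : (1 : ℝ) ≤ N := by
      have : 0 < N := by exact_mod_cast h1
      exact_mod_cast (by omega : 1 ≤ N)
    exact lt_of_mul_lt_mul_right (hδcard.trans_le (hN ▸ h2)) hHpos'.le
  have hneggap : ∀ Y, Γ.gap (Γ.canonicalWeight H d) S m Y < 0 →
      Γ.gap (Γ.canonicalWeight H d) S m Y < -(δ * Fintype.card V) := by
    intro Y h
    obtain ⟨N, hN⟩ := Γ.exists_int_eq_mul_gap hHpos d S m Y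
    have h1 : (N : ℝ) < 0 := hN ▸ mul_neg_of_neg_of_pos h hHpos'
    have h2 : (N : ℝ) ≤ -1 := by
      have : N < 0 := by exact_mod_cast h1
      exact_mod_cast (by omega : N ≤ -1)
    refine lt_of_mul_lt_mul_right ?_ hHpos'.le
    rw [hN]
    linarith
  have hcard : ∀ Y : Finset V, (Y.card : ℝ) ≤ Fintype.card V := fun Y => by
    exact_mod_cast Finset.card_le_univ Y
  have hcard' : ∀ Y : Finset V, Y ⊂ Finset.univ → (Y.card : ℝ) < Fintype.card V := fun Y hY => by
    exact_mod_cast Finset.card_lt_card hY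
  rw [IsQuasistable, Γ.isSemistable_iff_gap hH hd, Γ.hasStrictFlow_iff hpsum hd]
  constructor
  · rintro ⟨hss, hq⟩ Y
    rcases Y.eq_empty_or_nonempty with rfl | hY
    · rw [gap_empty]; exact ⟨le_rfl, fun _ => by simp [cutSize]⟩
    rcases eq_or_ne Y Finset.univ with rfl | hne
    · rw [Γ.gap_univ hpsum hd]; exact ⟨le_rfl, fun _ => by simp [cutSize]⟩
    have hY' := Finset.ssubset_univ_iff.2 hne
    have hpos : 0 < Γ.gap p S m Y := by
      rw [hgap]
      have h1 := hss Y hY hY'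
      have h2 : (0 : ℝ) < Y.card := by exact_mod_cast hY.card_pos
      have h3 := mul_pos hδpos h2
      split_ifs with hv
      · have h4 : 0 < Γ.gap (Γ.canonicalWeight H d) S m Y := lt_of_le_of_ne h1 fun h5 =>
          hq Y hY hY' ((Γ.gap_eq_zero_iff hH hd hY).1 h5.symm) hv
        have h6 := hposgap Y h4
        linarith
      · linarith
    exact ⟨hpos.le, fun h => absurd h hpos.ne'⟩
  · intro h
    have key : ∀ Y : Finset V, Y ⊂ Finset.univ →
        0 ≤ Γ.gap (Γ.canonicalWeight H d) S m Y ∧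
        (v ∈ Y → 0 < Γ.gap (Γ.canonicalWeight H d) S m Y) := by
      intro Y hY
      have h1 := (h Y).1
      rw [hgap] at h1
      split_ifs at h1 with hv
      · have h2 := mul_pos hδpos (sub_pos.2 (hcard' Y hY))
        have h3 : 0 < Γ.gap (Γ.canonicalWeight H d) S m Y := by linarith
        exact ⟨h3.le, fun _ => h3⟩
      · refine ⟨?_, fun h' => absurd h' hv⟩
        by_contra hneg
        have h2 := hneggap Y (not_le.1 hneg)
        have h3 := mul_le_mul_of_nonneg_left (hcard Y) hδpos.le
        linarith
    refine ⟨fun Y _ hY => (key Y hY).1, fun Y hYne hY heq hv => ?_⟩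
    exact ((key Y hY).2 hv).ne' ((Γ.gap_eq_zero_iff hH hd hYne).2 heq)

end Stability

end MetricGraph

/-- A function with locally constant integer slopes whose slope does not change and vanishes
at the start is constant. -/
theorem eq_of_locally_linear {F : ℝ → ℝ} {l : ℝ} (hl : 0 < l) (ρ r : ℝ → ℤ)
    (hright : ∀ t ∈ Set.Ico 0 l, ∀ᶠ s in nhdsWithin t (Set.Ioi t), F s = F t + ρ t * (s - t))
    (hleft : ∀ t ∈ Set.Ioc 0 l, ∀ᶠ s in nhdsWithin t (Set.Iio t), F s = F t + r t * (t - s))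
    (hsum : ∀ t ∈ Set.Ioo 0 l, ρ t + r t = 0) (h0 : ρ 0 = 0) : F l = F 0 ∧ r l = 0 := by
  -- Two distinct points to the left of `t` determine both the slope and the value at `t`. With
  -- `hsum` the right slope then vanishes as well, and continuous induction continues past `t`.
  have hleft0 : ∀ t ∈ Set.Ioc 0 l, (∀ u, 0 ≤ u → u < t → F u = F 0) → F t = F 0 ∧ r t = 0 := by
    intro t ht hu
    have hev : ∀ᶠ s in nhdsWithin t (Set.Iio t), F 0 = F t + r t * (t - s) ∧ s < t := by
      filter_upwards [hleft t ht, Ioo_mem_nhdsLT ht.1] with s hs hs'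
      exact ⟨(hu s hs'.1.le hs'.2).symm.trans hs, hs'.2⟩
    obtain ⟨s, hs, hst⟩ := hev.exists
    have hev' := hev.and (Ioo_mem_nhdsLT hst)
    obtain ⟨s', ⟨hs', hst'⟩, hss', -⟩ := hev'.exists
    have h1 : (r t : ℝ) * (s' - s) = 0 := by linarith
    have h2 : (r t : ℝ) = 0 := by
      rcases mul_eq_zero.1 h1 with h | h
      · exact h
      · exact absurd h (sub_pos.2 hss').ne'
    rw [h2] at hs
    exact ⟨by linarith, by exact_mod_cast h2⟩
  set s : Set ℝ := {t | ∀ u, 0 ≤ u → u ≤ t → F u = F 0} with hs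
  have hsub : Set.Icc 0 l ⊆ s := by
    refine IsClosed.Icc_subset_of_forall_mem_nhdsWithin ?_ ?_ ?_
    · refine isClosed_of_closure_subset fun t ht => ?_
      have htI : t ∈ Set.Icc 0 l := closure_minimal Set.inter_subset_right isClosed_Icc ht
      have hlt : ∀ u, 0 ≤ u → u < t → F u = F 0 := by
        intro u hu0 hut
        obtain ⟨t', htu, ht's, -⟩ := mem_closure_iff.1 ht (Set.Ioi u) isOpen_Ioi hut
        exact ht's u hu0 (le_of_lt htu)
      refine ⟨fun u hu0 hut => ?_, htI⟩
      rcases hut.lt_or_eq with h | rfl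
      · exact hlt u hu0 h
      · rcases hu0.lt_or_eq with h | h
        · exact (hleft0 u ⟨h, htI.2⟩ hlt).1
        · rw [← h]
    · intro u h1 h2
      rw [le_antisymm h2 h1]
    · rintro t ⟨hts, ht0, htl⟩
      have hρ : ρ t = 0 := by
        rcases ht0.lt_or_eq with h | h
        · have h1 := (hleft0 t ⟨h, htl.le⟩ fun u hu0 hut => hts u hu0 hut.le).2
          have h2 := hsum t ⟨h, htl⟩
          omega
        · rw [← h, h0]
      have hev := hright t ⟨ht0, htl⟩
      rw [hρ] at hev
      obtain ⟨b, hb, hsubs⟩ := (mem_nhdsGT_iff_exists_Ioo_subset).1 hev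
      refine Filter.mem_of_superset (Ioo_mem_nhdsGT hb) fun x hx u hu0 hux => ?_
      rcases le_or_gt u t with h | h
      · exact hts u hu0 h
      · have h3 : F u = F t + ((0 : ℤ) : ℝ) * (u - t) := hsubs ⟨h, hux.trans_lt hx.2⟩
        rw [h3, hts t ht0 le_rfl]; simp
  have hall : ∀ u, 0 ≤ u → u ≤ l → F u = F 0 := hsub ⟨hl.le, le_rfl⟩
  exact hleft0 l ⟨hl, le_rfl⟩ fun u hu0 hul => hall u hu0 hul.le

namespace MetricGraph

/-! ### Piecewise linear functions on an edge, built from ramps bending at given points. -/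

section Points

variable {V E : Type*} [DecidableEq E]

/-- The vertex at which the initial segment of the edge through a point starts. -/
def basePoint (Γ : MetricGraph V E) : Γ.Point → V
  | Sum.inl w => w
  | Sum.inr ⟨e, _⟩ => Γ.src e

/-- The chain of the initial segment from the base vertex of a point to the point. -/
noncomputable def offset (Γ : MetricGraph V E) : Γ.Point → E → ℝ
  | Sum.inl _ => 0
  | Sum.inr ⟨e, t⟩ => Pi.single e ((t : ℝ) / Γ.len e)

/-- The indicator function of the interior of an edge. -/
def onEdge (Γ : MetricGraph V E) (e : E) : Γ.Point → ℤ
  | Sum.inl _ => 0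
  | Sum.inr ⟨e', _⟩ => if e' = e then 1 else 0

/-- The indicator function of the points of an edge at distance at most `t` from the source. -/
noncomputable def slopeRight (Γ : MetricGraph V E) (e : E) (t : ℝ) : Γ.Point → ℤ
  | Sum.inl _ => 0
  | Sum.inr ⟨e', s⟩ => if e' = e then if (s : ℝ) ≤ t then 1 else 0 else 0

/-- The indicator function of the points of an edge at distance less than `t` from the source. -/
noncomputable def slopeLeft (Γ : MetricGraph V E) (e : E) (t : ℝ) : Γ.Point → ℤ
  | Sum.inl _ => 0
  | Sum.inr ⟨e', s⟩ => if e' = e then if (s : ℝ) < t then 1 else 0 else 0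

/-- The function on an edge, as a function of the position `t`, that bends at a given point. -/
noncomputable def ramp (Γ : MetricGraph V E) (e : E) (t : ℝ) : Γ.Point → ℝ
  | Sum.inl _ => 0
  | Sum.inr ⟨e', s⟩ => if e' = e then max (t - s) 0 else 0

theorem eventually_ramp_right (Γ : MetricGraph V E) (e : E) (t : ℝ) (x : Γ.Point) :
    ∀ᶠ s in nhdsWithin t (Set.Ioi t),
      Γ.ramp e s x = Γ.ramp e t x + Γ.slopeRight e t x * (s - t) := by
  rcases x with w | ⟨e', u⟩
  · simp [ramp, slopeRight]
  by_cases he : e' = e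
  swap
  · simp [ramp, slopeRight, he]
  rcases le_or_gt (u : ℝ) t with h | h
  · filter_upwards [self_mem_nhdsWithin] with s hs
    have hs' : t < s := hs
    simp only [ramp, slopeRight, he, h, if_true]
    rw [max_eq_left (by linarith), max_eq_left (by linarith)]
    push_cast; ring
  · filter_upwards [Ioo_mem_nhdsGT h] with s hs
    simp only [ramp, slopeRight, he, if_true, h.not_ge, if_false]
    rw [max_eq_right (by linarith [hs.2]), max_eq_right (by linarith)]
    simp

theorem eventually_ramp_left (Γ : MetricGraph V E) (e : E) (t : ℝ) (x : Γ.Point) :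
    ∀ᶠ s in nhdsWithin t (Set.Iio t),
      Γ.ramp e s x = Γ.ramp e t x - Γ.slopeLeft e t x * (t - s) := by
  rcases x with w | ⟨e', u⟩
  · simp [ramp, slopeLeft]
  by_cases he : e' = e
  swap
  · simp [ramp, slopeLeft, he]
  rcases lt_or_ge (u : ℝ) t with h | h
  · filter_upwards [Ioo_mem_nhdsLT h] with s hs
    simp only [ramp, slopeLeft, he, h, if_true]
    rw [max_eq_left (by linarith [hs.1]), max_eq_left (by linarith)]
    push_cast; ring
  · filter_upwards [self_mem_nhdsWithin] with s hs
    have hs' : s < t := hs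
    simp only [ramp, slopeLeft, he, if_true, h.not_gt, if_false]
    rw [max_eq_right (by linarith), max_eq_right (by linarith)]
    simp

theorem slopeRight_zero (Γ : MetricGraph V E) (e : E) : Γ.slopeRight e 0 = 0 := by
  ext x
  rcases x with w | ⟨e', u⟩
  · rfl
  · simp [slopeRight, u.2.1.not_ge]

theorem slopeLeft_len (Γ : MetricGraph V E) (e : E) : Γ.slopeLeft e (Γ.len e) = Γ.onEdge e := by
  ext x
  rcases x with w | ⟨e', u⟩
  · rfl
  · by_cases he : e' = e
    · subst he; simp [slopeLeft, onEdge, u.2.2]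
    · simp [slopeLeft, onEdge, he]

theorem ramp_zero (Γ : MetricGraph V E) (e : E) : Γ.ramp e 0 = 0 := by
  ext x
  rcases x with w | ⟨e', u⟩
  · rfl
  · simp [ramp, u.2.1.le]

theorem ramp_len (Γ : MetricGraph V E) (e : E) (x : Γ.Point) :
    Γ.ramp e (Γ.len e) x = Γ.len e * (Γ.onEdge e x - Γ.offset x e) := by
  have hl := (Γ.len_pos e).ne'
  rcases x with w | ⟨e', u⟩
  · simp [ramp, onEdge, offset]
  · by_cases he : e' = e
    · subst he
      simp only [ramp, onEdge, offset, if_true, Pi.single_eq_same]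
      rw [max_eq_left (by linarith [u.2.2])]
      push_cast
      field_simp
    · simp [ramp, onEdge, offset, he]

theorem slopeRight_sub_slopeLeft [DecidableEq V] (Γ : MetricGraph V E) (e : E) (t : ℝ)
    (ht : t ∈ Set.Ioo 0 (Γ.len e)) (x : Γ.Point) : Γ.slopeRight e t x - Γ.slopeLeft e t x =
      if x = Sum.inr ⟨e, ⟨t, ht⟩⟩ then 1 else 0 := by
  rcases x with w | ⟨e', u⟩
  · simp [slopeRight, slopeLeft]
  · by_cases he : e' = e
    · subst he
      simp only [slopeRight, slopeLeft, if_true, Sum.inr.injEq, Sigma.mk.injEq, heq_eq_eq, true_and,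
        Subtype.ext_iff]
      rcases lt_trichotomy (u : ℝ) t with h | h | h
      · simp [h, h.le, h.ne]
      · simp [h]
      · simp [h.not_ge, h.not_gt, h.ne']
    · simp [slopeRight, slopeLeft, he]

end Points

/-! ### Principal divisors and periods. -/

section Pairing

open Finsupp (linearCombination)

variable {V E : Type*}

theorem sum_smul_integral [DecidableEq V] [Fintype E] (Γ : MetricGraph V E)
    (p : Γ.Point → E → ℝ) (D : Γ.Divisor) :
    (D.sum fun x a => a • Γ.integral (p x)) = Γ.integral (linearCombination ℤ p D) := by
  have h := Finsupp.apply_linearCombination ℤ (Γ.integralMap.restrictScalars ℤ) p D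
  exact h.symm

theorem edgePoint_zero (Γ : MetricGraph V E) (e : E) : Γ.edgePoint e 0 = Sum.inl (Γ.src e) := by
  simp [edgePoint]

theorem edgePoint_len (Γ : MetricGraph V E) (e : E) :
    Γ.edgePoint e (Γ.len e) = Sum.inl (Γ.tgt e) := by
  simp [edgePoint, Γ.len_pos e]

theorem edgePoint_of_mem (Γ : MetricGraph V E) {e : E} {t : ℝ} (ht : t ∈ Set.Ioo 0 (Γ.len e)) :
    Γ.edgePoint e t = Sum.inr ⟨e, ⟨t, ht⟩⟩ := by
  simp [edgePoint, ht.1, ht.2]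

variable [DecidableEq E]

theorem pairing_ramp_right (Γ : MetricGraph V E) (D : Γ.Divisor) (e : E) (t : ℝ) :
    ∀ᶠ s in nhdsWithin t (Set.Ioi t),
      (linearCombination ℤ (Γ.ramp e s) D) = (linearCombination ℤ (Γ.ramp e t) D) +
        (linearCombination ℤ (Γ.slopeRight e t) D : ℤ) * (s - t) := by
  filter_upwards [(Filter.eventually_all_finset D.support).2 fun x _ =>
    Γ.eventually_ramp_right e t x] with s hs
  simp only [Finsupp.linearCombination_apply, Finsupp.sum, zsmul_eq_mul, Int.cast_sum,
    Finset.sum_mul, ← Finset.sum_add_distrib]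
  refine Finset.sum_congr rfl fun x hx => ?_
  rw [hs x hx]
  push_cast
  ring

theorem pairing_ramp_left (Γ : MetricGraph V E) (D : Γ.Divisor) (e : E) (t : ℝ) :
    ∀ᶠ s in nhdsWithin t (Set.Iio t),
      (linearCombination ℤ (Γ.ramp e s) D) = (linearCombination ℤ (Γ.ramp e t) D) -
        (linearCombination ℤ (Γ.slopeLeft e t) D : ℤ) * (t - s) := by
  filter_upwards [(Filter.eventually_all_finset D.support).2 fun x _ =>
    Γ.eventually_ramp_left e t x] with s hs
  simp only [Finsupp.linearCombination_apply, Finsupp.sum, zsmul_eq_mul, Int.cast_sum,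
    Finset.sum_mul, ← Finset.sum_sub_distrib]
  refine Finset.sum_congr rfl fun x hx => ?_
  rw [hs x hx]
  push_cast
  ring

theorem pairing_ramp_len (Γ : MetricGraph V E) (D : Γ.Divisor) (e : E) :
    (linearCombination ℤ (Γ.ramp e (Γ.len e)) D) =
      Γ.len e * ((linearCombination ℤ (Γ.onEdge e) D : ℤ) - (linearCombination ℤ Γ.offset D) e) :=
        by
  simp only [Finsupp.linearCombination_apply, Finsupp.sum, zsmul_eq_mul, Int.cast_sum,
    Finset.sum_apply, ← Finset.sum_sub_distrib, Finset.mul_sum, ramp_len]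
  refine Finset.sum_congr rfl fun x _ => ?_
  simp
  ring

theorem Connected.exists_isPathTo {Γ : MetricGraph V E} (hΓ : Γ.Connected) (v' : V)
    (x : Γ.Point) : ∃ c, Γ.IsPathTo v' x c := by
  rcases x with w | ⟨e, t⟩
  · obtain ⟨ξ, hξ⟩ := hΓ v' w
    exact ⟨_, ξ, hξ, rfl⟩
  · obtain ⟨ξ, hξ⟩ := hΓ v' (Γ.src e)
    exact ⟨_, ξ, hξ, rfl⟩

variable [DecidableEq V]

theorem pairing_slope_sub (Γ : MetricGraph V E) (D : Γ.Divisor) (e : E) (t : ℝ)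
    (ht : t ∈ Set.Ioo 0 (Γ.len e)) :
    (linearCombination ℤ (Γ.slopeRight e t) D) - (linearCombination ℤ (Γ.slopeLeft e t) D) =
      D (Sum.inr ⟨e, ⟨t, ht⟩⟩) := by
  simp only [Finsupp.linearCombination_apply, Finsupp.sum, ← Finset.sum_sub_distrib, ← smul_sub,
    Γ.slopeRight_sub_slopeLeft e t ht]
  simp only [smul_eq_mul, mul_ite, mul_one, mul_zero, Finset.sum_ite_eq', Finsupp.mem_support_iff,
    ne_eq, ite_not, ite_eq_right_iff]
  exact Eq.symm

variable [Fintype E]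

/-- The divisor on the vertices obtained by moving the points to their base vertices. -/
noncomputable def vertexDivisor (Γ : MetricGraph V E) (D : Γ.Divisor) : V → ℤ :=
  linearCombination ℤ (fun x => (Pi.single (Γ.basePoint x) 1 : V → ℤ)) D

theorem vertexDivisor_apply (Γ : MetricGraph V E) (D : Γ.Divisor) (w : V) :
    Γ.vertexDivisor D w = D (Sum.inl w) + ∑ e with Γ.src e = w,
      (linearCombination ℤ (Γ.onEdge e) D) := by
  have h : ∀ x : Γ.Point, (Pi.single (Γ.basePoint x) 1 : V → ℤ) w =
      (if x = Sum.inl w then 1 else 0) + ∑ e with Γ.src e = w, Γ.onEdge e x := by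
    rintro (u | ⟨e, t⟩)
    · simp [basePoint, onEdge, Pi.single_apply, eq_comm]
    · simp [basePoint, onEdge, Pi.single_apply, eq_comm]
  simp only [vertexDivisor, Finsupp.linearCombination_apply, Finsupp.sum, Finset.sum_apply,
    Pi.smul_apply, h, smul_eq_mul, mul_add, Finset.sum_add_distrib, Finset.mul_sum]
  rw [Finset.sum_comm]
  simp only [mul_ite, mul_one, mul_zero, Finset.sum_ite_eq', Finsupp.mem_support_iff, ne_eq,
    ite_not,
    add_left_inj, ite_eq_right_iff]
  exact Eq.symm

/-- The chain `c` is the sum of the chains of paths from `v'` to the points of `D`. -/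
def IsLift (Γ : MetricGraph V E) (v' : V) (D : Γ.Divisor) (c : E → ℝ) : Prop :=
  ∃ Z : E → ℤ, Γ.boundary ℤ Z = Γ.vertexDivisor D - Γ.degree D • Pi.single v' 1 ∧
    c = (fun e => (Z e : ℝ)) + (linearCombination ℤ Γ.offset D)

theorem IsLift.sub {Γ : MetricGraph V E} {v' : V} {D D' : Γ.Divisor} {c c' : E → ℝ}
    (h : Γ.IsLift v' D c) (h' : Γ.IsLift v' D' c') : Γ.IsLift v' (D - D') (c - c') := by
  obtain ⟨Z, hZ, rfl⟩ := h
  obtain ⟨Z', hZ', rfl⟩ := h'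
  have hdeg : Γ.degree (D - D') = Γ.degree D - Γ.degree D' := by
    unfold degree
    exact Finsupp.sum_sub_index fun _ _ _ => rfl
  refine ⟨Z - Z', ?_, ?_⟩
  · rw [map_sub, hZ, hZ', hdeg, sub_smul, vertexDivisor, vertexDivisor, vertexDivisor, map_sub]
    abel
  · rw [map_sub]
    ext e
    simp only [Pi.sub_apply, Pi.add_apply, Int.cast_sub]
    ring

theorem IsPathTo.exists_chain {Γ : MetricGraph V E} {v' : V} {x : Γ.Point} {c : E → ℝ}
    (h : Γ.IsPathTo v' x c) : ∃ ξ : E → ℤ,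
      Γ.boundary ℤ ξ = Pi.single (Γ.basePoint x) 1 - Pi.single v' 1 ∧
      c = (fun e => (ξ e : ℝ)) + Γ.offset x := by
  rcases x with w | ⟨e, t⟩
  · obtain ⟨ξ, hξ, rfl⟩ := h
    exact ⟨ξ, hξ.boundary, by simp [offset]⟩
  · obtain ⟨ξ, hξ, rfl⟩ := h
    exact ⟨ξ, hξ.boundary, rfl⟩

theorem isLift_of_paths (Γ : MetricGraph V E) {v' : V} {p : Γ.Point → E → ℝ}
    (hp : ∀ x, Γ.IsPathTo v' x (p x)) (D : Γ.Divisor) :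
      Γ.IsLift v' D (linearCombination ℤ p D) := by
  choose ξ hξ hpξ using fun x => (hp x).exists_chain
  refine ⟨(linearCombination ℤ ξ D), ?_, ?_⟩
  · have h1 : Γ.boundary ℤ (linearCombination ℤ ξ D) =
    (linearCombination ℤ (fun x => Γ.boundary ℤ (ξ x)) D) :=
      Finsupp.apply_linearCombination ℤ (Γ.boundary ℤ) ξ D
    rw [h1]
    simp only [hξ, vertexDivisor, degree, Finsupp.linearCombination_apply, Finsupp.sum, smul_sub,
      Finset.sum_sub_distrib, Finset.sum_smul]
  · ext e
    simp only [Finsupp.linearCombination_apply, Finsupp.sum, hpξ, Finset.sum_apply, Pi.add_apply,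
      Pi.smul_apply, smul_add, Finset.sum_add_distrib, Int.cast_sum]
    simp

/-- The outgoing slopes at the targets of the edges form an integral chain that differs from `Z` by
a cycle and from `-offset` by a gradient. -/
theorem integral_mem_of_principal [Fintype V] (Γ : MetricGraph V E) {v' : V} {D : Γ.Divisor}
    (hdeg : Γ.degree D = 0) (hD : D ∈ Γ.principal) {c : E → ℝ} (hc : Γ.IsLift v' D c) :
    Γ.integral c ∈ Γ.periodLattice := by
  obtain ⟨f, σ, τ, ⟨hσ, hτ⟩, hDv, hDe⟩ := hD
  obtain ⟨Z, hZ, rfl⟩ := hc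
  rw [hdeg, zero_smul, sub_zero] at hZ
  have hedge : ∀ e, f (Sum.inl (Γ.tgt e)) - f (Sum.inl (Γ.src e)) =
      σ e 0 * Γ.len e + (linearCombination ℤ (Γ.ramp e (Γ.len e)) D) ∧ τ e (Γ.len e) + σ e 0 +
        (linearCombination ℤ (Γ.onEdge e) D) = 0 := by
    intro e
    -- Removing from `f` its initial slope and the ramps at the points of `D` leaves a function on
    -- the edge without bends.
    obtain ⟨h1, h2⟩ := eq_of_locally_linear
      (F := fun t => f (Γ.edgePoint e t) - σ e 0 * t - (linearCombination ℤ (Γ.ramp e t) D))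
        (Γ.len_pos e)
      (fun t => σ e t - σ e 0 - (linearCombination ℤ (Γ.slopeRight e t) D))
      (fun t => τ e t + σ e 0 + (linearCombination ℤ (Γ.slopeLeft e t) D))
      (fun t ht => by
        filter_upwards [hσ e t ht, Γ.pairing_ramp_right D e t] with s hs hs'
        rw [hs, hs']
        push_cast
        ring)
      (fun t ht => by
        filter_upwards [hτ e t ht, Γ.pairing_ramp_left D e t] with s hs hs'
        rw [hs, hs']
        push_cast
        ring)
      (fun t ht => by
        have h1 := Γ.pairing_slope_sub D e t ht
        have h2 := hDe e ⟨t, ht⟩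
        simp only at h2
        linarith)
      (by rw [slopeRight_zero]; simp)
    rw [slopeLeft_len] at h2
    refine ⟨?_, h2⟩
    simp only [edgePoint_zero, edgePoint_len, ramp_zero] at h1
    have h3 : (linearCombination ℤ (0 : Γ.Point → ℝ) D) = 0 := by simp
    rw [h3] at h1
    linarith
  refine ⟨Z - fun e => τ e (Γ.len e), ?_, ?_⟩
  · rw [mem_homology_iff, map_sub, hZ]
    ext w
    rw [Pi.sub_apply, vertexDivisor_apply, hDv]
    simp only [boundary, LinearMap.coe_mk, AddHom.coe_mk, Pi.zero_apply]
    have h4 : ∑ e with Γ.src e = w, (linearCombination ℤ (Γ.onEdge e) D) =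
        ∑ e with Γ.src e = w, (-τ e (Γ.len e) - σ e 0) :=
      Finset.sum_congr rfl fun e _ => by linarith [(hedge e).2]
    rw [h4, Finset.sum_sub_distrib, Finset.sum_neg_distrib]
    ring
  · have h5 := Γ.integral_gradient (fun e => (linearCombination ℤ Γ.offset D) e + τ e (Γ.len e))
      (fun w => -f (Sum.inl w)) (fun e => by
        obtain ⟨h6, h7⟩ := hedge e
        rw [pairing_ramp_len] at h6
        have h8 : (τ e (Γ.len e) : ℝ) + σ e 0 + (linearCombination ℤ (Γ.onEdge e) D : ℤ) = 0 :=
          by exact_mod_cast h7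
        linear_combination (Γ.len e) * h8 + h6)
    have h9 := map_add Γ.integralMap (fun e => (((Z - fun e => τ e (Γ.len e)) e : ℤ) : ℝ))
      (fun e => (linearCombination ℤ Γ.offset D) e + τ e (Γ.len e))
    simp only [integralMap_apply, h5, add_zero] at h9
    rw [← h9]
    congr 1
    ext e
    simp

theorem principal_of_integral_mem (Γ : MetricGraph V E) (hΓ : Γ.Connected) {v' : V}
    {D : Γ.Divisor} (hdeg : Γ.degree D = 0) {c : E → ℝ} (hc : Γ.IsLift v' D c)
    (h : Γ.integral c ∈ Γ.periodLattice) : D ∈ Γ.principal := by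
  obtain ⟨Z₀, hZ₀, rfl⟩ := hc
  rw [hdeg, zero_smul, sub_zero] at hZ₀
  obtain ⟨u, hu, hint⟩ := h
  obtain ⟨g, hg⟩ := Γ.exists_gradient hΓ
    (((fun e => (Z₀ e : ℝ)) + (linearCombination ℤ Γ.offset D)) - fun e => (u e : ℝ)) (by
      have := map_sub Γ.integralMap ((fun e => (Z₀ e : ℝ)) + (linearCombination ℤ Γ.offset D))
        (fun e => (u e : ℝ))
      simp only [integralMap_apply, hint, sub_self] at this
      exact this)
  -- Subtracting the period `u` makes the lift a gradient, with potential `g`.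
  obtain ⟨Z, hZ⟩ : ∃ Z : E → ℤ, Z = Z₀ - u := ⟨_, rfl⟩
  have hZb : Γ.boundary ℤ Z = Γ.vertexDivisor D := by
    rw [hZ, map_sub, (Γ.mem_homology_iff u).1 hu, hZ₀, sub_zero]
  have hg' : ∀ e, (Z e + (linearCombination ℤ Γ.offset D) e) * Γ.len e = g (Γ.tgt e) -
      g (Γ.src e) := by
    intro e
    rw [← hg e, hZ]
    simp only [Pi.sub_apply, Pi.add_apply, Int.cast_sub]
    ring
  -- The initial slope on `e` is chosen so that the outgoing slope at the target is `Z e`; with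
  -- value `-g` at the vertices, the pieces on the edges then match at both ends.
  set a : E → ℤ := fun e => -(linearCombination ℤ (Γ.onEdge e) D) - Z e with ha
  set f : Γ.Point → ℝ := fun x => match x with
    | Sum.inl w => -g w
    | Sum.inr ⟨e, t⟩ => -g (Γ.src e) + a e * t + (linearCombination ℤ (Γ.ramp e t) D) with hf
  have hzero : ∀ M : Type, ∀ [AddCommGroup M], (linearCombination ℤ (0 : Γ.Point → M) D) = 0 := by
    intro M _; simp
  have hfe : ∀ e, ∀ t ∈ Set.Icc 0 (Γ.len e),
      f (Γ.edgePoint e t) = -g (Γ.src e) + a e * t + (linearCombination ℤ (Γ.ramp e t) D) := by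
    intro e t ht
    rcases ht.1.eq_or_lt with rfl | h0
    · rw [edgePoint_zero, ramp_zero, hzero]; simp [hf]
    rcases ht.2.eq_or_lt with rfl | h1
    · rw [edgePoint_len, pairing_ramp_len]
      have := hg' e
      simp only [hf, ha]
      push_cast
      linarith
    · rw [Γ.edgePoint_of_mem ⟨h0, h1⟩]
  refine ⟨f, fun e t => a e + (linearCombination ℤ (Γ.slopeRight e t) D),
      fun e t => -a e - (linearCombination ℤ (Γ.slopeLeft e t) D),
    ⟨fun e t ht => ?_, fun e t ht => ?_⟩, fun w => ?_, fun e t => ?_⟩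
  · filter_upwards [Γ.pairing_ramp_right D e t, Ioo_mem_nhdsGT ht.2] with s hs hs'
    rw [hfe e s ⟨ht.1.trans hs'.1.le, hs'.2.le⟩, hfe e t ⟨ht.1, ht.2.le⟩, hs]
    push_cast
    ring
  · filter_upwards [Γ.pairing_ramp_left D e t, Ioo_mem_nhdsLT ht.1] with s hs hs'
    rw [hfe e s ⟨hs'.1.le, hs'.2.le.trans ht.2⟩, hfe e t ⟨ht.1.le, ht.2⟩, hs]
    push_cast
    ring
  · have h1 := congrFun hZb w
    rw [vertexDivisor_apply] at h1
    simp only [boundary, LinearMap.coe_mk, AddHom.coe_mk] at h1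
    simp only [slopeRight_zero, slopeLeft_len, hzero, add_zero, ha, Finset.sum_sub_distrib,
      Finset.sum_neg_distrib, neg_sub, sub_neg_eq_add, add_sub_cancel_right]
    linarith
  · have := Γ.pairing_slope_sub D e t t.2
    simp only
    have h2 : D (Sum.inr ⟨e, t⟩) = D (Sum.inr ⟨e, ⟨(t : ℝ), t.2⟩⟩) := rfl
    rw [h2, ← this]
    ring

end Pairing

end MetricGraph

namespace MetricGraph

/-! ### The Abel–Jacobi bijection and lifts of types. -/

section AbelJacobi

variable {V E : Type*}

theorem degree_eq_linearCombination (Γ : MetricGraph V E) (D : Γ.Divisor) :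
    Γ.degree D = Finsupp.linearCombination ℤ (fun _ => (1 : ℤ)) D := by
  simp [degree, Finsupp.linearCombination_apply]

/-- Ties in rounding occur exactly on `S`, where the coordinate is half-integral; elsewhere `|y e| <
1 / 2` makes `Z e` the only rounding. -/
theorem dualBox_eq_of_flow [DecidableEq E] (Z : E → ℤ) (S : Finset E) (y : E → ℝ)
    (hS : ∀ e ∈ S, y e = 0)
    (hy : ∀ e, |y e| < 1 / 2) : dualBox (fun e => Z e + (if e ∈ S then 1 / 2 else 0) + y e) =
      Set.univ.pi fun e => if e ∈ S then Set.Icc (Z e : ℝ) (Z e + 1) else {(Z e : ℝ)} := by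
  ext c
  rw [mem_dualBox, Set.mem_univ_pi]
  refine forall_congr' fun e => ?_
  have h1 := abs_lt.1 (hy e)
  by_cases h : e ∈ S
  · have e1 : ⌈(Z e : ℝ) + 1 / 2 + 0 - 1 / 2⌉ = Z e := by
      rw [show (Z e : ℝ) + 1 / 2 + 0 - 1 / 2 = Z e by ring, Int.ceil_intCast]
    have e2 : ⌊(Z e : ℝ) + 1 / 2 + 0 + 1 / 2⌋ = Z e + 1 := by
      rw [show (Z e : ℝ) + 1 / 2 + 0 + 1 / 2 = (Z e + 1 : ℤ) by push_cast; ring, Int.floor_intCast]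
    simp only [h, if_true, hS e h, e1, e2, Set.mem_Icc]
    push_cast
    rfl
  · have e1 : ⌈(Z e : ℝ) + 0 + y e - 1 / 2⌉ = Z e := by
      rw [Int.ceil_eq_iff]; constructor <;> linarith
    have e2 : ⌊(Z e : ℝ) + 0 + y e + 1 / 2⌋ = Z e := by
      rw [Int.floor_eq_iff]; constructor <;> linarith
    simp only [h, if_false, e1, e2, Set.mem_singleton_iff]
    exact ⟨fun h => le_antisymm h.2 h.1, fun h => ⟨h.ge, h.le⟩⟩

theorem IsOfType.degree [Fintype V] {Γ : MetricGraph V E} {S : Finset E} {m : V → ℤ} {D : Γ.Divisor}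
    (h : Γ.IsOfType S m D) : Γ.degree D = S.card + ∑ v, m v := by
  obtain ⟨t, rfl⟩ := h
  rw [degree_eq_linearCombination]
  simp [add_comm]

variable [DecidableEq V] [Fintype E] [DecidableEq E]

/-- The half edges in `z` spread each point of `S` from its source evenly over both ends, which is
the convention of `demand`. -/
theorem boundary_of_flow (Γ : MetricGraph V E) (v' : V) {d : ℤ} {p : V → ℝ} {S : Finset E}
    {m : V → ℤ} {Z : E → ℤ}
    (hZ : Γ.boundary ℤ Z = m + ∑ e ∈ S, Pi.single (Γ.src e) 1 - d • Pi.single v' 1) (y : E → ℝ) :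
    Γ.boundary ℝ (fun e => Z e + (if e ∈ S then 1 / 2 else 0) + y e) =
        p - d • Pi.single v' 1 ↔ Γ.boundary ℝ y = -Γ.demand p S m := by
  have h1 : (fun e => (Z e : ℝ) + (if e ∈ S then 1 / 2 else 0) + y e) =
      (fun e => (Z e : ℝ)) + ∑ e ∈ S, Pi.single e (1 / 2) + y := by
    ext e; simp [Pi.single_apply]
  have h2 : ∀ v, Γ.boundary ℝ (∑ e ∈ S, Pi.single e (1 / 2)) v = 1 / 2 * ∑ e, (if e ∈ S then
      ((if Γ.tgt e = v then 1 else 0) - (if Γ.src e = v then 1 else 0) : ℝ) else 0) := by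
    intro v
    rw [map_sum, Finset.mul_sum]
    simp only [boundary_single, Finset.sum_apply, Pi.sub_apply, Pi.single_apply]
    rw [← Finset.sum_filter_add_sum_filter_not Finset.univ (· ∈ S)]
    have h3 : ∑ e with e ∉ S, 1 / 2 * (if e ∈ S then
      ((if Γ.tgt e = v then 1 else 0) - (if Γ.src e = v then 1 else 0) : ℝ) else 0) = 0 :=
      Finset.sum_eq_zero fun e he => by simp [(Finset.mem_filter.1 he).2]
    rw [h3, add_zero]
    refine Finset.sum_congr (by ext; simp) fun e he => ?_
    rw [if_pos (Finset.mem_filter.1 he).2, mul_sub]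
    simp [eq_comm]
  rw [h1, map_add, map_add, boundary_intCast, hZ, funext_iff, funext_iff]
  refine forall_congr' fun v => ?_
  have h4 : ∑ e, (if e ∈ S then
      ((if Γ.src e = v then 1 else 0) + (if Γ.tgt e = v then 1 else 0) : ℝ) else 0) - ∑ e, (if e ∈ S then
      ((if Γ.tgt e = v then 1 else 0) - (if Γ.src e = v then 1 else 0) : ℝ) else 0) =
      2 * ((∑ e ∈ S, (Pi.single (Γ.src e) 1 : V → ℤ) v : ℤ) : ℝ) := by
    rw [← Finset.sum_sub_distrib, Int.cast_sum, Finset.mul_sum,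
      ← Finset.sum_filter_add_sum_filter_not Finset.univ (· ∈ S)]
    rw [Finset.sum_eq_zero (s := Finset.univ.filter (· ∉ S))
      fun e he => by simp [(Finset.mem_filter.1 he).2], add_zero]
    refine Finset.sum_congr (by ext; simp) fun e he => ?_
    have he' : e ∈ S := by simpa using he
    simp only [he', if_true, Pi.single_apply, eq_comm (a := v)]
    push_cast
    ring
  simp only [Pi.add_apply, Pi.sub_apply, Pi.neg_apply, demand, h2, Finset.sum_apply,
    Int.cast_add, Int.cast_sub, Pi.smul_apply]
  have h5 : (((d • (Pi.single v' 1 : V → ℤ) v : ℤ)) : ℝ) = d • (Pi.single v' 1 : V → ℝ) v := by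
    simp only [Pi.single_apply]; split_ifs <;> simp
  rw [h5]
  constructor <;> intro h <;> linarith

variable [Fintype V]

/-- The lifts of divisors of type `(S, m)`. -/
theorem isLift_type_iff (Γ : MetricGraph V E) (v' : V) {d : ℤ} {S : Finset E} {m : V → ℤ}
    (hd : (S.card : ℤ) + ∑ v, m v = d) (t : ∀ e, Set.Ioo (0 : ℝ) (Γ.len e)) (c : E → ℝ) :
    Γ.IsLift v' (∑ v, Finsupp.single (Sum.inl v) (m v) +
      ∑ e ∈ S, Finsupp.single (Sum.inr ⟨e, t e⟩) 1) c ↔ ∃ Z : E → ℤ,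
        Γ.boundary ℤ Z = m + ∑ e ∈ S, Pi.single (Γ.src e) 1 - d • Pi.single v' 1 ∧
        c = fun e => Z e + if e ∈ S then (t e : ℝ) / Γ.len e else 0 := by
  have h1 : Γ.degree (∑ v, Finsupp.single (Sum.inl v) (m v) +
      ∑ e ∈ S, Finsupp.single (Sum.inr ⟨e, t e⟩) 1) = d := by
    rw [← hd]; exact IsOfType.degree ⟨t, rfl⟩
  have h2 : Γ.vertexDivisor (∑ v, Finsupp.single (Sum.inl v) (m v) +
      ∑ e ∈ S, Finsupp.single (Sum.inr ⟨e, t e⟩) 1) = m + ∑ e ∈ S, Pi.single (Γ.src e) 1 := by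
    rw [vertexDivisor]
    simp only [map_add, map_sum, Finsupp.linearCombination_single, basePoint, one_smul]
    congr 1
    ext v
    simp [Pi.single_apply]
  have h3 : Finsupp.linearCombination ℤ Γ.offset (∑ v, Finsupp.single (Sum.inl v) (m v) +
      ∑ e ∈ S, Finsupp.single (Sum.inr ⟨e, t e⟩) 1) =
        fun e => if e ∈ S then (t e : ℝ) / Γ.len e else 0 := by
    ext e
    simp [offset, Pi.single_apply]
  rw [IsLift, h1, h2, h3]
  rfl

/-- The Abel–Jacobi bijection. -/
theorem exists_abelJacobi (Γ : MetricGraph V E) (hΓ : Γ.Connected) (v' : V) (d : ℤ) :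
    ∃ ι : Γ.PicDeg d ≃ Γ.Torus, ∀ (x : Γ.PicDeg d) (D : Γ.Divisor), Γ.degree D = d →
      (D : Γ.Pic) = x → ∀ c, Γ.IsLift v' D c → ι x = (Γ.integral c : Γ.Torus) := by
  choose p hp using hΓ.exists_isPathTo v'
  have key : ∀ D D' : Γ.Divisor, Γ.degree D = d → Γ.degree D' = d → ∀ c c', Γ.IsLift v' D c →
      Γ.IsLift v' D' c' → ((D : Γ.Pic) = (D' : Γ.Pic) ↔
        (Γ.integral c : Γ.Torus) = (Γ.integral c' : Γ.Torus)) := by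
    intro D D' hD hD' c c' hc hc'
    have hdeg : Γ.degree (D - D') = 0 := by
      rw [degree_eq_linearCombination, map_sub, ← degree_eq_linearCombination,
        ← degree_eq_linearCombination, hD, hD', sub_self]
    have hsub : Γ.integral (c - c') = Γ.integral c - Γ.integral c' := map_sub Γ.integralMap c c'
    rw [QuotientAddGroup.eq_iff_sub_mem, QuotientAddGroup.eq_iff_sub_mem, ← hsub]
    exact ⟨fun h => Γ.integral_mem_of_principal hdeg h (hc.sub hc'),
      fun h => Γ.principal_of_integral_mem hΓ hdeg (hc.sub hc') h⟩
  choose rep hrep hrep' using fun x : Γ.PicDeg d => x.2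
  have hlift := fun x => Γ.isLift_of_paths hp (rep x)
  set f : Γ.PicDeg d → Γ.Torus := fun x =>
    (Γ.integral (Finsupp.linearCombination ℤ p (rep x)) : Γ.Torus) with hf
  have hbij : Function.Bijective f := by
    constructor
    · intro x y hxy
      have := (key _ _ (hrep x) (hrep y) _ _ (hlift x) (hlift y)).2 hxy
      rw [hrep', hrep'] at this
      exact Subtype.ext this
    · intro y
      obtain ⟨y, rfl⟩ := QuotientAddGroup.mk_surjective y
      obtain ⟨c, rfl⟩ := Γ.integral_surjective y
      -- For surjectivity, the fractional parts of a chain give points inside edges, and the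
      -- boundary of its integral part gives the multidegree.
      set S : Finset E := Finset.univ.filter fun e => Int.fract (c e) ≠ 0 with hS
      set m : V → ℤ := Γ.boundary ℤ (fun e => ⌊c e⌋) - ∑ e ∈ S, Pi.single (Γ.src e) 1 +
        d • Pi.single v' 1 with hm
      have hd : (S.card : ℤ) + ∑ v, m v = d := by
        simp only [hm, Pi.add_apply, Pi.sub_apply, Finset.sum_add_distrib, Finset.sum_sub_distrib,
          sum_boundary, Finset.sum_apply]
        rw [Finset.sum_comm]
        simp [← Finset.mul_sum]
      set t : ∀ e, Set.Ioo (0 : ℝ) (Γ.len e) := fun e =>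
        if h : Int.fract (c e) ≠ 0 then ⟨Int.fract (c e) * Γ.len e,
          mul_pos ((Int.fract_nonneg _).lt_of_ne' h) (Γ.len_pos e),
          (mul_lt_iff_lt_one_left (Γ.len_pos e)).2 (Int.fract_lt_one _)⟩
        -- A default position; edges outside `S` carry no point.
        else ⟨Γ.len e / 2, half_pos (Γ.len_pos e), half_lt_self (Γ.len_pos e)⟩ with ht
      have hc := (Γ.isLift_type_iff v' hd t c).2 ⟨fun e => ⌊c e⌋, by rw [hm]; abel, by
        ext e
        by_cases h : Int.fract (c e) ≠ 0
        · rw [if_pos (by simpa [hS] using h)]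
          simp only [ht, dif_pos h]
          rw [mul_div_cancel_right₀ _ (Γ.len_pos e).ne', Int.floor_add_fract]
        · rw [if_neg (by simpa [hS] using h)]
          rw [not_not] at h
          have := Int.floor_add_fract (c e)
          rw [h] at this
          exact this.symm⟩
      have hdeg := IsOfType.degree (Γ := Γ) (S := S) (m := m) ⟨t, rfl⟩
      rw [hd] at hdeg
      refine ⟨⟨_, _, hdeg, rfl⟩, ?_⟩
      refine ((key _ _ hdeg (hrep _) _ _ hc (hlift _)).1 ?_).symm
      rw [hrep']
  refine ⟨Equiv.ofBijective f hbij, fun x D hD hDx c hc => ?_⟩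
  exact (key _ _ (hrep x) hD _ _ (hlift x) hc).1 ((hrep' x).trans hDx.symm)

end AbelJacobi

/-! ### From cells to decompositions of the torus. -/

section Decomposition

variable {V E : Type*} [DecidableEq V] [Fintype E]

/-- Its preimage is the union of the period translates of `P`, a locally finite family of compact
sets. No discreteness of `Λ` is needed separately. -/
theorem isClosed_image_torus (Γ : MetricGraph V E) {q : V → ℝ} {P : Set Γ.Dual}
    (hP : P ∈ Γ.mixedCells q) : IsClosed ((fun x : Γ.Dual => (x : Γ.Torus)) '' P) := by
  have hq : Topology.IsQuotientMap (fun x : Γ.Dual => (x : Γ.Torus)) :=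
    QuotientAddGroup.isOpenQuotientMap_mk.isQuotientMap
  rw [← hq.isClosed_preimage]
  have hpre : (fun x : Γ.Dual => (x : Γ.Torus)) ⁻¹' ((fun x : Γ.Dual => (x : Γ.Torus)) '' P) =
      ⋃ Q : {Q : Set Γ.Dual // ∃ x ∈ Γ.periodLattice, Q = (fun y => y + x) '' P}, Q.1 := by
    ext y
    rw [Set.mem_iUnion]
    constructor
    · rintro ⟨z, hz, hzy⟩
      have h1 : y - z ∈ Γ.periodLattice := QuotientAddGroup.eq_iff_sub_mem.1 (Eq.symm hzy)
      exact ⟨⟨_, y - z, h1, rfl⟩, z, hz, add_sub_cancel z y⟩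
    · rintro ⟨⟨_, x, hx, rfl⟩, z, hz, rfl⟩
      refine ⟨z, hz, Eq.symm (QuotientAddGroup.eq_iff_sub_mem.2 ?_)⟩
      convert hx using 1
      exact add_sub_cancel_left z x
  have hmem : ∀ Q : {Q : Set Γ.Dual // ∃ x ∈ Γ.periodLattice, Q = (fun y => y + x) '' P},
      Q.1 ∈ Γ.mixedCells q := by
    rintro ⟨_, x, hx, rfl⟩
    exact Γ.mixedCells_translate hP hx
  rw [hpre]
  refine LocallyFinite.isClosed_iUnion (fun x => ?_) fun Q => ?_
  · have hball : Metric.ball x 1 ∈ nhds x := Metric.ball_mem_nhds (α := Γ.Dual) _ one_pos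
    refine ⟨_, hball, ?_⟩
    refine ((Γ.mixedCells_finite q (‖x‖ + 1)).preimage Subtype.val_injective.injOn).subset ?_
    rintro Q ⟨y, hyQ, hy⟩
    refine ⟨hmem Q, y, hyQ, ?_⟩
    have h1 : dist y x < 1 := hy
    have h2 := norm_le_norm_add_norm_sub x y
    rw [dist_comm] at h1
    have h3 : ‖x - y‖ < 1 := (dist_eq_norm (E := Γ.Dual) x y).symm.trans_lt h1
    linarith
  · obtain ⟨z, -, hz⟩ := hmem Q
    rw [hz]
    exact (Γ.isCompact_dualBox_image z).isClosed

variable [DecidableEq E] [Fintype V]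

/-- The boundary of `Z` depends only on the type, so one `Z` serves all positions of the points and
the classes form the image of an open cube. The closed cube lies in its closure by continuity, and
`hcl` gives the converse. -/
theorem theta_eq (Γ : MetricGraph V E) (v' : V) {d : ℤ} (ι : Γ.PicDeg d ≃ Γ.Torus)
    (hι : ∀ (x : Γ.PicDeg d) (D : Γ.Divisor), Γ.degree D = d →
      (D : Γ.Pic) = x → ∀ c, Γ.IsLift v' D c → ι x = (Γ.integral c : Γ.Torus))
    {S : Finset E} {m : V → ℤ} (hd : (S.card : ℤ) + ∑ v, m v = d) {Z : E → ℤ}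
    (hZ : Γ.boundary ℤ Z = m + ∑ e ∈ S, Pi.single (Γ.src e) 1 - d • Pi.single v' 1)
    (hcl : IsClosed ((fun x : Γ.Dual => (x : Γ.Torus)) '' (Γ.integral ''
      Set.univ.pi fun e => if e ∈ S then Set.Icc (Z e : ℝ) (Z e + 1) else {(Z e : ℝ)}))) :
    Γ.theta ι S m = (fun x : Γ.Dual => (x : Γ.Torus)) '' (Γ.integral ''
      Set.univ.pi fun e => if e ∈ S then Set.Icc (Z e : ℝ) (Z e + 1) else {(Z e : ℝ)}) := by
  have hopen : ι '' Γ.thetaOpen d S m = (fun x : Γ.Dual => (x : Γ.Torus)) '' (Γ.integral ''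
      Set.univ.pi fun e => if e ∈ S then Set.Ioo (Z e : ℝ) (Z e + 1) else {(Z e : ℝ)}) := by
    ext y
    constructor
    · rintro ⟨x, ⟨D, ⟨t, rfl⟩, hDx⟩, rfl⟩
      have hdeg := IsOfType.degree (Γ := Γ) (S := S) (m := m) ⟨t, rfl⟩
      rw [hd] at hdeg
      have hc := (Γ.isLift_type_iff v' hd t _).2 ⟨Z, hZ, rfl⟩
      refine ⟨_, ⟨_, ?_, rfl⟩, (hι x _ hdeg hDx _ hc).symm⟩
      rw [Set.mem_univ_pi]
      intro e
      split_ifs with h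
      · have h1 : 0 < (t e : ℝ) / Γ.len e := div_pos (t e).2.1 (Γ.len_pos e)
        have h2 : (t e : ℝ) / Γ.len e < 1 := (div_lt_one (Γ.len_pos e)).2 (t e).2.2
        constructor <;> linarith
      · simp
    · rintro ⟨_, ⟨c, hc, rfl⟩, rfl⟩
      rw [Set.mem_univ_pi] at hc
      have hcS : ∀ e ∈ S, 0 < c e - Z e ∧ c e - Z e < 1 := by
        intro e he
        have h := hc e
        rw [if_pos he] at h
        exact ⟨by linarith [h.1], by linarith [h.2]⟩
      set t : ∀ e, Set.Ioo (0 : ℝ) (Γ.len e) := fun e =>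
        if h : e ∈ S then ⟨(c e - Z e) * Γ.len e, mul_pos (hcS e h).1 (Γ.len_pos e),
          (mul_lt_iff_lt_one_left (Γ.len_pos e)).2 (hcS e h).2⟩
        else ⟨Γ.len e / 2, half_pos (Γ.len_pos e), half_lt_self (Γ.len_pos e)⟩ with ht
      have hdeg := IsOfType.degree (Γ := Γ) (S := S) (m := m) ⟨t, rfl⟩
      rw [hd] at hdeg
      have hc := (Γ.isLift_type_iff v' hd t c).2 ⟨Z, hZ, by
        ext e
        by_cases h : e ∈ S
        · simp only [h, if_true, ht, dif_pos]
          rw [mul_div_cancel_right₀ _ (Γ.len_pos e).ne']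
          ring
        · have h1 := hc e
          rw [if_neg h] at h1
          simpa [h] using h1⟩
      exact ⟨⟨_, _, hdeg, rfl⟩, ⟨_, ⟨t, rfl⟩, rfl⟩, hι _ _ hdeg rfl c hc⟩
  have hcont : Continuous fun c : E → ℝ => (Γ.integral c : Γ.Torus) :=
    continuous_quot_mk.comp Γ.continuous_integral
  have hclos : closure (Set.univ.pi fun e => if e ∈ S then Set.Ioo (Z e : ℝ) (Z e + 1) else
      {(Z e : ℝ)}) = Set.univ.pi fun e => if e ∈ S then Set.Icc (Z e : ℝ) (Z e + 1) else
      {(Z e : ℝ)} := by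
    rw [closure_pi_set]
    congr 1
    ext1 e
    split_ifs
    · exact closure_Ioo (lt_add_one _).ne
    · exact closure_singleton
  rw [theta, hopen]
  refine Set.Subset.antisymm (closure_minimal ?_ hcl) ?_
  · refine Set.image_mono (Set.image_mono (Set.pi_mono fun e _ => ?_))
    split_ifs
    · exact Set.Ioo_subset_Icc_self
    · exact subset_rfl
  · rw [Set.image_image, Set.image_image, ← hclos]
    exact image_closure_subset_closure_image hcont

/-- The closures of the sets of divisors of the types with a strict flow to `p` form an admissible
decomposition of the torus. -/
theorem isAdmissibleTorusDecomposition_strictFlow (Γ : MetricGraph V E) (hΓ : Γ.Connected)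
    (A : AddSubgroup ℝ) (hA : ∀ e, Γ.len e ∈ A) {n : ℕ} (φ : Γ.Dual ≃ₗ[ℝ] (Fin n → ℝ))
    (hφ : ∀ x : Γ.Dual, x ∈ Γ.dualLattice ↔ ∀ i, ∃ k : ℤ, φ x i = k) (v' : V) {d : ℤ}
    (ι : Γ.PicDeg d ≃ Γ.Torus)
    (hι : ∀ (x : Γ.PicDeg d) (D : Γ.Divisor), Γ.degree D = d →
      (D : Γ.Pic) = x → ∀ c, Γ.IsLift v' D c → ι x = (Γ.integral c : Γ.Torus))
    {p : V → ℝ} (hp : ∑ v, p v = d) :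
    Γ.IsAdmissibleTorusDecomposition A φ {T | ∃ (S : Finset E) (m : V → ℤ),
      (S.card : ℤ) + ∑ v, m v = d ∧ Γ.HasStrictFlow p S m ∧ T = Γ.theta ι S m} := by
  have hq : ∑ v, (p - d • Pi.single v' 1 : V → ℝ) v = 0 := by
    simp [hp, ← Finset.mul_sum]
  refine ⟨_, Γ.isAdmissiblePeriodicDecomposition_mixedCells hΓ A hA φ hφ hq, ?_⟩
  have hpre : ∀ P : Set Γ.Dual, φ ⁻¹' (φ '' P) = P := fun P =>
    Set.preimage_image_eq P φ.injective
  have key : ∀ (S : Finset E) (m : V → ℤ) (Z : E → ℤ) (y : E → ℝ),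
      (S.card : ℤ) + ∑ v, m v = d →
      Γ.boundary ℤ Z = m + ∑ e ∈ S, Pi.single (Γ.src e) 1 - d • Pi.single v' 1 →
      (∀ e ∈ S, y e = 0) → (∀ e, |y e| < 1 / 2) →
      Γ.boundary ℝ (fun e => Z e + (if e ∈ S then 1 / 2 else 0) + y e) = p - d • Pi.single v' 1 →
      Γ.theta ι S m = (fun x : Γ.Dual => (x : Γ.Torus)) ''
        (Γ.integral '' dualBox fun e => Z e + (if e ∈ S then 1 / 2 else 0) + y e) := by
    intro S m Z y hd hZ hyS hy hz
    have hcl := Γ.isClosed_image_torus ⟨_, hz, rfl⟩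
    rw [dualBox_eq_of_flow Z S y hyS hy] at hcl ⊢
    exact Γ.theta_eq v' ι hι hd hZ hcl
  ext T
  constructor
  · rintro ⟨S, m, hd, ⟨y, hyS, hy, hb⟩, rfl⟩
    obtain ⟨Z, hZ⟩ := hΓ.exists_boundary_eq
      (m + ∑ e ∈ S, Pi.single (Γ.src e) 1 - d • Pi.single v' 1 : V → ℤ) (by
        simp only [Pi.add_apply, Pi.sub_apply, Finset.sum_add_distrib, Finset.sum_sub_distrib,
          Finset.sum_apply]
        rw [Finset.sum_comm, ← hd]
        simp [← Finset.mul_sum]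
        ring)
    have hz := (Γ.boundary_of_flow v' hZ y).2 hb
    refine ⟨_, ⟨_, ⟨_, hz, rfl⟩, rfl⟩, ?_⟩
    simp only [hpre]
    exact key S m Z y hd hZ hyS hy hz
  · rintro ⟨_, ⟨_, ⟨z, hz, rfl⟩, rfl⟩, rfl⟩
    simp only [hpre]
    -- Conversely, a type is read off from `z`: round to the nearest integer with ties going down,
    -- let `S` be the set of ties, and let `y` be the remaining error.
    set Z : E → ℤ := fun e => ⌈z e - 1 / 2⌉ with hZdef
    set S : Finset E := Finset.univ.filter fun e => z e = Z e + 1 / 2 with hS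
    set m : V → ℤ := Γ.boundary ℤ Z - ∑ e ∈ S, Pi.single (Γ.src e) 1 + d • Pi.single v' 1 with hm
    set y : E → ℝ := fun e => z e - Z e - if e ∈ S then 1 / 2 else 0 with hy
    have hd : (S.card : ℤ) + ∑ v, m v = d := by
      simp only [hm, Pi.add_apply, Pi.sub_apply, Finset.sum_add_distrib, Finset.sum_sub_distrib,
        sum_boundary, Finset.sum_apply]
      rw [Finset.sum_comm]
      simp [← Finset.mul_sum]
    have hZ : Γ.boundary ℤ Z = m + ∑ e ∈ S, Pi.single (Γ.src e) 1 - d • Pi.single v' 1 := by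
      rw [hm]; abel
    have hzy : z = fun e => Z e + (if e ∈ S then 1 / 2 else 0) + y e := by
      ext e; simp only [hy]; ring
    have hyS : ∀ e ∈ S, y e = 0 := by
      intro e he
      have : z e = Z e + 1 / 2 := by simpa [hS] using he
      simp only [hy, he, if_true]
      linarith
    have hyb : ∀ e, |y e| < 1 / 2 := by
      intro e
      by_cases he : e ∈ S
      · rw [hyS e he]; norm_num
      · have h1 : z e ≠ Z e + 1 / 2 := by simpa [hS] using he
        have h2 := Int.le_ceil (z e - 1 / 2)
        have h3 := Int.ceil_lt_add_one (z e - 1 / 2)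
        have h4 : z e < Z e + 1 / 2 := lt_of_le_of_ne (by simp only [hZdef]; linarith) h1
        simp only [hy, he, if_false]
        rw [abs_lt]
        constructor
        · simp only [hZdef]; linarith
        · linarith
    have hz' := hz
    rw [hzy] at hz'
    refine ⟨S, m, hd, ⟨y, hyS, hyb, (Γ.boundary_of_flow v' hZ y).1 hz'⟩, ?_⟩
    rw [key S m Z y hd hZ hyS hyb hz', ← hzy]

end Decomposition

end MetricGraph

theorem mainTheorem7 {K : Type*} [NontriviallyNormedField K] [IsUltrametricDist K]
    {V E : Type*} [Fintype V] [DecidableEq V] [Fintype E] [DecidableEq E]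
    (Γ : MetricGraph V E) (hconn : Γ.Connected) (hlen : ∀ e, Γ.len e ∈ valueGroup K)
    (H : V → ℤ) (hH : ∀ w, 0 < H w) (d : ℤ) (v v' : V)
    {n : ℕ} (φ : Γ.Dual ≃ₗ[ℝ] (Fin n → ℝ))
    (hφ : ∀ x : Γ.Dual, x ∈ Γ.dualLattice ↔ ∀ i, ∃ k : ℤ, φ x i = k) :
    ∃ ι : Γ.PicDeg d ≃ Γ.Torus, Γ.IsAbelJacobi v' ι ∧
      Γ.IsAdmissibleTorusDecomposition (valueGroup K) φ (Γ.polystableCells H ι) ∧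
      Γ.IsAdmissibleTorusDecomposition (valueGroup K) φ (Γ.quasistableCells H v ι) := by
  obtain ⟨ι, hι⟩ := Γ.exists_abelJacobi hconn v' d
  have : Nonempty V := ⟨v⟩
  refine ⟨ι, fun x D hD hDx p hp => ?_, ?_, ?_⟩
  · rw [Γ.sum_smul_integral]
    exact hι x D hD hDx _ (Γ.isLift_of_paths hp D)
  · have hsum := Γ.sum_canonicalWeight H
      (Finset.sum_pos (fun w _ => hH w) Finset.univ_nonempty) d
    convert Γ.isAdmissibleTorusDecomposition_strictFlow hconn (valueGroup K) hlen φ hφ v' ι hι hsum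
      using 1
    ext T
    exact exists₂_congr fun S m => and_congr_right fun hd =>
      and_congr_left fun _ => Γ.isPolystable_iff hH hd
  · obtain ⟨p, hp, hqs⟩ := Γ.exists_isQuasistable_iff hH v d
    convert Γ.isAdmissibleTorusDecomposition_strictFlow hconn (valueGroup K) hlen φ hφ v' ι hι hp
      using 1
    ext T
    exact exists₂_congr fun S m => and_congr_right fun hd =>
      and_congr_left fun _ => hqs S m hd
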